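/- **Conventions.** Indices are natural numbers coding algorithms ($\varphi_e$ is the $e$-th partial computable function, $W_e$ its domain); finite objects (words, rationals, $*$-polynomials over $\mathbb{Q}(i)$) are coded by natural numbers in a fixed effective way. C*-algebras need not be unital. A *presentation* $\mathbf{A}^\#$ of a C*-algebra $\mathbf{A}$ is a sequence $(a_n)_{n\in\mathbb N}$ in $\mathbf{A}$ (the special points) generating a dense $*$-subalgebra; its *rational points* are the values $p(a_0,\dots,a_n)$ of $*$-polynomials $p$ over $\mathbb{Q}(i)$ without constant term. It is *c.e.*, with index $e$, if $e$ is an index of an algorithm that, given (a code of) a rational point $\rho$, enumerates a decreasing sequence of rationals converging to $\|\rho\|$. A $*$-homomorphism $\phi:\mathbf{A}\to\mathbf{B}$ is *computable* from $\mathbf{A}^\#$ to $\mathbf{B}^\#$, with index $d$, if algorithm $d$, given a rational point $\rho$ of $\mathbf{A}^\#$ and $k\in\mathbb N$, computes a rational point $\sigma$ of $\mathbf{B}^\#$ with $\|\phi(\rho)-\sigma\|<2^{-k}$. A *presentation* of a group $G$ is an epimorphism $\nu:F_\omega\to G$ from the free group on $x_0,x_1,\dots$; a word $w$ is a *label* of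 $\nu(w)$. It is *c.e.*, with index $e$, if $\{(w,w'):\nu(w)=\nu(w')\}$ is the c.e. set with index $e$. A homomorphism $\psi:G\to H$ is *computable* from $(G,\nu)$ to $(H,\nu')$, with index $d$, if algorithm $d$ maps every label of every $a\in G$ to a label of $\psi(a)$. For a unital C*-algebra $\mathbf{B}$, $K_0(\mathbf{B})$ is the Grothendieck group of the abelian semigroup of Murray–von Neumann classes of projections in the matrix algebras $M_n(\mathbf{B})$, with addition induced by $p\oplus q$. For any $\mathbf{A}$, with unitization $\widetilde{\mathbf{A}}$ and $\pi:\widetilde{\mathbf{A}}\to\mathbb{C}$ the projection $(a,\alpha)\mapsto\alpha$, $K_0(\mathbf{A})=\ker\big(K_0(\pi):K_0(\widetilde{\mathbf{A}})\to K_0(\mathbb{C})\big)$; for a $*$-homomorphism $\phi$, $K_0(\phi)$ is the restriction of $K_0(\widetilde\phi)$. With $S\mathbf{A}=C_0(0,1)\otimes\mathbf{A}=C_0((0,1),\mathbf{A})$ and $S\phi(h)=\phi\circ h$, put $K_1=K_0\circ S$. A presentation $\mathbf{A}^\#$ induces a presentation $S\mathbf{A}^\#$, whose special points are the $F\otimes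 a$ with $F$ a rational point of $C_0(0,1)^\#$ (special points: the rational polygonal curves vanishing at $0$ and $1$) and $a$ a rational point of $\mathbf{A}^\#$, and a presentation $\widetilde{S\mathbf{A}}^\#$, whose special points are the pairs $(b,\alpha)$ with $b$ a special point of $S\mathbf{A}^\#$ and $\alpha\in\mathbb{Q}(i)$. (These special points are listed effectively; codes that list nothing are assigned $0$.) An *index* of a projection $p\in M_n(\widetilde{S\mathbf{A}})$ is an index of an algorithm that computes, for each $k$ and each position, a rational point of $\widetilde{S\mathbf{A}}^\#$ within $2^{-k}$ of the entry of $p$ there. **Theorem.** $K_1$ is a computable functor from the category of c.e. presentations of C*-algebras (with computable $*$-homomorphisms) to the category of c.e. presentations of groups (with computable homomorphisms). That is: $K_1(\mathrm{id})=\mathrm{id}$ and $K_1(\psi\circ\phi)=K_1(\psi)\circ K_1(\phi)$, and one can assign * to every c.e. presentation $\mathbf{A}^\#$ a presentation $K_1(\mathbf{A}^\#)$ of $K_1(\mathbf{A})$, * to every c.e. presentation $\mathbf{A}^\#$ together with an index $e$ of it a presentation $K_1(\mathbf{A}^\#,e)$ of $K_1(\mathbf{A})$, and there are computable functions $f,g,s$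 such that 1. $K_1(\mathbf{A}^\#)$ is c.e. for every c.e. presentation $\mathbf{A}^\#$, and if $\phi$ is a computable $*$-homomorphism from $\mathbf{A}^\#$ to $\mathbf{B}^\#$ (both c.e.), then $K_1(\phi)$ is computable from $K_1(\mathbf{A}^\#)$ to $K_1(\mathbf{B}^\#)$; 2. the identity of $K_1(\mathbf{A})$ is computable from $K_1(\mathbf{A}^\#,e)$ to $K_1(\mathbf{A}^\#)$ and from $K_1(\mathbf{A}^\#)$ to $K_1(\mathbf{A}^\#,e)$; 3. for every index $e$ of $\mathbf{A}^\#$ and every word $w$, $s(e,w)$ consists of sizes $m,n$ and indices of projections $p\in M_m(\widetilde{S\mathbf{A}})$ and $q\in M_n(\widetilde{S\mathbf{A}})$ such that $w$ is a label in $K_1(\mathbf{A}^\#,e)$ of the element $[p]-[q]$ of $K_1(\mathbf{A})\subseteq K_0(\widetilde{S\mathbf{A}})$; 4. for every index $e$ of $\mathbf{A}^\#$, $f(e)$ is an index of $K_1(\mathbf{A}^\#,e)$; 5. if $e,e'$ are indices of $\mathbf{A}^\#,\mathbf{B}^\#$ and $d$ is an index of a computable $*$-homomorphism $\phi$ from $\mathbf{A}^\#$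 to $\mathbf{B}^\#$, then $g(e,e',d)$ is an index of $K_1(\phi)$ as a computable map from $K_1(\mathbf{A}^\#,e)$ to $K_1(\mathbf{B}^\#,e')$. -/

import Mathlib

universe u

open scoped ZeroAtInfty Matrix

noncomputable section

namespace EffectiveK

/-! ### Indices of algorithms -/

/-- The partial computable function with index `e`. -/
def phi (e : ℕ) : ℕ →. ℕ := (Denumerable.ofNat Nat.Partrec.Code e).eval

/-- The c.e. set with index `e`, the domain of the partial computable function with index `e`. -/
def W (e : ℕ) : Set ℕ := {n | (phi e n).Dom}

/-! ### Presentations of C⋆-algebras -/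

/-- The letter `(i, false)` is the variable `x_i`, the letter `(i, true)` is its adjoint. -/
abbrev Letter : Type := ℕ × Bool

/-- A code `((a, b), c)` of the Gaussian rational `(a + b i) / (c + 1)`. -/
abbrev GaussCode : Type := (ℤ × ℤ) × ℕ

/-- A monomial of a `*`-polynomial without constant term: a coefficient and a nonempty word in the
variables and their adjoints, given by its first letter and the list of the other ones. -/
abbrev Monomial : Type := GaussCode × (Letter × List Letter)

/-- A `*`-polynomial in noncommuting variables `x_0, x_1, …`, with coefficients in `ℚ(i)` and
without constant term, as a formal sum of monomials. -/
abbrev RatPoly : Type := List Monomial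

/-- The complex number coded by an element of `GaussCode`. -/
def GaussCode.val (z : GaussCode) : ℂ := ((z.1.1 : ℂ) + (z.1.2 : ℂ) * Complex.I) / ((z.2 : ℂ) + 1)

/-- The rational number `a / (c + 1)` coded by the pair `(a, c)`. -/
def ratVal (z : ℤ × ℕ) : ℚ := (z.1 : ℚ) / ((z.2 : ℚ) + 1)

section Presentation

variable {A : Type*} [NonUnitalCStarAlgebra A]

/-- The value of a letter at a sequence of points. -/
def Letter.eval (a : ℕ → A) (l : Letter) : A := if l.2 then star (a l.1) else a l.1

/-- The value of a monomial at a sequence of points. -/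
def Monomial.eval (a : ℕ → A) (m : Monomial) : A :=
  GaussCode.val m.1 •
    m.2.2.foldl (fun x l => x * Letter.eval a l) (Letter.eval a m.2.1)

/-- The value of a rational `*`-polynomial at a sequence of points. -/
def RatPoly.eval (a : ℕ → A) (p : RatPoly) : A := (p.map (Monomial.eval a)).sum

end Presentation

/-- A presentation of a C⋆-algebra: a sequence of special points which generates a dense
`*`-subalgebra. -/
structure CStarPresentation (A : Type*) [NonUnitalCStarAlgebra A] where
  /-- the special points -/
  pt : ℕ → A
  dense : Dense (NonUnitalStarAlgebra.adjoin ℂ (Set.range pt) : Set A)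

namespace CStarPresentation

variable {A B : Type*} [NonUnitalCStarAlgebra A] [NonUnitalCStarAlgebra B]

/-- The rational point with code `p`. -/
def ratPt (P : CStarPresentation A) (p : RatPoly) : A := RatPoly.eval P.pt p

/-- `e` is a (right) c.e. index of `P`: it is the index of an algorithm which, given a rational
point, enumerates a decreasing sequence of rationals that converges to the norm of the point. -/
def IsIndex (P : CStarPresentation A) (e : ℕ) : Prop :=
  ∀ p : RatPoly, ∃ r : ℕ → ℤ × ℕ,
    (∀ n, phi e (Encodable.encode (p, n)) = Part.some (Encodable.encode (r n))) ∧
    Antitone (fun n => ratVal (r n)) ∧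
    Filter.Tendsto (fun n => (ratVal (r n) : ℝ)) Filter.atTop (nhds ‖P.ratPt p‖)

/-- The presentation `P` is c.e. -/
def IsCE (P : CStarPresentation A) : Prop := ∃ e, P.IsIndex e

/-- `d` is an index of `φ` as a computable map from `P` to `Q`: given a rational point `a` of `P`
and `k`, the algorithm `d` computes a rational point of `Q` at distance `< 2⁻ᵏ` from `φ a`. -/
def IsMapIndex (P : CStarPresentation A) (Q : CStarPresentation B) (φ : A →⋆ₙₐ[ℂ] B) (d : ℕ) :
    Prop :=
  ∀ (p : RatPoly) (k : ℕ), ∃ q : RatPoly,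
    phi d (Encodable.encode (p, k)) = Part.some (Encodable.encode q) ∧
    ‖φ (P.ratPt p) - Q.ratPt q‖ < (2 : ℝ)⁻¹ ^ k

/-- `φ` is a computable `*`-homomorphism from `P` to `Q`. -/
def IsComputableMap (P : CStarPresentation A) (Q : CStarPresentation B) (φ : A →⋆ₙₐ[ℂ] B) : Prop :=
  ∃ d, IsMapIndex P Q φ d

end CStarPresentation

/-! ### Presentations of groups -/

/-- A presentation of a group `G`: an epimorphism onto `G` from the free group on countably many
generators. -/
structure GroupPresentation (G : Type*) [Group G] where
  /-- the epimorphism -/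
  hom : FreeGroup ℕ →* G
  surj : Function.Surjective hom

namespace GroupPresentation

variable {G H : Type*} [Group G] [Group H]

/-- The element of `G` labelled by a word in the generators and their inverses; the letter
`(i, true)` is the generator `x_i`, the letter `(i, false)` is its inverse. -/
def val (N : GroupPresentation G) (w : List (ℕ × Bool)) : G := N.hom (FreeGroup.mk w)

/-- `e` is a c.e. index of `N`: an index of the kernel of `N`, the set of all pairs of labels of
the same element, as a c.e. set. -/
def IsIndex (N : GroupPresentation G) (e : ℕ) : Prop :=
  ∀ w w' : List (ℕ × Bool), Encodable.encode (w, w') ∈ W e ↔ N.val w = N.val w'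

/-- The presentation `N` is c.e. -/
def IsCE (N : GroupPresentation G) : Prop := ∃ e, N.IsIndex e

/-- `d` is an index of `ψ` as a computable map from `N` to `N'`: given a label of `a`, the
algorithm `d` computes a label of `ψ a`. -/
def IsMapIndex (N : GroupPresentation G) (N' : GroupPresentation H) (ψ : G →* H) (d : ℕ) : Prop :=
  ∀ w : List (ℕ × Bool), ∃ w' : List (ℕ × Bool),
    phi d (Encodable.encode w) = Part.some (Encodable.encode w') ∧ N'.val w' = ψ (N.val w)

/-- `ψ` is a computable homomorphism from `N` to `N'`. -/
def IsComputableMap (N : GroupPresentation G) (N' : GroupPresentation H) (ψ : G →* H) : Prop :=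
  ∃ d, IsMapIndex N N' ψ d

end GroupPresentation

/-! ### The Murray-von Neumann semigroup of a unital C⋆-algebra -/

section MvN

variable (B : Type*) [CStarAlgebra B]

/-- Projections in the matrix algebras over `B`. -/
structure Proj where
  /-- the size of the matrix -/
  n : ℕ
  /-- the matrix -/
  mat : Matrix (Fin n) (Fin n) B
  selfAdj : matᴴ = mat
  idem : mat * mat = mat

variable {B} {C : Type*} [CStarAlgebra C]

/-- The relation of Murray-von Neumann equivalence between matrices of possibly different sizes. -/
def MvNRel {m n : ℕ} (p : Matrix (Fin m) (Fin m) B) (q : Matrix (Fin n) (Fin n) B) : Prop :=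
  ∃ v : Matrix (Fin m) (Fin n) B, p = v * vᴴ ∧ q = vᴴ * v

/-- Murray-von Neumann equivalence of projections. -/
def MvN (p q : Proj B) : Prop := MvNRel p.mat q.mat

theorem MvN.refl (p : Proj B) : MvN p p :=
  ⟨p.mat, by rw [p.selfAdj, p.idem], by rw [p.selfAdj, p.idem]⟩

theorem MvN.symm {p q : Proj B} : MvN p q → MvN q p := by
  rintro ⟨v, h1, h2⟩
  exact ⟨vᴴ, by rw [Matrix.conjTranspose_conjTranspose, h2],
    by rw [Matrix.conjTranspose_conjTranspose, h1]⟩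

theorem MvN.trans {p q r : Proj B} : MvN p q → MvN q r → MvN p r := by
  rintro ⟨u, h1, h2⟩ ⟨v, h3, h4⟩
  refine ⟨u * v, ?_, ?_⟩
  · rw [Matrix.conjTranspose_mul]
    calc p.mat = p.mat * p.mat := p.idem.symm
      _ = u * (uᴴ * u) * uᴴ := by rw [h1]; simp only [Matrix.mul_assoc]
      _ = u * (v * vᴴ) * uᴴ := by rw [← h2, h3]
      _ = u * v * (vᴴ * uᴴ) := by simp only [Matrix.mul_assoc]
  · rw [Matrix.conjTranspose_mul]
    calc r.mat = r.mat * r.mat := r.idem.symm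
      _ = vᴴ * (v * vᴴ) * v := by rw [h4]; simp only [Matrix.mul_assoc]
      _ = vᴴ * (uᴴ * u) * v := by rw [← h3, h2]
      _ = vᴴ * uᴴ * (u * v) := by simp only [Matrix.mul_assoc]

instance mvnSetoid (B : Type*) [CStarAlgebra B] : Setoid (Proj B) where
  r := MvN
  iseqv := ⟨MvN.refl, MvN.symm, MvN.trans⟩

/-- The block-diagonal sum of two matrices. -/
def blockSum {m n m' n' : ℕ} (a : Matrix (Fin m) (Fin m') B) (b : Matrix (Fin n) (Fin n') B) :
    Matrix (Fin (m + n)) (Fin (m' + n')) B :=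
  (Matrix.fromBlocks a 0 0 b).submatrix finSumFinEquiv.symm finSumFinEquiv.symm

theorem blockSum_mul {m n m' n' m'' n'' : ℕ} (a : Matrix (Fin m) (Fin m') B)
    (b : Matrix (Fin n) (Fin n') B) (a' : Matrix (Fin m') (Fin m'') B)
    (b' : Matrix (Fin n') (Fin n'') B) :
    blockSum a b * blockSum a' b' = blockSum (a * a') (b * b') := by
  simp [blockSum, Matrix.submatrix_mul_equiv, Matrix.fromBlocks_multiply]

theorem blockSum_conjTranspose {m n m' n' : ℕ} (a : Matrix (Fin m) (Fin m') B)
    (b : Matrix (Fin n) (Fin n') B) : (blockSum a b)ᴴ = blockSum aᴴ bᴴ := by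
  simp [blockSum, Matrix.conjTranspose_submatrix, Matrix.fromBlocks_conjTranspose]

/-- The orthogonal sum `p ⊕ q`. -/
def Proj.oplus (p q : Proj B) : Proj B where
  n := p.n + q.n
  mat := blockSum p.mat q.mat
  selfAdj := by rw [blockSum_conjTranspose, p.selfAdj, q.selfAdj]
  idem := by rw [blockSum_mul, p.idem, q.idem]

/-- The projection of size `0`. -/
def Proj.zero : Proj B := ⟨0, 0, by simp, by simp⟩

theorem MvNRel.blockSum {m n m' n' : ℕ} {p : Matrix (Fin m) (Fin m) B}
    {q : Matrix (Fin n) (Fin n) B} {p' : Matrix (Fin m') (Fin m') B}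
    {q' : Matrix (Fin n') (Fin n') B} :
    MvNRel p p' → MvNRel q q' → MvNRel (blockSum p q) (blockSum p' q') := by
  rintro ⟨u, h1, h2⟩ ⟨v, h3, h4⟩
  refine ⟨EffectiveK.blockSum u v, ?_, ?_⟩
  · rw [blockSum_conjTranspose, blockSum_mul, ← h1, ← h3]
  · rw [blockSum_conjTranspose, blockSum_mul, ← h2, ← h4]

/-- Matrices which agree up to a renumbering of the rows and columns are equivalent. -/
theorem MvNRel.of_reindex {m n : ℕ} {p : Matrix (Fin m) (Fin m) B} {q : Matrix (Fin n) (Fin n) B}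
    (hq : qᴴ = q) (hqq : q * q = q) (σ : Fin m ≃ Fin n) (h : q.submatrix σ σ = p) :
    MvNRel p q := by
  refine ⟨q.submatrix σ id, ?_, ?_⟩
  · rw [Matrix.conjTranspose_submatrix, hq,
      ← Matrix.submatrix_mul _ _ _ _ _ Function.bijective_id, hqq, h]
  · rw [Matrix.conjTranspose_submatrix, hq,
      ← Matrix.submatrix_mul _ _ _ _ _ σ.bijective, hqq, Matrix.submatrix_id_id]

theorem blockSum_comm {m n : ℕ} (p : Matrix (Fin m) (Fin m) B) (q : Matrix (Fin n) (Fin n) B) :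
    (blockSum q p).submatrix
      ((finSumFinEquiv.symm.trans (Equiv.sumComm _ _)).trans finSumFinEquiv)
      ((finSumFinEquiv.symm.trans (Equiv.sumComm _ _)).trans finSumFinEquiv) = blockSum p q := by
  ext i j
  obtain ⟨i, rfl⟩ := finSumFinEquiv.surjective i
  obtain ⟨j, rfl⟩ := finSumFinEquiv.surjective j
  rcases i with i | i <;> rcases j with j | j <;>
    simp [blockSum, -finSumFinEquiv_apply_left, -finSumFinEquiv_apply_right]

/-- The renumbering that makes `⊕` associative. -/
def assocEquiv (l m n : ℕ) : Fin (l + m + n) ≃ Fin (l + (m + n)) :=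
  (((finSumFinEquiv.symm.trans (Equiv.sumCongr finSumFinEquiv.symm (Equiv.refl _))).trans
      (Equiv.sumAssoc _ _ _)).trans
      (Equiv.sumCongr (Equiv.refl _) finSumFinEquiv)).trans finSumFinEquiv

theorem blockSum_assoc {l m n : ℕ} (p : Matrix (Fin l) (Fin l) B) (q : Matrix (Fin m) (Fin m) B)
    (r : Matrix (Fin n) (Fin n) B) :
    (blockSum p (blockSum q r)).submatrix (assocEquiv l m n) (assocEquiv l m n) =
      blockSum (blockSum p q) r := by
  ext i j
  obtain ⟨i, rfl⟩ := finSumFinEquiv.surjective i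
  obtain ⟨j, rfl⟩ := finSumFinEquiv.surjective j
  rcases i with i | i
  · obtain ⟨i, rfl⟩ := finSumFinEquiv.surjective i
    rcases j with j | j
    · obtain ⟨j, rfl⟩ := finSumFinEquiv.surjective j
      rcases i with i | i <;> rcases j with j | j <;>
        simp [blockSum, assocEquiv, -finSumFinEquiv_apply_left, -finSumFinEquiv_apply_right]
    · rcases i with i | i <;>
        simp [blockSum, assocEquiv, -finSumFinEquiv_apply_left, -finSumFinEquiv_apply_right]
  · rcases j with j | j
    · obtain ⟨j, rfl⟩ := finSumFinEquiv.surjective j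
      rcases j with j | j <;>
        simp [blockSum, assocEquiv, -finSumFinEquiv_apply_left, -finSumFinEquiv_apply_right]
    · simp [blockSum, assocEquiv, -finSumFinEquiv_apply_left, -finSumFinEquiv_apply_right]

theorem zero_blockSum {n : ℕ} (p : Matrix (Fin n) (Fin n) B) :
    p.submatrix (finSumFinEquiv.symm.trans (Equiv.emptySum (Fin 0) (Fin n)))
      (finSumFinEquiv.symm.trans (Equiv.emptySum (Fin 0) (Fin n))) =
      blockSum (0 : Matrix (Fin 0) (Fin 0) B) p := by
  ext i j
  obtain ⟨i, rfl⟩ := finSumFinEquiv.surjective i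
  obtain ⟨j, rfl⟩ := finSumFinEquiv.surjective j
  rcases i with i | i
  · exact i.elim0
  · rcases j with j | j
    · exact j.elim0
    · simp [blockSum, -finSumFinEquiv_apply_left, -finSumFinEquiv_apply_right]

theorem MvN.oplus_comm (p q : Proj B) : MvN (p.oplus q) (q.oplus p) :=
  MvNRel.of_reindex (q.oplus p).selfAdj (q.oplus p).idem _ (blockSum_comm p.mat q.mat)

theorem MvN.oplus_assoc (p q r : Proj B) :
    MvN ((p.oplus q).oplus r) (p.oplus (q.oplus r)) :=
  MvNRel.of_reindex (p.oplus (q.oplus r)).selfAdj (p.oplus (q.oplus r)).idem _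
    (blockSum_assoc p.mat q.mat r.mat)

theorem MvN.zero_oplus (p : Proj B) : MvN (Proj.zero.oplus p) p :=
  MvNRel.of_reindex p.selfAdj p.idem _ (zero_blockSum p.mat)

/-- The Murray-von Neumann semigroup `𝒟(B)`. -/
def MvNSemigroup (B : Type*) [CStarAlgebra B] : Type _ := Quotient (mvnSetoid B)

/-- The Murray-von Neumann class of a projection. -/
def MvNSemigroup.mk (p : Proj B) : MvNSemigroup B := Quotient.mk (mvnSetoid B) p

instance (B : Type*) [CStarAlgebra B] : Add (MvNSemigroup B) where
  add := Quotient.map₂ Proj.oplus fun _ _ h _ _ h' => MvNRel.blockSum h h'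

instance (B : Type*) [CStarAlgebra B] : Zero (MvNSemigroup B) where
  zero := MvNSemigroup.mk Proj.zero

instance (B : Type*) [CStarAlgebra B] : AddCommMonoid (MvNSemigroup B) where
  add_assoc := by
    rintro ⟨p⟩ ⟨q⟩ ⟨r⟩
    exact Quotient.sound (MvN.oplus_assoc p q r)
  add_comm := by
    rintro ⟨p⟩ ⟨q⟩
    exact Quotient.sound (MvN.oplus_comm p q)
  zero_add := by
    rintro ⟨p⟩
    exact Quotient.sound (MvN.zero_oplus p)
  add_zero := by
    rintro ⟨p⟩
    exact Quotient.sound ((MvN.oplus_comm p Proj.zero).trans (MvN.zero_oplus p))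
  nsmul := nsmulRec

theorem conjTranspose_map_hom (φ : B →⋆ₐ[ℂ] C) {m n : ℕ} (a : Matrix (Fin m) (Fin n) B) :
    (a.map φ)ᴴ = aᴴ.map φ := by
  ext i j
  exact (map_star φ (a j i)).symm

theorem mul_map_hom (φ : B →⋆ₐ[ℂ] C) {l m n : ℕ} (a : Matrix (Fin l) (Fin m) B)
    (b : Matrix (Fin m) (Fin n) B) : (a * b).map φ = a.map φ * b.map φ := by
  ext i j
  simp [Matrix.mul_apply]

theorem blockSum_map (φ : B →⋆ₐ[ℂ] C) {m n m' n' : ℕ} (a : Matrix (Fin m) (Fin m') B)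
    (b : Matrix (Fin n) (Fin n') B) : (blockSum a b).map φ = blockSum (a.map φ) (b.map φ) := by
  simp only [blockSum, ← Matrix.submatrix_map, Matrix.fromBlocks_map]
  congr 2 <;> (ext i j; simp)

/-- The image of a projection under a unital `*`-homomorphism, applied entrywise. -/
def Proj.map (φ : B →⋆ₐ[ℂ] C) (p : Proj B) : Proj C where
  n := p.n
  mat := p.mat.map φ
  selfAdj := by rw [conjTranspose_map_hom, p.selfAdj]
  idem := by rw [← mul_map_hom, p.idem]

theorem MvNRel.map (φ : B →⋆ₐ[ℂ] C) {m n : ℕ} {p : Matrix (Fin m) (Fin m) B}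
    {q : Matrix (Fin n) (Fin n) B} : MvNRel p q → MvNRel (p.map φ) (q.map φ) := by
  rintro ⟨v, h1, h2⟩
  refine ⟨v.map φ, ?_, ?_⟩
  · rw [conjTranspose_map_hom, ← mul_map_hom, ← h1]
  · rw [conjTranspose_map_hom, ← mul_map_hom, ← h2]

/-- The homomorphism `𝒟(φ)`, given by `[p] ↦ [φ(p)]`. -/
def MvNSemigroup.map (φ : B →⋆ₐ[ℂ] C) : MvNSemigroup B →+ MvNSemigroup C where
  toFun := Quotient.map (Proj.map φ) fun _ _ h => MvNRel.map φ h
  map_zero' := by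
    refine congrArg MvNSemigroup.mk ?_
    simp only [Proj.map, Proj.zero, Proj.mk.injEq, heq_eq_eq, true_and]
    ext i
    exact i.elim0
  map_add' := by
    rintro ⟨p⟩ ⟨q⟩
    refine congrArg MvNSemigroup.mk ?_
    simp only [Proj.map, Proj.oplus, blockSum_map]

end MvN

/-! ### The groups `K₀` and `K₁` -/

/-- `K₀` of a unital C⋆-algebra: the Grothendieck group of its Murray-von Neumann semigroup. -/
abbrev UnitalK0 (B : Type*) [CStarAlgebra B] : Type _ :=
  Algebra.GrothendieckAddGroup (MvNSemigroup B)

/-- `K₀(φ)` for a unital `*`-homomorphism `φ` between unital C⋆-algebras. -/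
def UnitalK0.map {B C : Type*} [CStarAlgebra B] [CStarAlgebra C] (φ : B →⋆ₐ[ℂ] C) :
    UnitalK0 B →+ UnitalK0 C :=
  Algebra.GrothendieckAddGroup.lift
    (Algebra.GrothendieckAddGroup.of.comp (MvNSemigroup.map φ))

theorem UnitalK0.map_of {B C : Type*} [CStarAlgebra B] [CStarAlgebra C] (φ : B →⋆ₐ[ℂ] C)
    (x : MvNSemigroup B) : UnitalK0.map φ (Algebra.GrothendieckAddGroup.of x) =
      Algebra.GrothendieckAddGroup.of (MvNSemigroup.map φ x) :=
  DFunLike.congr_fun (Algebra.GrothendieckAddGroup.lift.symm_apply_apply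
    (Algebra.GrothendieckAddGroup.of.comp (MvNSemigroup.map φ))) x

section NonUnital

variable {A B : Type*} [NonUnitalCStarAlgebra A] [NonUnitalCStarAlgebra B]

/-- The `*`-homomorphism `(a, α) ↦ α` from the unitization of `A` to `ℂ`. -/
def unitizationProj (A : Type*) [NonUnitalCStarAlgebra A] : Unitization ℂ A →⋆ₐ[ℂ] ℂ :=
  { Unitization.fstHom ℂ A with map_star' := fun x => Unitization.fst_star x }

/-- `K₀` of a C⋆-algebra `A` that need not be unital: the kernel of the homomorphism from `K₀` of
the unitization of `A` to `K₀(ℂ)`. -/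
abbrev K0 (A : Type*) [NonUnitalCStarAlgebra A] : Type _ :=
  (UnitalK0.map (unitizationProj A)).ker

theorem unitizationProj_starMap (φ : A →⋆ₙₐ[ℂ] B) (x : Unitization ℂ A) :
    unitizationProj B (Unitization.starMap φ x) = unitizationProj A x := by
  change (Unitization.starMap φ x).fst = x.fst
  simp [Unitization.algebraMap_eq_inl]

theorem MvNSemigroup.map_proj (φ : A →⋆ₙₐ[ℂ] B) (x : MvNSemigroup (Unitization ℂ A)) :
    MvNSemigroup.map (unitizationProj B) (MvNSemigroup.map (Unitization.starMap φ) x) =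
      MvNSemigroup.map (unitizationProj A) x := by
  obtain ⟨p⟩ := x
  refine congrArg MvNSemigroup.mk ?_
  simp only [Proj.map, Matrix.map_map, Proj.mk.injEq, heq_eq_eq, true_and]
  congr 1
  ext x
  exact unitizationProj_starMap φ x

theorem UnitalK0.map_proj (φ : A →⋆ₙₐ[ℂ] B) (x : UnitalK0 (Unitization ℂ A)) :
    UnitalK0.map (unitizationProj B) (UnitalK0.map (Unitization.starMap φ) x) =
      UnitalK0.map (unitizationProj A) x := by
  have h : (UnitalK0.map (unitizationProj B)).comp (UnitalK0.map (Unitization.starMap φ)) =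
      UnitalK0.map (unitizationProj A) := by
    refine Algebra.GrothendieckAddGroup.lift.symm.injective ?_
    ext y
    change UnitalK0.map _ (UnitalK0.map _ (Algebra.GrothendieckAddGroup.of y)) =
      UnitalK0.map _ (Algebra.GrothendieckAddGroup.of y)
    rw [UnitalK0.map_of, UnitalK0.map_of, UnitalK0.map_of, MvNSemigroup.map_proj]
  exact DFunLike.congr_fun h x

/-- `K₀(φ)`, the restriction to `K₀(A)` of the map induced by `φ` on the unitizations. -/
def K0.map (φ : A →⋆ₙₐ[ℂ] B) : K0 A →+ K0 B :=
  ((UnitalK0.map (Unitization.starMap φ)).comp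
    (UnitalK0.map (unitizationProj A)).ker.subtype).codRestrict
      (UnitalK0.map (unitizationProj B)).ker
      (fun x => (UnitalK0.map_proj φ x.1).trans x.2)

/-- The suspension of `A`: continuous functions from the open interval `(0, 1)` to `A` which vanish
at infinity, that is, `C₀(0, 1) ⊗ A`. -/
abbrev Suspension (A : Type*) [NonUnitalCStarAlgebra A] : Type _ := C₀(Set.Ioo (0 : ℝ) 1, A)

theorem starHom_continuous (φ : A →⋆ₙₐ[ℂ] B) : Continuous φ :=
  AddMonoidHomClass.continuous_of_bound φ 1 fun a => by
    simpa using NonUnitalStarAlgHom.norm_apply_le φ a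

/-- The suspension of a `*`-homomorphism, `f ↦ φ ∘ f`. -/
def Suspension.map (φ : A →⋆ₙₐ[ℂ] B) : Suspension A →⋆ₙₐ[ℂ] Suspension B where
  toFun f :=
    { toFun := fun t => φ (f t)
      continuous_toFun := (starHom_continuous φ).comp (map_continuous f)
      zero_at_infty' := by
        have h := ((starHom_continuous φ).tendsto 0).comp f.zero_at_infty'
        rw [map_zero] at h
        exact h }
  map_smul' c f := by ext t; exact map_smul φ c (f t)
  map_zero' := by ext t; exact map_zero φ
  map_add' f g := by ext t; exact map_add φ (f t) (g t)
  map_mul' f g := by ext t; exact map_mul φ (f t) (g t)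
  map_star' f := by ext t; exact map_star φ (f t)

/-- `K₁(A) = K₀(SA)`. -/
abbrev K1 (A : Type*) [NonUnitalCStarAlgebra A] : Type _ := K0 (Suspension A)

/-- `K₁(φ) = K₀(Sφ)`. -/
def K1.map (φ : A →⋆ₙₐ[ℂ] B) : K1 A →+ K1 B := K0.map (Suspension.map φ)

end NonUnital

/-! ### The induced presentations of the suspension and of its unitization -/

section Induced

/-- The tent function with peak `1` at `(i + 1) / (n + 1)` and support of radius `1 / (n + 1)`. -/
def tent (n i : ℕ) (t : ℝ) : ℝ := max 0 (1 - |((n : ℝ) + 1) * t - ((i : ℝ) + 1)|)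

/-- The polygonal curve with vertices at `0, 1 / (n + 1), …, n / (n + 1), 1`, where `n` is the length
of `z`, which takes the value `z_i` at `(i + 1) / (n + 1)` and vanishes at `0` and `1`. -/
def polygon (z : List GaussCode) (t : ℝ) : ℂ :=
  ∑ i : Fin z.length, (tent z.length i t : ℂ) * GaussCode.val z[i]

theorem polygon_continuous (z : List GaussCode) : Continuous (polygon z) := by
  unfold polygon tent
  fun_prop

theorem polygon_zero (z : List GaussCode) : polygon z 0 = 0 := by
  refine Finset.sum_eq_zero fun i _ => ?_
  have h : tent z.length i 0 = 0 := by
    refine max_eq_left ?_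
    rw [mul_zero, zero_sub, abs_neg, abs_of_nonneg (by positivity)]
    have : (0 : ℝ) ≤ (i : ℕ) := Nat.cast_nonneg _
    linarith
  rw [h]
  simp

theorem polygon_one (z : List GaussCode) : polygon z 1 = 0 := by
  refine Finset.sum_eq_zero fun i _ => ?_
  have h : tent z.length i 1 = 0 := by
    refine max_eq_left ?_
    have h1 : ((i : ℕ) : ℝ) + 1 ≤ z.length := by exact_mod_cast i.2
    rw [abs_of_nonneg (by linarith)]
    linarith
  rw [h]
  simp

/-- The rational polygonal curve `polygon z` as an element of `C₀(0, 1)`. -/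
def curve (z : List GaussCode) : C₀(Set.Ioo (0 : ℝ) 1, ℂ) where
  toFun t := polygon z t
  continuous_toFun := (polygon_continuous z).comp continuous_subtype_val
  zero_at_infty' := by
    refine (Filter.tendsto_def).2 fun s hs => ?_
    obtain ⟨U, hUs, hU, hU0⟩ := mem_nhds_iff.1 hs
    refine Filter.mem_cocompact.2 ⟨Subtype.val ⁻¹' (Set.Icc 0 1 ∩ (polygon z ⁻¹' U)ᶜ), ?_, ?_⟩
    · rw [Subtype.isCompact_iff, Subtype.image_preimage_coe, Set.inter_eq_right.2]
      · exact isCompact_Icc.inter_right (hU.preimage (polygon_continuous z)).isClosed_compl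
      · rintro t ⟨⟨h0, h1⟩, h⟩
        refine ⟨lt_of_le_of_ne h0 ?_, lt_of_le_of_ne h1 ?_⟩
        · rintro rfl
          exact h (by rw [Set.mem_preimage, polygon_zero]; exact hU0)
        · rintro rfl
          exact h (by rw [Set.mem_preimage, polygon_one]; exact hU0)
    · intro t ht
      by_contra hc
      exact ht ⟨⟨t.2.1.le, t.2.2.le⟩, fun h => hc (hUs h)⟩

/-- The special points of the standard presentation of `C₀(0, 1)`: the rational polygonal curves
(and `0` at the numbers which do not code a curve). -/
def curvePt (n : ℕ) : C₀(Set.Ioo (0 : ℝ) 1, ℂ) :=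
  match (Encodable.decode n : Option (List GaussCode)) with
  | some z => curve z
  | none => 0

variable {A : Type*} [NonUnitalCStarAlgebra A]

/-- The elementary tensor `F ⊗ a`, the function `t ↦ F(t) a`. -/
def tensor (F : C₀(Set.Ioo (0 : ℝ) 1, ℂ)) (a : A) : Suspension A where
  toFun t := F t • a
  continuous_toFun := (map_continuous F).smul continuous_const
  zero_at_infty' := by
    have h := F.zero_at_infty'.smul_const a
    rw [zero_smul] at h
    exact h

/-- The special points of the presentation of the suspension induced by `P`: the tensors of the
rational points of `C₀(0, 1)` and the rational points of `P`. -/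
def suspensionPt (P : CStarPresentation A) (n : ℕ) : Suspension A :=
  match (Encodable.decode n : Option (RatPoly × RatPoly)) with
  | some (p, q) => tensor (RatPoly.eval curvePt p) (P.ratPt q)
  | none => 0

/-- The special points of the presentation of the unitization induced by a presentation with
special points `a`: the pairs `(a_m, α)`, where `α` is a Gaussian rational. -/
def unitizationPt (a : ℕ → A) (n : ℕ) : Unitization ℂ A :=
  match (Encodable.decode n : Option (ℕ × GaussCode)) with
  | some (m, z) => Unitization.inl (GaussCode.val z) + Unitization.inr (a m)
  | none => 0

/-- `c` is an index of the projection `p` with respect to the special points `b`: the algorithm `c`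
computes, given `k` and a position in the matrix `p`, a rational point at distance `< 2⁻ᵏ` from the
entry at this position. -/
def IsProjIndex {B : Type*} [CStarAlgebra B] (b : ℕ → B) (p : Proj B) (c : ℕ) : Prop :=
  ∀ (k : ℕ) (i j : Fin p.n), ∃ r : RatPoly,
    phi c (Encodable.encode (k, (i : ℕ), (j : ℕ))) = Part.some (Encodable.encode r) ∧
    ‖p.mat i j - RatPoly.eval b r‖ < (2 : ℝ)⁻¹ ^ k

/-- `P` computably supports the presentation `N` of `K₁(A) = K₀(SA)`, by means of the algorithm `s`:
given a word `w`, it computes sizes and indices of projections `p` and `q` in matrix algebras over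
the unitization of the suspension, such that `w` labels `[p] - [q]`. -/
def Supports (P : CStarPresentation A) (N : GroupPresentation (Multiplicative (K1 A)))
    (s : List (ℕ × Bool) → (ℕ × ℕ) × (ℕ × ℕ)) : Prop :=
  ∀ w, ∃ p q : Proj (Unitization ℂ (Suspension A)),
    p.n = (s w).1.1 ∧ IsProjIndex (unitizationPt (suspensionPt P)) p (s w).1.2 ∧
    q.n = (s w).2.1 ∧ IsProjIndex (unitizationPt (suspensionPt P)) q (s w).2.2 ∧
    ((N.val w).toAdd : UnitalK0 (Unitization ℂ (Suspension A))) =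
      Algebra.GrothendieckAddGroup.of (MvNSemigroup.mk p) -
        Algebra.GrothendieckAddGroup.of (MvNSemigroup.mk q)

end Induced

end EffectiveK

end

/-!
The point of the proof is that every notion involved is semidecidable, uniformly in an index of the
presentation, although a c.e. index gives only upper bounds for norms. Let `U` be the unitization of
the suspension of `A`; its special points are numbered by `unitizationPt (suspensionPt P)`, and
matrices over `U` are coded by matrices of `*`-polynomials in these points (`MCode`, `meval`).

*Norms in `U`* (`isNormTest`, `sigmaOne_normTest`). A polynomial in the special points is a scalar plus
a function on `(0, 1)` with values in `A`. At a rational time its value is a rational point of `A`, the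
code of which can be computed (`evalUnit_peval`), so that the index of `A` bounds its norm. A
Lipschitz constant can be certified as well, hence it is enough to test finitely many times. The
rational points are dense in `U` (`denseRange_peval`), because functions in the suspension are limits
of sums of tent functions times elements of `A`.

*Projections*. If `x` is self-adjoint and `x² - x` is small, Newton's iteration `x ↦ 3 x² - 2 x³`
converges to a projection at a known rate (`exists_newton_limit`, `Conv`). So every code that passes
the semidecidable test `SValid` stands for a projection, and every projection is equivalent to one of
this kind (`exists_valid_rep`). Two projections are equivalent if there is an approximate partial
isometry between them, because the polar part of it is a partial isometry (`MvNRel.of_approx`);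
therefore equivalence is semidecidable on codes (`sEquiv_iff`), and so is equality of formal
differences in `K₀(U)` (`diffTest_iff`), where a further projection that makes both sides equivalent
is searched for.

*The presentation of `K₁`* (`k1Pres`). The exact sequence that defines `K₁(A)` splits, so the difference
`[p] - [q]` belongs to `K₁(A)` if and only if `[ε(p)] - [ε(q)] = 0`, where `ε(a, α) = (0, α)`
(`mem_K0_iff`). On codes, `ε` is a renaming of the variables, and this condition is semidecidable too.
The generators are the pairs of valid codes together with a certificate for it; numbers that are not
of this form give `0`. Thus every element of `K₁(A)` is a generator, and the equality of labels is
semidecidable (`exists_k1Pres_index`).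

*Homomorphisms* (`exists_k1Map_index`). To map `[p] - [q]`, the variables of late iterates of the codes
of `p` and `q` are replaced by approximations of their images. The error can be certified, and close
projections are equivalent (`MvNRel.of_close`), so a search for a generator that passes the
corresponding tests finds a label of the image. Applied to the identity of `A`, this shows that the
presentations of `K₁(A)` for different indices of `A` are computably isomorphic.
-/

noncomputable section

namespace EffectiveK

/-! ### Arithmetic of Gaussian rationals on codes -/

/-- The product of two Gaussian rationals, on codes. A code stores the denominator minus one, and
fractions are not reduced. -/
def gmul (x y : GaussCode) : GaussCode :=
  ((x.1.1 * y.1.1 - x.1.2 * y.1.2, x.1.1 * y.1.2 + x.1.2 * y.1.1), x.2 * y.2 + x.2 + y.2)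

/-- The sum of two Gaussian rationals, on codes. -/
def gadd (x y : GaussCode) : GaussCode :=
  ((x.1.1 * (y.2 + 1 : ℕ) + y.1.1 * (x.2 + 1 : ℕ), x.1.2 * (y.2 + 1 : ℕ) + y.1.2 * (x.2 + 1 : ℕ)),
    x.2 * y.2 + x.2 + y.2)

/-- The complex conjugate of a Gaussian rational, on codes. -/
def gconj (x : GaussCode) : GaussCode := ((x.1.1, -x.1.2), x.2)

/-- A natural number that bounds the modulus of the Gaussian rational with code `x`. -/
def gbound (x : GaussCode) : ℕ := x.1.1.natAbs + x.1.2.natAbs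

/-- The integer `n` as a code of a Gaussian rational. -/
def gint (n : ℤ) : GaussCode := ((n, 0), 0)

theorem val_gmul (x y : GaussCode) : (gmul x y).val = x.val * y.val := by
  have h1 : (x.2 : ℂ) + 1 ≠ 0 := Nat.cast_add_one_ne_zero _
  have h2 : (y.2 : ℂ) + 1 ≠ 0 := Nat.cast_add_one_ne_zero _
  have h3 : ((x.2 * y.2 + x.2 + y.2 : ℕ) : ℂ) + 1 = (x.2 + 1) * (y.2 + 1) := by push_cast; ring
  simp only [GaussCode.val, gmul, h3]
  field_simp
  push_cast
  linear_combination (-(x.1.2 : ℂ) * y.1.2) * Complex.I_sq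

theorem val_gadd (x y : GaussCode) : (gadd x y).val = x.val + y.val := by
  have h1 : (x.2 : ℂ) + 1 ≠ 0 := Nat.cast_add_one_ne_zero _
  have h2 : (y.2 : ℂ) + 1 ≠ 0 := Nat.cast_add_one_ne_zero _
  have h3 : ((x.2 * y.2 + x.2 + y.2 : ℕ) : ℂ) + 1 = (x.2 + 1) * (y.2 + 1) := by push_cast; ring
  simp only [GaussCode.val, gadd, h3]
  field_simp
  push_cast
  ring

theorem val_gconj (x : GaussCode) : (gconj x).val = star x.val := by
  simp [GaussCode.val, gconj]

theorem val_gint (n : ℤ) : (gint n).val = n := by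
  simp [GaussCode.val, gint]

theorem norm_val_eq (x : GaussCode) :
    ‖x.val‖ = ‖(x.1.1 : ℂ) + (x.1.2 : ℂ) * Complex.I‖ / ((x.2 : ℝ) + 1) := by
  have h : ‖(x.2 : ℂ) + 1‖ = (x.2 : ℝ) + 1 := by
    have := Complex.norm_natCast (x.2 + 1)
    push_cast at this
    exact this
  rw [GaussCode.val, norm_div, h]

theorem norm_val_mul_le (x : GaussCode) : ‖x.val‖ * ((x.2 : ℝ) + 1) ≤ gbound x := by
  have h1 : (0 : ℝ) < (x.2 : ℝ) + 1 := by positivity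
  rw [norm_val_eq, div_mul_cancel₀ _ h1.ne']
  refine (norm_add_le _ _).trans ?_
  simp [gbound, Nat.cast_natAbs]

theorem norm_val_le (x : GaussCode) : ‖x.val‖ ≤ gbound x := by
  refine le_trans ?_ (norm_val_mul_le x)
  have : (0 : ℝ) ≤ x.2 := by positivity
  nlinarith [norm_nonneg x.val]

theorem gbound_le (x : GaussCode) : (gbound x : ℝ) ≤ 2 * ‖x.val‖ * ((x.2 : ℝ) + 1) := by
  have h1 : (0 : ℝ) < (x.2 : ℝ) + 1 := by positivity
  rw [norm_val_eq, mul_assoc, div_mul_cancel₀ _ h1.ne']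
  have ha := Complex.abs_re_le_norm ((x.1.1 : ℂ) + (x.1.2 : ℂ) * Complex.I)
  have hb := Complex.abs_im_le_norm ((x.1.1 : ℂ) + (x.1.2 : ℂ) * Complex.I)
  simp at ha hb
  simp only [gbound]
  push_cast [Nat.cast_natAbs]
  linarith

/-! ### Polynomials with constant term and matrices of polynomials, on codes -/

/-- A monomial with a possibly empty word; the empty word stands for the unit. -/
abbrev Mono : Type := GaussCode × List Letter

/-- A `*`-polynomial over `ℚ(i)`, possibly with constant term, as a formal sum of monomials. -/
abbrev StarPoly : Type := List Mono

/-- The product of two monomials. -/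
def mulMono (x y : Mono) : Mono := (gmul x.1 y.1, x.2 ++ y.2)

/-- The product of two `*`-polynomials. -/
def mulP (p q : StarPoly) : StarPoly := p.flatMap fun x => q.map fun y => mulMono x y

/-- The adjoint of a letter. -/
def starLetter (l : Letter) : Letter := (l.1, !l.2)

/-- The adjoint of a monomial. -/
def starMono (x : Mono) : Mono := (gconj x.1, (x.2.map starLetter).reverse)

/-- The adjoint of a `*`-polynomial. -/
def starP (p : StarPoly) : StarPoly := p.map starMono

/-- A scalar multiple of a `*`-polynomial. -/
def smulP (c : GaussCode) (p : StarPoly) : StarPoly := p.map fun x => (gmul c x.1, x.2)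

/-- The result of substituting the polynomials `f i` for the variables of a word. -/
def substW (f : ℕ → StarPoly) (w : List Letter) : StarPoly :=
  w.foldr (fun l acc => mulP (bif l.2 then starP (f l.1) else f l.1) acc) [(gint 1, [])]

/-- The result of substituting the polynomials `f i` for the variables of a polynomial. -/
def substP (f : ℕ → StarPoly) (p : StarPoly) : StarPoly :=
  p.flatMap fun x => smulP x.1 (substW f x.2)

/-- A polynomial without constant term as a polynomial. -/
def ofRat (p : RatPoly) : StarPoly := p.map fun x => (x.1, x.2.1 :: x.2.2)

/-- A polynomial as one without constant term, where the variable `u` stands for the unit. -/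
def toRat (u : ℕ) (p : StarPoly) : RatPoly := p.map fun x => (x.1, ((u, false), x.2))

/-- The part of a polynomial without the constant term. -/
def nonconst (p : StarPoly) : RatPoly :=
  p.flatMap fun x => x.2.casesOn [] fun l ls => [(x.1, (l, ls))]

/-- The constant term of a polynomial. -/
def constP (p : StarPoly) : GaussCode :=
  p.foldr (fun x acc => x.2.casesOn (gadd x.1 acc) fun _ _ => acc) (gint 0)

/-- The result of renaming the variables of a monomial. -/
def renMono (f : ℕ → ℕ) (x : Mono) : Mono := (x.1, x.2.map fun l => (f l.1, l.2))

/-- A matrix of `*`-polynomials, as a formal sum of monomials at given positions. -/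
abbrev MCode : Type := List ((ℕ × ℕ) × Mono)

/-- The entry of a matrix of polynomials. -/
def ent (L : MCode) (i j : ℕ) : StarPoly := (L.filter fun x => x.1 = (i, j)).map Prod.snd

/-- The product of two matrices of polynomials, where the inner dimension is `n`. -/
def mmul (n : ℕ) (L L' : MCode) : MCode :=
  L.flatMap fun x => L'.flatMap fun y =>
    if x.1.2 = y.1.1 ∧ x.1.2 < n then [((x.1.1, y.1.2), mulMono x.2 y.2)] else []

/-- The adjoint of a matrix of polynomials. -/
def mstar (L : MCode) : MCode := L.map fun x => ((x.1.2, x.1.1), starMono x.2)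

/-- A scalar multiple of a matrix of polynomials. -/
def msmul (c : GaussCode) (L : MCode) : MCode := L.map fun x => (x.1, (gmul c x.2.1, x.2.2))

/-- The result of renaming the variables of a matrix of polynomials. -/
def mren (f : ℕ → ℕ) (L : MCode) : MCode := L.map fun x => (x.1, renMono f x.2)

/-- The block-diagonal sum of two matrices of polynomials, the first of size `m`. -/
def msum (m : ℕ) (L L' : MCode) : MCode :=
  (L.flatMap fun x => if x.1.1 < m ∧ x.1.2 < m then [x] else []) ++
    L'.map fun x => ((x.1.1 + m, x.1.2 + m), x.2)

/-- The self-adjoint matrix `L + L*`. -/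
def msymm (L : MCode) : MCode := L ++ mstar L

/-- One step `x ↦ 3 x² - 2 x³` of Newton's iteration for projections. -/
def newton (n : ℕ) (L : MCode) : MCode :=
  msmul (gint 3) (mmul n L L) ++ msmul (gint (-2)) (mmul n L (mmul n L L))

/-- Newton's iteration for projections. -/
def newtonIter (n k : ℕ) (L : MCode) : MCode := (newton n)^[k] L

/-- A bound for the value and for the Lipschitz constant of a polynomial in variables of norm at
most `K`. -/
def polyBound (K : ℕ) (p : StarPoly) : ℕ :=
  (p.map fun x => gbound x.1 * (x.2.length + 1) * K ^ x.2.length).sum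

/-! ### Primitive recursiveness of the operations on codes -/

section PrimrecInt

theorem primrec_toNat : Primrec Int.toNat := by
  refine (Primrec.ite (Primrec.eq.comp (Primrec.nat_mod.comp Primrec.encode (Primrec.const 2))
    (Primrec.const 0)) (Primrec.nat_div.comp Primrec.encode (Primrec.const 2))
    (Primrec.const 0)).of_eq fun z => ?_
  cases z with
  | ofNat n =>
    change (if 2 * n % 2 = 0 then 2 * n / 2 else 0) = n
    rw [if_pos (by omega)]
    omega
  | negSucc n =>
    change (if (2 * n + 1) % 2 = 0 then (2 * n + 1) / 2 else 0) = 0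
    rw [if_neg (by omega)]

theorem primrec_subNat : Primrec₂ fun m n : ℕ => (m : ℤ) - n := by
  refine Primrec₂.encode_iff.1 ?_
  refine (Primrec.ite (Primrec.nat_le.comp Primrec.snd Primrec.fst)
    (Primrec.nat_mul.comp (Primrec.const 2) (Primrec.nat_sub.comp Primrec.fst Primrec.snd))
    (Primrec.nat_sub.comp (Primrec.nat_mul.comp (Primrec.const 2)
      (Primrec.nat_sub.comp Primrec.snd Primrec.fst)) (Primrec.const 1))).of_eq ?_
  rintro ⟨m, n⟩
  dsimp only
  split_ifs with h
  · obtain ⟨k, rfl⟩ := Nat.exists_eq_add_of_le h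
    rw [show ((n + k : ℕ) : ℤ) - n = (k : ℤ) by push_cast; ring, Nat.add_sub_cancel_left]
    rfl
  · obtain ⟨k, rfl⟩ := Nat.exists_eq_add_of_lt (not_le.1 h)
    rw [show ((m : ℕ) : ℤ) - (m + k + 1 : ℕ) = Int.negSucc k by push_cast; omega]
    change 2 * (m + k + 1 - m) - 1 = 2 * k + 1
    omega

theorem primrec_negPart : Primrec fun z : ℤ => (-z).toNat := by
  refine (Primrec.ite (Primrec.eq.comp (Primrec.nat_mod.comp Primrec.encode (Primrec.const 2))
    (Primrec.const 0)) (Primrec.const 0)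
    (Primrec.nat_div.comp (Primrec.succ.comp Primrec.encode) (Primrec.const 2))).of_eq fun z => ?_
  cases z with
  | ofNat n =>
    change (if 2 * n % 2 = 0 then 0 else (2 * n + 1) / 2) = (-(n : ℤ)).toNat
    rw [if_pos (by omega)]
    omega
  | negSucc n =>
    change (if (2 * n + 1) % 2 = 0 then 0 else (2 * n + 1 + 1) / 2) = n + 1
    rw [if_neg (by omega)]
    omega

variable {α : Type*} [Primcodable α] {f g : α → ℤ}

theorem primrec_intNeg (hf : Primrec f) : Primrec fun a => -f a :=
  (primrec_subNat.comp (primrec_negPart.comp hf) (primrec_toNat.comp hf)).of_eq fun a => by omega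

theorem primrec_intAdd (hf : Primrec f) (hg : Primrec g) : Primrec fun a => f a + g a :=
  (primrec_subNat.comp
    (Primrec.nat_add.comp (primrec_toNat.comp hf) (primrec_toNat.comp hg))
    (Primrec.nat_add.comp (primrec_negPart.comp hf) (primrec_negPart.comp hg))).of_eq
      fun a => by push_cast; omega

theorem primrec_intSub (hf : Primrec f) (hg : Primrec g) : Primrec fun a => f a - g a :=
  (primrec_intAdd hf (primrec_intNeg hg)).of_eq fun _ => (sub_eq_add_neg _ _).symm

theorem primrec_intMul (hf : Primrec f) (hg : Primrec g) : Primrec fun a => f a * g a := by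
  refine (primrec_subNat.comp
    (Primrec.nat_add.comp
      (Primrec.nat_mul.comp (primrec_toNat.comp hf) (primrec_toNat.comp hg))
      (Primrec.nat_mul.comp (primrec_negPart.comp hf) (primrec_negPart.comp hg)))
    (Primrec.nat_add.comp
      (Primrec.nat_mul.comp (primrec_toNat.comp hf) (primrec_negPart.comp hg))
      (Primrec.nat_mul.comp (primrec_negPart.comp hf) (primrec_toNat.comp hg)))).of_eq
      fun a => ?_
  have h (z : ℤ) : z = (z.toNat : ℤ) - ((-z).toNat : ℤ) := by omega
  conv_rhs => rw [h (f a), h (g a)]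
  push_cast
  ring

theorem primrec_natCast {f : α → ℕ} (hf : Primrec f) : Primrec fun a => (f a : ℤ) :=
  (primrec_subNat.comp hf (Primrec.const 0)).of_eq fun a => by simp

theorem primrec_natAbs (hf : Primrec f) : Primrec fun a => (f a).natAbs :=
  (Primrec.nat_add.comp (primrec_toNat.comp hf) (primrec_negPart.comp hf)).of_eq
    fun a => by omega

theorem primrec_pow {f g : α → ℕ} (hf : Primrec f) (hg : Primrec g) :
    Primrec fun a => f a ^ g a :=
  (Primrec₂.unpaired'.1 Nat.Primrec.pow).comp hf hg

end PrimrecInt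

section PrimrecCodes

variable {α β : Type*} [Primcodable α] [Primcodable β]

theorem primrec_sum {f : α → List ℕ} (hf : Primrec f) : Primrec fun a => (f a).sum :=
  (Primrec.list_foldr hf (Primrec.const 0) (Primrec.nat_add.comp (Primrec.fst.comp Primrec.snd)
    (Primrec.snd.comp Primrec.snd)).to₂).of_eq fun _ => rfl

theorem primrec_gmul {f g : α → GaussCode} (hf : Primrec f) (hg : Primrec g) :
    Primrec fun a => gmul (f a) (g a) := by
  have f1 := Primrec.fst.comp (Primrec.fst.comp hf)
  have f2 := Primrec.snd.comp (Primrec.fst.comp hf)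
  have f3 := Primrec.snd.comp hf
  have g1 := Primrec.fst.comp (Primrec.fst.comp hg)
  have g2 := Primrec.snd.comp (Primrec.fst.comp hg)
  have g3 := Primrec.snd.comp hg
  exact Primrec.pair (Primrec.pair
    (primrec_intSub (primrec_intMul f1 g1) (primrec_intMul f2 g2))
    (primrec_intAdd (primrec_intMul f1 g2) (primrec_intMul f2 g1)))
    (Primrec.nat_add.comp (Primrec.nat_add.comp (Primrec.nat_mul.comp f3 g3) f3) g3)

theorem primrec_gadd {f g : α → GaussCode} (hf : Primrec f) (hg : Primrec g) :
    Primrec fun a => gadd (f a) (g a) := by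
  have f1 := Primrec.fst.comp (Primrec.fst.comp hf)
  have f2 := Primrec.snd.comp (Primrec.fst.comp hf)
  have f3 := Primrec.snd.comp hf
  have g1 := Primrec.fst.comp (Primrec.fst.comp hg)
  have g2 := Primrec.snd.comp (Primrec.fst.comp hg)
  have g3 := Primrec.snd.comp hg
  have f4 := primrec_natCast (Primrec.succ.comp f3)
  have g4 := primrec_natCast (Primrec.succ.comp g3)
  exact Primrec.pair (Primrec.pair
    (primrec_intAdd (primrec_intMul f1 g4) (primrec_intMul g1 f4))
    (primrec_intAdd (primrec_intMul f2 g4) (primrec_intMul g2 f4)))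
    (Primrec.nat_add.comp (Primrec.nat_add.comp (Primrec.nat_mul.comp f3 g3) f3) g3)

theorem primrec_gconj : Primrec gconj :=
  Primrec.pair (Primrec.pair (Primrec.fst.comp Primrec.fst)
    (primrec_intNeg (Primrec.snd.comp Primrec.fst))) Primrec.snd

theorem primrec_gbound : Primrec gbound :=
  Primrec.nat_add.comp (primrec_natAbs (Primrec.fst.comp Primrec.fst))
    (primrec_natAbs (Primrec.snd.comp Primrec.fst))

theorem primrec_mulMono {f g : α → Mono} (hf : Primrec f) (hg : Primrec g) :
    Primrec fun a => mulMono (f a) (g a) :=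
  Primrec.pair (primrec_gmul (Primrec.fst.comp hf) (Primrec.fst.comp hg))
    (Primrec.list_append.comp (Primrec.snd.comp hf) (Primrec.snd.comp hg))

theorem primrec_mulP {f g : α → StarPoly} (hf : Primrec f) (hg : Primrec g) :
    Primrec fun a => mulP (f a) (g a) :=
  Primrec.list_flatMap hf (Primrec.list_map (hg.comp Primrec.fst)
    (primrec_mulMono (Primrec.snd.comp Primrec.fst) Primrec.snd).to₂).to₂

theorem primrec_starLetter : Primrec starLetter :=
  Primrec.pair Primrec.fst (Primrec.not.comp Primrec.snd)

theorem primrec_starMono : Primrec starMono :=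
  Primrec.pair (primrec_gconj.comp Primrec.fst) (Primrec.list_reverse.comp
    (Primrec.list_map Primrec.snd (primrec_starLetter.comp Primrec.snd).to₂))

theorem primrec_starP : Primrec starP :=
  Primrec.list_map Primrec.id (primrec_starMono.comp Primrec.snd).to₂

theorem primrec_smulP {f : α → GaussCode} {g : α → StarPoly} (hf : Primrec f) (hg : Primrec g) :
    Primrec fun a => smulP (f a) (g a) :=
  Primrec.list_map hg (Primrec.pair (primrec_gmul (hf.comp Primrec.fst)
    (Primrec.fst.comp Primrec.snd)) (Primrec.snd.comp Primrec.snd)).to₂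

theorem primrec_substW {f : α → ℕ → StarPoly} {w : α → List Letter} (hf : Primrec₂ f)
    (hw : Primrec w) : Primrec fun a => substW (f a) (w a) := by
  have h : Primrec fun x : α × Letter × StarPoly => f x.1 x.2.1.1 :=
    hf.comp Primrec.fst (Primrec.fst.comp (Primrec.fst.comp Primrec.snd))
  exact Primrec.list_foldr hw (Primrec.const _) (primrec_mulP
    (Primrec.cond (Primrec.snd.comp (Primrec.fst.comp Primrec.snd)) (primrec_starP.comp h) h)
    (Primrec.snd.comp Primrec.snd)).to₂

theorem primrec_substP {f : α → ℕ → StarPoly} {p : α → StarPoly} (hf : Primrec₂ f)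
    (hp : Primrec p) : Primrec fun a => substP (f a) (p a) :=
  Primrec.list_flatMap hp (primrec_smulP (Primrec.fst.comp Primrec.snd)
    (primrec_substW (f := fun x : α × Mono => f x.1)
      (hf.comp (Primrec.fst.comp Primrec.fst) Primrec.snd)
      (Primrec.snd.comp Primrec.snd))).to₂

theorem primrec_ofRat : Primrec ofRat :=
  Primrec.list_map Primrec.id (Primrec.pair (Primrec.fst.comp Primrec.snd)
    (Primrec.list_cons.comp (Primrec.fst.comp (Primrec.snd.comp Primrec.snd))
      (Primrec.snd.comp (Primrec.snd.comp Primrec.snd)))).to₂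

theorem primrec_toRat (u : ℕ) : Primrec (toRat u) :=
  Primrec.list_map Primrec.id (Primrec.pair (Primrec.fst.comp Primrec.snd)
    (Primrec.pair (Primrec.const _) (Primrec.snd.comp Primrec.snd))).to₂

theorem primrec_nonconst : Primrec nonconst := by
  have h : Primrec₂ fun (x : StarPoly × Mono) (y : Letter × List Letter) => [(x.2.1, y)] :=
    (Primrec.list_cons.comp (Primrec.pair
      (Primrec.fst.comp (Primrec.snd.comp Primrec.fst)) Primrec.snd) (Primrec.const [])).to₂
  exact (Primrec.list_flatMap Primrec.id (Primrec.list_casesOn (Primrec.snd.comp Primrec.snd)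
    (Primrec.const []) h).to₂).of_eq fun _ => rfl

theorem primrec_constP : Primrec constP := by
  have h : Primrec₂ fun (x : StarPoly × Mono × GaussCode) (_ : Letter × List Letter) => x.2.2 :=
    ((Primrec.snd.comp Primrec.snd).comp Primrec.fst).to₂
  have h' : Primrec fun x : StarPoly × Mono × GaussCode => gadd x.2.1.1 x.2.2 :=
    primrec_gadd (Primrec.fst.comp (Primrec.fst.comp Primrec.snd)) (Primrec.snd.comp Primrec.snd)
  exact (Primrec.list_foldr Primrec.id (Primrec.const (gint 0)) (Primrec.list_casesOn
    (Primrec.snd.comp (Primrec.fst.comp Primrec.snd)) h' h).to₂).of_eq fun _ => rfl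

theorem primrec_mmul {n : α → ℕ} {f g : α → MCode} (hn : Primrec n) (hf : Primrec f)
    (hg : Primrec g) : Primrec fun a => mmul (n a) (f a) (g a) := by
  have hx : Primrec fun x : (α × ((ℕ × ℕ) × Mono)) × ((ℕ × ℕ) × Mono) => x.1.2 :=
    Primrec.snd.comp Primrec.fst
  have hy : Primrec fun x : (α × ((ℕ × ℕ) × Mono)) × ((ℕ × ℕ) × Mono) => x.2 := Primrec.snd
  exact Primrec.list_flatMap hf (Primrec.list_flatMap (hg.comp Primrec.fst)
    (Primrec.ite (PrimrecPred.and (Primrec.eq.comp (Primrec.snd.comp (Primrec.fst.comp hx))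
      (Primrec.fst.comp (Primrec.fst.comp hy)))
    (Primrec.nat_lt.comp (Primrec.snd.comp (Primrec.fst.comp hx))
      (hn.comp (Primrec.fst.comp Primrec.fst))))
    (Primrec.list_cons.comp (Primrec.pair (Primrec.pair (Primrec.fst.comp (Primrec.fst.comp hx))
      (Primrec.snd.comp (Primrec.fst.comp hy)))
      (primrec_mulMono (Primrec.snd.comp hx) (Primrec.snd.comp hy))) (Primrec.const []))
    (Primrec.const [])).to₂).to₂

theorem primrec_mstar : Primrec mstar :=
  Primrec.list_map Primrec.id (Primrec.pair
    (Primrec.pair (Primrec.snd.comp (Primrec.fst.comp Primrec.snd))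
      (Primrec.fst.comp (Primrec.fst.comp Primrec.snd)))
    (primrec_starMono.comp (Primrec.snd.comp Primrec.snd))).to₂

theorem primrec_msmul {f : α → GaussCode} {g : α → MCode} (hf : Primrec f) (hg : Primrec g) :
    Primrec fun a => msmul (f a) (g a) :=
  Primrec.list_map hg (Primrec.pair (Primrec.fst.comp Primrec.snd)
    (Primrec.pair (primrec_gmul (hf.comp Primrec.fst)
      (Primrec.fst.comp (Primrec.snd.comp Primrec.snd)))
      (Primrec.snd.comp (Primrec.snd.comp Primrec.snd)))).to₂

theorem primrec_mren {f : α → ℕ → ℕ} {g : α → MCode} (hf : Primrec₂ f) (hg : Primrec g) :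
    Primrec fun a => mren (f a) (g a) := by
  have h : Primrec₂ fun (x : α × (ℕ × ℕ) × Mono) (l : Letter) => (f x.1 l.1, l.2) :=
    (Primrec.pair (hf.comp (Primrec.fst.comp Primrec.fst) (Primrec.fst.comp Primrec.snd))
      (Primrec.snd.comp Primrec.snd)).to₂
  exact Primrec.list_map hg (Primrec.pair (Primrec.fst.comp Primrec.snd)
    (Primrec.pair (Primrec.fst.comp (Primrec.snd.comp Primrec.snd))
      (Primrec.list_map (Primrec.snd.comp (Primrec.snd.comp Primrec.snd)) h))).to₂

theorem primrec_msum {m : α → ℕ} {f g : α → MCode} (hm : Primrec m) (hf : Primrec f)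
    (hg : Primrec g) : Primrec fun a => msum (m a) (f a) (g a) := by
  have h1 {β : Type} [Primcodable β] : Primrec fun x : α × (ℕ × ℕ) × β => x.2.1.1 :=
    Primrec.fst.comp (Primrec.fst.comp Primrec.snd)
  have h2 {β : Type} [Primcodable β] : Primrec fun x : α × (ℕ × ℕ) × β => x.2.1.2 :=
    Primrec.snd.comp (Primrec.fst.comp Primrec.snd)
  have h3 {β : Type} [Primcodable β] : Primrec fun x : α × (ℕ × ℕ) × β => m x.1 :=
    hm.comp Primrec.fst
  refine Primrec.list_append.comp (Primrec.list_flatMap hf ?_) (Primrec.list_map hg ?_)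
  · exact (Primrec.ite (PrimrecPred.and (Primrec.nat_lt.comp h1 h3) (Primrec.nat_lt.comp h2 h3))
      (Primrec.list_cons.comp Primrec.snd (Primrec.const [])) (Primrec.const [])).to₂
  · exact (Primrec.pair (Primrec.pair (Primrec.nat_add.comp h1 h3) (Primrec.nat_add.comp h2 h3))
      (Primrec.snd.comp Primrec.snd)).to₂

theorem primrec_msymm {f : α → MCode} (hf : Primrec f) : Primrec fun a => msymm (f a) :=
  Primrec.list_append.comp hf (primrec_mstar.comp hf)

theorem primrec_newton {n : α → ℕ} {f : α → MCode} (hn : Primrec n) (hf : Primrec f) :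
    Primrec fun a => newton (n a) (f a) := by
  have h := primrec_mmul hn hf hf
  exact Primrec.list_append.comp (primrec_msmul (Primrec.const _) h)
    (primrec_msmul (Primrec.const _) (primrec_mmul hn hf h))

theorem primrec_newtonIter {n k : α → ℕ} {f : α → MCode} (hn : Primrec n) (hk : Primrec k)
    (hf : Primrec f) : Primrec fun a => newtonIter (n a) (k a) (f a) :=
  Primrec.nat_iterate hk hf (primrec_newton (hn.comp Primrec.fst) Primrec.snd).to₂

theorem primrec_ent {f : α → MCode} {i j : α → ℕ} (hf : Primrec f) (hi : Primrec i)
    (hj : Primrec j) : Primrec fun a => ent (f a) (i a) (j a) := by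
  have h : Primrec fun a => (f a).flatMap fun x => if x.1 = (i a, j a) then [x.2] else [] :=
    Primrec.list_flatMap hf (Primrec.ite (Primrec.eq.comp (Primrec.fst.comp Primrec.snd)
      ((Primrec.pair hi hj).comp Primrec.fst))
      (Primrec.list_cons.comp (Primrec.snd.comp Primrec.snd) (Primrec.const []))
      (Primrec.const [])).to₂
  refine h.of_eq fun a => ?_
  rw [ent]
  generalize f a = L
  induction L with
  | nil => rfl
  | cons x L ih => by_cases hx : x.1 = (i a, j a) <;> simp [hx, ih]

theorem primrec_polyBound {K : α → ℕ} {p : α → StarPoly} (hK : Primrec K) (hp : Primrec p) :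
    Primrec fun a => polyBound (K a) (p a) := by
  refine primrec_sum (Primrec.list_map hp ?_)
  have hl : Primrec fun x : α × Mono => x.2.2.length :=
    Primrec.list_length.comp (Primrec.snd.comp Primrec.snd)
  exact (Primrec.nat_mul.comp (Primrec.nat_mul.comp
    (primrec_gbound.comp (Primrec.fst.comp Primrec.snd)) (Primrec.succ.comp hl))
    (primrec_pow (hK.comp Primrec.fst) hl)).to₂

end PrimrecCodes

/-! ### Semidecidable relations -/

section SigmaOne

variable {α β γ : Type*} [Primcodable α] [Primcodable β] [Primcodable γ]

/-- A semidecidable relation: there is a primitive recursive notion of certificate such that `R a`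
holds if and only if there is a certificate for `a`. -/
def SigmaOne (R : α → Prop) : Prop :=
  ∃ D : α → ℕ → Prop, PrimrecRel D ∧ ∀ a, R a ↔ ∃ s, D a s

theorem PrimrecPred.sigmaOne {R : α → Prop} (h : PrimrecPred R) : SigmaOne R :=
  ⟨fun a _ => R a, h.comp Primrec.fst, fun a => by simp⟩

theorem SigmaOne.comp {R : β → Prop} (h : SigmaOne R) {f : α → β} (hf : Primrec f) :
    SigmaOne fun a => R (f a) := by
  obtain ⟨D, hD, hR⟩ := h
  exact ⟨fun a s => D (f a) s, hD.comp (hf.comp Primrec.fst) Primrec.snd, fun a => hR _⟩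

theorem SigmaOne.exists_bool {R : α → Prop} (h : SigmaOne R) :
    ∃ D : α → ℕ → Bool, Primrec₂ D ∧ ∀ a, R a ↔ ∃ s, D a s = true := by
  classical
  obtain ⟨D, hD, hR⟩ := h
  exact ⟨fun a s => decide (D a s), hD.decide, fun a => by simp [hR]⟩

theorem SigmaOne.and {R R' : α → Prop} (h : SigmaOne R) (h' : SigmaOne R') :
    SigmaOne fun a => R a ∧ R' a := by
  obtain ⟨D, hD, hR⟩ := h
  obtain ⟨D', hD', hR'⟩ := h'
  refine ⟨fun a s => D a s.unpair.1 ∧ D' a s.unpair.2, PrimrecPred.and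
    (hD.comp Primrec.fst (Primrec.fst.comp (Primrec.unpair.comp Primrec.snd)))
    (hD'.comp Primrec.fst (Primrec.snd.comp (Primrec.unpair.comp Primrec.snd))), fun a => ?_⟩
  change R a ∧ R' a ↔ _
  rw [hR, hR']
  constructor
  · rintro ⟨⟨s, hs⟩, t, ht⟩
    exact ⟨Nat.pair s t, by simpa using ⟨hs, ht⟩⟩
  · rintro ⟨s, h1, h2⟩
    exact ⟨⟨_, h1⟩, _, h2⟩

theorem SigmaOne.exists {R : α → β → Prop} (h : SigmaOne fun x : α × β => R x.1 x.2) :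
    SigmaOne fun a => ∃ b, R a b := by
  obtain ⟨D, hD, hR⟩ := h.exists_bool
  have h1 : Primrec₂ fun (x : α × ℕ) (b : β) => D (x.1, b) x.2.unpair.2 :=
    (hD.comp (Primrec.pair (Primrec.fst.comp Primrec.fst) Primrec.snd)
      (Primrec.snd.comp (Primrec.unpair.comp (Primrec.snd.comp Primrec.fst)))).to₂
  have h2 : Primrec fun x : α × ℕ => ((Encodable.decode x.2.unpair.1 : Option β).casesOn false
      fun b => D (x.1, b) x.2.unpair.2 : Bool) :=
    Primrec.option_casesOn (Primrec.decode.comp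
      (Primrec.fst.comp (Primrec.unpair.comp Primrec.snd))) (Primrec.const false) h1
  refine ⟨fun a s => ((Encodable.decode s.unpair.1 : Option β).casesOn false
      fun b => D (a, b) s.unpair.2 : Bool) = true,
    Primrec.eq.comp h2 (Primrec.const true), fun a => ?_⟩
  constructor
  · rintro ⟨b, hb⟩
    obtain ⟨s, hs⟩ := (hR (a, b)).1 hb
    exact ⟨Nat.pair (Encodable.encode b) s, by simpa using hs⟩
  · rintro ⟨s, hs⟩
    cases hb : (Encodable.decode s.unpair.1 : Option β) with
    | none => simp [hb] at hs
    | some b =>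
      simp only [hb] at hs
      exact ⟨b, (hR (a, b)).2 ⟨_, hs⟩⟩

theorem SigmaOne.forall_mem {R : α → β → Prop} (h : SigmaOne fun x : α × β => R x.1 x.2)
    {l : α → List β} (hl : Primrec l) : SigmaOne fun a => ∀ b ∈ l a, R a b := by
  obtain ⟨D, hD, hR⟩ := h
  -- a single bound for the certificates of all elements of the list serves as a certificate
  have h1 : PrimrecRel fun (L : List ℕ) (x : α × β) => ∃ t ∈ L, D x t :=
    PrimrecRel.exists_mem_list (R := fun t x => D x t) hD.swap
  have h2 : PrimrecRel fun (b : β) (x : α × ℕ) => ∃ t < x.2, D (x.1, b) t :=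
    (h1.comp (f := fun y : β × α × ℕ => List.range y.2.2) (g := fun y => (y.2.1, y.1))
      (Primrec.list_range.comp (Primrec.snd.comp Primrec.snd))
      (Primrec.pair (Primrec.fst.comp Primrec.snd) Primrec.fst)).of_eq fun y => by simp
  have h3 : PrimrecRel fun (a : α) (s : ℕ) => ∀ b ∈ l a, ∃ t < s, D (a, b) t :=
    (PrimrecRel.forall_mem_list h2).comp (hl.comp Primrec.fst) Primrec.id
  refine ⟨_, h3, fun a => ?_⟩
  constructor
  · intro ha
    have key : ∀ L : List β, (∀ b ∈ L, R a b) → ∃ s, ∀ b ∈ L, ∃ t < s, D (a, b) t := by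
      intro L
      induction L with
      | nil => exact fun _ => ⟨0, by simp⟩
      | cons b L ih =>
        intro hL
        obtain ⟨s, hs⟩ := ih fun b hb => hL b (List.mem_cons_of_mem _ hb)
        obtain ⟨t, ht⟩ := (hR (a, b)).1 (hL b List.mem_cons_self)
        refine ⟨max s (t + 1), fun b' hb' => ?_⟩
        rcases List.mem_cons.1 hb' with rfl | hb'
        · exact ⟨t, by omega, ht⟩
        · obtain ⟨t', h', h''⟩ := hs b' hb'
          exact ⟨t', by omega, h''⟩
    exact key _ ha
  · rintro ⟨s, hs⟩ b hb
    obtain ⟨t, -, ht⟩ := hs b hb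
    exact (hR (a, b)).2 ⟨t, ht⟩

/-- The graph of the universal partial computable function is semidecidable: a bound for the running
time is a certificate. -/
theorem sigmaOne_phi : SigmaOne fun x : ℕ × ℕ × ℕ => x.2.2 ∈ phi x.1 x.2.1 := by
  refine ⟨fun x s => Nat.Partrec.Code.evaln s (Denumerable.ofNat _ x.1) x.2.1 = some x.2.2, ?_,
    fun x => Nat.Partrec.Code.evaln_complete⟩
  exact Primrec.eq.comp (Nat.Partrec.Code.primrec_evaln.comp (Primrec.pair (Primrec.pair
    Primrec.snd ((Primrec.ofNat _).comp (Primrec.fst.comp Primrec.fst)))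
    (Primrec.fst.comp (Primrec.snd.comp Primrec.fst))))
    (Primrec.option_some.comp (Primrec.snd.comp (Primrec.snd.comp Primrec.fst)))

/-- Uniformization: a semidecidable relation contains the graph of a partial computable function
with the same domain. -/
theorem SigmaOne.exists_partrec {R : α → β → Prop} (h : SigmaOne fun x : α × β => R x.1 x.2) :
    ∃ F : α →. β, Partrec F ∧ (∀ a, ∀ b ∈ F a, R a b) ∧ ∀ a, (∃ b, R a b) → (F a).Dom := by
  obtain ⟨D, hD, hR⟩ := h.exists_bool
  let f : α → ℕ → Option β := fun a s => (Encodable.decode s.unpair.1 : Option β).bind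
      fun b => bif D (a, b) s.unpair.2 then some b else none
  have h1 : Primrec₂ fun (x : α × ℕ) (b : β) =>
      bif D (x.1, b) x.2.unpair.2 then some b else none :=
    Primrec.cond ((hD.comp (Primrec.pair (Primrec.fst.comp Primrec.fst) Primrec.snd)
      (Primrec.snd.comp (Primrec.unpair.comp (Primrec.snd.comp Primrec.fst)))))
      (Primrec.option_some.comp Primrec.snd) (Primrec.const none)
  have h2 : Primrec₂ f := Primrec.option_bind (Primrec.decode.comp
      (Primrec.fst.comp (Primrec.unpair.comp Primrec.snd))) h1
  refine ⟨fun a => Nat.rfindOpt (f a), Partrec.rfindOpt h2.to_comp, fun a b hb => ?_, ?_⟩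
  · obtain ⟨s, hs⟩ := Nat.rfindOpt_spec hb
    simp only [f, Option.mem_def, Option.bind_eq_some_iff] at hs
    obtain ⟨b', -, hb'⟩ := hs
    by_cases hDb : D (a, b') s.unpair.2 = true
    · simp only [hDb, cond_true, Option.some.injEq] at hb'
      subst hb'
      exact (hR (a, b')).2 ⟨_, hDb⟩
    · simp [hDb] at hb'
  · rintro a ⟨b, hb⟩
    obtain ⟨s, hs⟩ := (hR (a, b)).1 hb
    refine Nat.rfindOpt_dom.2 ⟨Nat.pair (Encodable.encode b) s, b, ?_⟩
    simp [f, hs]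

/-- The `s`-`m`-`n` theorem for partial computable functions between coded types. -/
theorem exists_index {F : γ × α →. β} (hF : Partrec F) :
    ∃ g : γ → ℕ, Primrec g ∧
      ∀ c a, phi (g c) (Encodable.encode a) = (F (c, a)).map Encodable.encode := by
  obtain ⟨c, hc⟩ := Nat.Partrec.Code.exists_code.1 hF
  refine ⟨fun x => Encodable.encode (c.curry (Encodable.encode x)),
    Primrec.encode.comp (Nat.Partrec.Code.primrec₂_curry.comp (Primrec.const c) Primrec.encode),
    fun x a => ?_⟩
  rw [phi, Denumerable.ofNat_encode, Nat.Partrec.Code.eval_curry, hc]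
  have h : Encodable.decode (Nat.pair (Encodable.encode x) (Encodable.encode a)) =
      some (x, a) := Encodable.encodek (x, a)
  change (Part.bind (Encodable.decode (Nat.pair (Encodable.encode x) (Encodable.encode a)) :
    Option (γ × α)) fun a => Part.map Encodable.encode (F a)) = _
  rw [h]
  simp

/-- An index of a semidecidable set can be computed from its parameters. -/
theorem SigmaOne.exists_W {R : γ → α → Prop} (h : SigmaOne fun x : γ × α => R x.1 x.2) :
    ∃ f : γ → ℕ, Primrec f ∧ ∀ c a, Encodable.encode a ∈ W (f c) ↔ R c a := by
  obtain ⟨F, hF, h1, h2⟩ := SigmaOne.exists_partrec (R := fun (x : γ × α) (_ : Unit) => R x.1 x.2)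
    (h.comp Primrec.fst)
  obtain ⟨f, hf, hff⟩ := exists_index hF
  refine ⟨f, hf, fun c a => ?_⟩
  change (phi (f c) (Encodable.encode a)).Dom ↔ _
  rw [hff]
  exact ⟨fun hd => h1 (c, a) _ (Part.get_mem (o := F (c, a)) hd), fun hR => h2 (c, a) ⟨(), hR⟩⟩

end SigmaOne

/-! ### Values of polynomials and of matrices of polynomials -/

section Eval

variable {U V : Type*} [CStarAlgebra U] [CStarAlgebra V]

/-- The value of a monomial at a sequence of points of a unital C⋆-algebra. -/
def monoEval (b : ℕ → U) (x : Mono) : U := x.1.val • (x.2.map (Letter.eval b)).prod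

/-- The value of a polynomial at a sequence of points of a unital C⋆-algebra. -/
def peval (b : ℕ → U) (p : StarPoly) : U := (p.map (monoEval b)).sum

@[simp] theorem peval_nil (b : ℕ → U) : peval b [] = 0 := rfl

@[simp] theorem peval_cons (b : ℕ → U) (x : Mono) (p : StarPoly) :
    peval b (x :: p) = monoEval b x + peval b p := by simp [peval]

@[simp] theorem peval_append (b : ℕ → U) (p q : StarPoly) :
    peval b (p ++ q) = peval b p + peval b q := by simp [peval]

theorem letterEval_star (b : ℕ → U) (l : Letter) :
    Letter.eval b (starLetter l) = star (Letter.eval b l) := by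
  rcases l with ⟨i, _ | _⟩ <;> simp [Letter.eval, starLetter]

theorem monoEval_mulMono (b : ℕ → U) (x y : Mono) :
    monoEval b (mulMono x y) = monoEval b x * monoEval b y := by
  rw [monoEval, monoEval, monoEval, smul_mul_smul_comm, ← val_gmul, ← List.prod_append,
    ← List.map_append]
  rfl

theorem monoEval_starMono (b : ℕ → U) (x : Mono) :
    monoEval b (starMono x) = star (monoEval b x) := by
  have h : ∀ w : List Letter, ((w.map starLetter).reverse.map (Letter.eval b)).prod =
      star (w.map (Letter.eval b)).prod := by
    intro w
    induction w with
    | nil => simp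
    | cons l w ih =>
      rw [List.map_cons, List.reverse_cons, List.map_append, List.prod_append, ih]
      simp [letterEval_star]
  simp only [monoEval, starMono, val_gconj, star_smul, h]

theorem peval_mulP (b : ℕ → U) (p q : StarPoly) :
    peval b (mulP p q) = peval b p * peval b q := by
  have h (x : Mono) : peval b (q.map fun y => mulMono x y) = monoEval b x * peval b q := by
    induction q with
    | nil => simp
    | cons y q ih => simp [ih, monoEval_mulMono, mul_add]
  induction p with
  | nil => simp [mulP]
  | cons x p ih =>
    rw [peval_cons, add_mul, ← ih, ← h, ← peval_append]
    rfl

theorem peval_starP (b : ℕ → U) (p : StarPoly) : peval b (starP p) = star (peval b p) := by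
  induction p with
  | nil => simp [starP]
  | cons x p ih =>
    rw [peval_cons, star_add, ← ih, ← monoEval_starMono, ← peval_cons]
    rfl

theorem peval_smulP (b : ℕ → U) (c : GaussCode) (p : StarPoly) :
    peval b (smulP c p) = c.val • peval b p := by
  induction p with
  | nil => simp [smulP]
  | cons x p ih =>
    rw [peval_cons, smul_add, ← ih]
    simp [smulP, monoEval, val_gmul, mul_smul]

theorem peval_substP (b : ℕ → U) (f : ℕ → StarPoly) (p : StarPoly) :
    peval b (substP f p) = peval (fun n => peval b (f n)) p := by
  have h (w : List Letter) : peval b (substW f w) =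
      (w.map (Letter.eval fun n => peval b (f n))).prod := by
    induction w with
    | nil => simp [substW, monoEval, val_gint]
    | cons l w ih =>
      rw [List.map_cons, List.prod_cons, ← ih]
      change peval b (mulP (bif l.2 then starP (f l.1) else f l.1) (substW f w)) = _
      rw [peval_mulP]
      rcases l with ⟨i, _ | _⟩ <;> simp [Letter.eval, peval_starP]
  induction p with
  | nil => simp [substP]
  | cons x p ih =>
    rw [peval_cons, ← ih]
    change peval b (smulP x.1 (substW f x.2) ++ substP f p) = _
    rw [peval_append, peval_smulP, h, monoEval]

theorem foldl_mul_eq_prod (b : ℕ → U) (w : List Letter) (y : U) :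
    w.foldl (fun x l => x * Letter.eval b l) y = y * (w.map (Letter.eval b)).prod := by
  induction w generalizing y with
  | nil => simp
  | cons l w ih => simp [ih, mul_assoc]

theorem peval_ofRat (b : ℕ → U) (p : RatPoly) : peval b (ofRat p) = RatPoly.eval b p := by
  induction p with
  | nil => simp [ofRat, RatPoly.eval]
  | cons x p ih =>
    simp only [ofRat, RatPoly.eval, List.map_cons, peval_cons, List.sum_cons] at ih ⊢
    rw [ih, monoEval, Monomial.eval, foldl_mul_eq_prod, List.map_cons, List.prod_cons]

theorem eval_toRat (b : ℕ → U) {u : ℕ} (hu : b u = 1) (p : StarPoly) :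
    RatPoly.eval b (toRat u p) = peval b p := by
  induction p with
  | nil => simp [toRat, RatPoly.eval]
  | cons x p ih =>
    simp only [toRat, RatPoly.eval, List.map_cons, peval_cons, List.sum_cons] at ih ⊢
    rw [ih, monoEval, Monomial.eval, foldl_mul_eq_prod]
    simp [Letter.eval, hu]

theorem letterEval_map (φ : U →⋆ₐ[ℂ] V) (b : ℕ → U) (l : Letter) :
    φ (Letter.eval b l) = Letter.eval (fun n => φ (b n)) l := by
  rcases l with ⟨i, _ | _⟩ <;> simp [Letter.eval, map_star]

theorem monoEval_map (φ : U →⋆ₐ[ℂ] V) (b : ℕ → U) (x : Mono) :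
    φ (monoEval b x) = monoEval (fun n => φ (b n)) x := by
  rw [monoEval, map_smul, map_list_prod, List.map_map, monoEval]
  congr 3
  ext l
  exact letterEval_map φ b l

theorem peval_map (φ : U →⋆ₐ[ℂ] V) (b : ℕ → U) (p : StarPoly) :
    φ (peval b p) = peval (fun n => φ (b n)) p := by
  induction p with
  | nil => simp
  | cons x p ih => simp [ih, monoEval_map]

theorem ratEval_map {A B : Type*} [NonUnitalCStarAlgebra A] [NonUnitalCStarAlgebra B]
    (φ : A →⋆ₙₐ[ℂ] B) (a : ℕ → A) (p : RatPoly) :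
    φ (RatPoly.eval a p) = RatPoly.eval (fun n => φ (a n)) p := by
  have h1 (l : Letter) : φ (Letter.eval a l) = Letter.eval (fun n => φ (a n)) l := by
    rcases l with ⟨i, _ | _⟩ <;> simp [Letter.eval, map_star]
  have h2 (w : List Letter) (x : A) : φ (w.foldl (fun x l => x * Letter.eval a l) x) =
      w.foldl (fun x l => x * Letter.eval (fun n => φ (a n)) l) (φ x) := by
    induction w generalizing x with
    | nil => simp
    | cons l w ih => simp [ih, h1]
  induction p with
  | nil => simp [RatPoly.eval]
  | cons x p ih =>
    simp only [RatPoly.eval, List.map_cons, List.sum_cons] at ih ⊢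
    rw [map_add, ih, Monomial.eval, map_smul, h2, h1]
    rfl

theorem monoEval_renMono (b : ℕ → U) (f : ℕ → ℕ) (x : Mono) :
    monoEval b (renMono f x) = monoEval (fun n => b (f n)) x := by
  rw [monoEval, renMono, List.map_map]
  rfl

/-- A polynomial splits into its constant term and a polynomial without constant term. -/
theorem peval_inr {A : Type*} [NonUnitalCStarAlgebra A] (a : ℕ → A) (p : StarPoly) :
    peval (fun n => (Unitization.inr (a n) : Unitization ℂ A)) p =
      Unitization.inl (constP p).val + Unitization.inr (RatPoly.eval a (nonconst p)) := by
  have h (q : RatPoly) : (Unitization.inr (RatPoly.eval a q) : Unitization ℂ A) =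
      RatPoly.eval (fun n => (Unitization.inr (a n) : Unitization ℂ A)) q :=
    ratEval_map (Unitization.inrNonUnitalStarAlgHom ℂ A) a q
  induction p with
  | nil => simp [constP, nonconst, RatPoly.eval, val_gint]
  | cons x p ih =>
    rw [peval_cons, ih]
    rcases x with ⟨c, _ | ⟨l, w⟩⟩
    · change _ = Unitization.inl (gadd c (constP p)).val + Unitization.inr (RatPoly.eval a (nonconst p))
      rw [val_gadd, Unitization.inl_add, add_assoc]
      simp [monoEval, Algebra.smul_def, Unitization.algebraMap_eq_inl]
    · change _ = Unitization.inl (constP p).val +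
        Unitization.inr (RatPoly.eval a ((c, (l, w)) :: nonconst p))
      rw [h, h, RatPoly.eval, RatPoly.eval, List.map_cons, List.sum_cons, ← add_assoc,
        add_comm (monoEval _ _), add_assoc, monoEval, Monomial.eval, foldl_mul_eq_prod]
      simp

/-! ### Norm bounds for polynomials -/

theorem norm_one_le_one : ‖(1 : U)‖ ≤ 1 := by
  nontriviality U
  exact CStarRing.norm_one.le

theorem norm_letterEval (b : ℕ → U) (l : Letter) : ‖Letter.eval b l‖ = ‖b l.1‖ := by
  rcases l with ⟨i, _ | _⟩ <;> simp [Letter.eval]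

theorem norm_letterEval_sub (b c : ℕ → U) (l : Letter) :
    ‖Letter.eval b l - Letter.eval c l‖ = ‖b l.1 - c l.1‖ := by
  rcases l with ⟨i, _ | _⟩ <;> simp [Letter.eval, ← star_sub]

theorem norm_prod_le {b : ℕ → U} {K : ℕ} {w : List Letter} (h : ∀ l ∈ w, ‖b l.1‖ ≤ K) :
    ‖(w.map (Letter.eval b)).prod‖ ≤ (K : ℝ) ^ w.length := by
  induction w with
  | nil => simpa using norm_one_le_one
  | cons l w ih =>
    rw [List.map_cons, List.prod_cons, List.length_cons, pow_succ']
    refine (norm_mul_le _ _).trans (mul_le_mul ?_ (ih fun l hl => h l (List.mem_cons_of_mem _ hl))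
      (norm_nonneg _) (Nat.cast_nonneg _))
    rw [norm_letterEval]
    exact h l List.mem_cons_self

theorem norm_prod_sub_le {b c : ℕ → U} {K : ℕ} (hK : 1 ≤ K) {η : ℝ} (hη : 0 ≤ η)
    {w : List Letter} (hb : ∀ l ∈ w, ‖b l.1‖ ≤ K) (hc : ∀ l ∈ w, ‖c l.1‖ ≤ K)
    (h : ∀ l ∈ w, ‖b l.1 - c l.1‖ ≤ η) :
    ‖(w.map (Letter.eval b)).prod - (w.map (Letter.eval c)).prod‖ ≤
      (w.length + 1) * (K : ℝ) ^ w.length * η := by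
  have hK' : (1 : ℝ) ≤ K := by exact_mod_cast hK
  induction w with
  | nil => simpa using hη
  | cons l w ih =>
    have hb' := norm_prod_le fun l hl => hb l (List.mem_cons_of_mem _ hl)
    have ih' := ih (fun l hl => hb l (List.mem_cons_of_mem _ hl))
      (fun l hl => hc l (List.mem_cons_of_mem _ hl)) (fun l hl => h l (List.mem_cons_of_mem _ hl))
    have h1 : ‖Letter.eval b l - Letter.eval c l‖ ≤ η := by
      rw [norm_letterEval_sub]; exact h l List.mem_cons_self
    have h2 : ‖Letter.eval c l‖ ≤ K := by
      rw [norm_letterEval]; exact hc l List.mem_cons_self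
    rw [List.map_cons, List.prod_cons, List.map_cons, List.prod_cons, List.length_cons]
    set x := (w.map (Letter.eval b)).prod
    set y := (w.map (Letter.eval c)).prod
    have h3 : Letter.eval b l * x - Letter.eval c l * y =
      (Letter.eval b l - Letter.eval c l) * x + Letter.eval c l * (x - y) := by noncomm_ring
    rw [h3]
    refine (norm_add_le _ _).trans ((add_le_add (norm_mul_le _ _) (norm_mul_le _ _)).trans ?_)
    have h4 : ‖Letter.eval b l - Letter.eval c l‖ * ‖x‖ ≤ η * (K : ℝ) ^ w.length :=
      mul_le_mul h1 hb' (norm_nonneg _) hη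
    have h5 : ‖Letter.eval c l‖ * ‖x - y‖ ≤ K * ((w.length + 1) * (K : ℝ) ^ w.length * η) :=
      mul_le_mul h2 ih' (norm_nonneg _) (by positivity)
    have h6 : η * (K : ℝ) ^ w.length ≤ K * (η * (K : ℝ) ^ w.length) :=
      le_mul_of_one_le_left (by positivity) hK'
    push_cast
    calc _ ≤ K * (η * (K : ℝ) ^ w.length) + K * ((w.length + 1) * (K : ℝ) ^ w.length * η) := by
          linarith
      _ = _ := by ring

theorem norm_peval_le {b : ℕ → U} {K : ℕ} {p : StarPoly}
    (h : ∀ x ∈ p, ∀ l ∈ x.2, ‖b l.1‖ ≤ K) : ‖peval b p‖ ≤ polyBound K p := by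
  induction p with
  | nil => simp [polyBound]
  | cons x p ih =>
    have h1 := ih fun x hx => h x (List.mem_cons_of_mem _ hx)
    have h2 := norm_prod_le (h x List.mem_cons_self)
    have h3 : ‖monoEval b x‖ ≤ gbound x.1 * (x.2.length + 1) * (K : ℝ) ^ x.2.length := by
      rw [monoEval, norm_smul, mul_assoc]
      refine mul_le_mul (norm_val_le _) (h2.trans ?_) (norm_nonneg _) (Nat.cast_nonneg _)
      exact le_mul_of_one_le_left (by positivity) (by linarith [x.2.length.cast_nonneg (α := ℝ)])
    rw [peval_cons]
    refine (norm_add_le _ _).trans ?_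
    simp only [polyBound, List.map_cons, List.sum_cons] at h1 ⊢
    push_cast at h1 ⊢
    linarith

/-- The number `polyBound K p` is a Lipschitz constant of the polynomial `p` on the ball of radius `K`. -/
theorem norm_peval_sub_le {b c : ℕ → U} {K : ℕ} (hK : 1 ≤ K) {η : ℝ} (hη : 0 ≤ η) {p : StarPoly}
    (hb : ∀ x ∈ p, ∀ l ∈ x.2, ‖b l.1‖ ≤ K) (hc : ∀ x ∈ p, ∀ l ∈ x.2, ‖c l.1‖ ≤ K)
    (h : ∀ x ∈ p, ∀ l ∈ x.2, ‖b l.1 - c l.1‖ ≤ η) :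
    ‖peval b p - peval c p‖ ≤ polyBound K p * η := by
  induction p with
  | nil => simp [polyBound]
  | cons x p ih =>
    have h1 := ih (fun x hx => hb x (List.mem_cons_of_mem _ hx))
      (fun x hx => hc x (List.mem_cons_of_mem _ hx)) fun x hx => h x (List.mem_cons_of_mem _ hx)
    have h2 := norm_prod_sub_le hK hη (hb x List.mem_cons_self) (hc x List.mem_cons_self)
      (h x List.mem_cons_self)
    have h3 : ‖monoEval b x - monoEval c x‖ ≤
        gbound x.1 * ((x.2.length + 1) * (K : ℝ) ^ x.2.length * η) := by
      rw [monoEval, monoEval, ← smul_sub, norm_smul]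
      exact mul_le_mul (norm_val_le _) h2 (norm_nonneg _) (Nat.cast_nonneg _)
    rw [peval_cons, peval_cons, add_sub_add_comm]
    refine (norm_add_le _ _).trans ?_
    simp only [polyBound, List.map_cons, List.sum_cons] at h1 ⊢
    push_cast at h1 ⊢
    linarith

/-! ### Values of matrices of polynomials -/

/-- The value of an `m × n` matrix of polynomials at a sequence of points. -/
def meval (b : ℕ → U) (m n : ℕ) (L : MCode) : Matrix (Fin m) (Fin n) U :=
  Matrix.of fun i j => peval b (ent L i j)

theorem meval_apply (b : ℕ → U) (m n : ℕ) (L : MCode) (i : Fin m) (j : Fin n) :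
    meval b m n L i j = peval b (ent L i j) := rfl

theorem peval_ent_cons (b : ℕ → U) (x : (ℕ × ℕ) × Mono) (L : MCode) (i j : ℕ) :
    peval b (ent (x :: L) i j) =
      (if x.1 = (i, j) then monoEval b x.2 else 0) + peval b (ent L i j) := by
  by_cases h : x.1 = (i, j) <;> simp [ent, h]

@[simp] theorem peval_ent_append (b : ℕ → U) (L L' : MCode) (i j : ℕ) :
    peval b (ent (L ++ L') i j) = peval b (ent L i j) + peval b (ent L' i j) := by
  simp [ent]

@[simp] theorem ent_nil (i j : ℕ) : ent [] i j = [] := rfl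

@[simp] theorem meval_append (b : ℕ → U) (m n : ℕ) (L L' : MCode) :
    meval b m n (L ++ L') = meval b m n L + meval b m n L' := by
  ext i j
  simp [meval_apply]

theorem meval_mmul (b : ℕ → U) (l m n : ℕ) (L L' : MCode) :
    meval b l n (mmul m L L') = meval b l m L * meval b m n L' := by
  ext i j
  rw [Matrix.mul_apply]
  simp only [meval_apply]
  induction L with
  | nil => simp [mmul]
  | cons x L ih =>
    simp only [peval_ent_cons b x L, add_mul, Finset.sum_add_distrib, ← ih]
    have h : mmul m (x :: L) L' = (L'.flatMap fun y => if x.1.2 = y.1.1 ∧ x.1.2 < m then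
      [((x.1.1, y.1.2), mulMono x.2 y.2)] else []) ++ mmul m L L' := rfl
    rw [h, peval_ent_append]
    congr 1
    clear ih h
    induction L' with
    | nil => simp
    | cons y L' ih =>
      simp only [List.flatMap_cons, peval_ent_append, peval_ent_cons b y L', mul_add,
        Finset.sum_add_distrib, ← ih]
      congr 1
      rcases x with ⟨⟨x1, x2⟩, x⟩
      rcases y with ⟨⟨y1, y2⟩, y⟩
      simp only [Prod.mk.injEq]
      by_cases hx : x2 < m
      · rw [Finset.sum_eq_single (⟨x2, hx⟩ : Fin m)]
        · by_cases h1 : x2 = y1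
          · subst h1
            simp only [hx, and_self, if_true, peval_ent_cons, ent_nil, peval_nil, add_zero,
              monoEval_mulMono, Prod.mk.injEq]
            by_cases h2 : x1 = i <;> by_cases h3 : y2 = j <;> simp [h2, h3]
          · simp [h1, Ne.symm h1]
        · intro k _ hk
          have : x2 ≠ k := fun h => hk (Fin.ext h.symm)
          simp [this]
        · simp
      · rw [Finset.sum_eq_zero]
        · simp [hx]
        · intro k _
          have : x2 ≠ k := by rintro rfl; exact hx k.2
          simp [this]

theorem peval_ent_mstar (b : ℕ → U) (L : MCode) (i j : ℕ) :
    peval b (ent (mstar L) i j) = star (peval b (ent L j i)) := by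
  induction L with
  | nil => simp [mstar]
  | cons x L ih =>
    rw [peval_ent_cons, star_add, ← ih]
    change peval b (ent (((x.1.2, x.1.1), starMono x.2) :: mstar L) i j) = _
    rw [peval_ent_cons]
    congr 1
    rcases x with ⟨⟨x1, x2⟩, x⟩
    by_cases h1 : x1 = j <;> by_cases h2 : x2 = i <;> simp [h1, h2, monoEval_starMono]

theorem meval_mstar (b : ℕ → U) (m n : ℕ) (L : MCode) :
    meval b m n (mstar L) = (meval b n m L)ᴴ := by
  ext i j
  exact peval_ent_mstar b L i j

theorem peval_ent_msmul (b : ℕ → U) (c : GaussCode) (L : MCode) (i j : ℕ) :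
    peval b (ent (msmul c L) i j) = c.val • peval b (ent L i j) := by
  induction L with
  | nil => simp [msmul]
  | cons x L ih =>
    rw [peval_ent_cons, smul_add, ← ih]
    change peval b (ent ((x.1, (gmul c x.2.1, x.2.2)) :: msmul c L) i j) = _
    rw [peval_ent_cons]
    by_cases h1 : x.1 = (i, j) <;> simp [h1, monoEval, val_gmul, mul_smul]

theorem meval_msmul (b : ℕ → U) (m n : ℕ) (c : GaussCode) (L : MCode) :
    meval b m n (msmul c L) = c.val • meval b m n L := by
  ext i j
  exact peval_ent_msmul b c L i j

theorem peval_ent_mren (b : ℕ → U) (f : ℕ → ℕ) (L : MCode) (i j : ℕ) :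
    peval b (ent (mren f L) i j) = peval (fun n => b (f n)) (ent L i j) := by
  induction L with
  | nil => simp [mren]
  | cons x L ih =>
    rw [peval_ent_cons, ← ih]
    change peval b (ent ((x.1, renMono f x.2) :: mren f L) i j) = _
    rw [peval_ent_cons, monoEval_renMono]

theorem meval_mren (b : ℕ → U) (m n : ℕ) (f : ℕ → ℕ) (L : MCode) :
    meval b m n (mren f L) = meval (fun k => b (f k)) m n L := by
  ext i j
  exact peval_ent_mren b f L i j

theorem meval_map (φ : U →⋆ₐ[ℂ] V) (b : ℕ → U) (m n : ℕ) (L : MCode) :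
    (meval b m n L).map φ = meval (fun k => φ (b k)) m n L := by
  ext i j
  exact peval_map φ b _

theorem meval_msymm (b : ℕ → U) (n : ℕ) (L : MCode) :
    meval b n n (msymm L) = meval b n n L + (meval b n n L)ᴴ := by
  rw [msymm, meval_append, meval_mstar]

theorem meval_newton (b : ℕ → U) (n : ℕ) (L : MCode) :
    meval b n n (newton n L) = (3 : ℂ) • (meval b n n L * meval b n n L) +
      (-2 : ℂ) • (meval b n n L * (meval b n n L * meval b n n L)) := by
  rw [newton, meval_append, meval_msmul, meval_msmul, meval_mmul, meval_mmul, meval_mmul,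
    val_gint, val_gint]
  norm_num

theorem meval_msum (b : ℕ → U) (m n : ℕ) (L L' : MCode) :
    meval b (m + n) (m + n) (msum m L L') = blockSum (meval b m m L) (meval b n n L') := by
  have h1 (i j : ℕ) : peval b (ent (L.flatMap fun x => if x.1.1 < m ∧ x.1.2 < m then [x] else [])
      i j) = if i < m ∧ j < m then peval b (ent L i j) else 0 := by
    induction L with
    | nil => simp
    | cons x L ih =>
      rw [List.flatMap_cons, peval_ent_append, ih, peval_ent_cons]
      rcases x with ⟨⟨x1, x2⟩, x⟩
      by_cases hx : x1 = i ∧ x2 = j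
      · obtain ⟨rfl, rfl⟩ := hx
        by_cases h : x1 < m ∧ x2 < m
        · simp [h, peval_ent_cons]
        · simp [h]
      · by_cases h : x1 < m ∧ x2 < m
        · simp [h, peval_ent_cons, hx]
        · simp [h, hx]
  have h2 (i j : ℕ) : peval b (ent (L'.map fun x => ((x.1.1 + m, x.1.2 + m), x.2)) i j) =
      if m ≤ i ∧ m ≤ j then peval b (ent L' (i - m) (j - m)) else 0 := by
    induction L' with
    | nil => simp
    | cons x L' ih =>
      rw [List.map_cons, peval_ent_cons, ih, peval_ent_cons]
      rcases x with ⟨⟨x1, x2⟩, x⟩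
      by_cases h : m ≤ i ∧ m ≤ j
      · have : (x1 + m = i ∧ x2 + m = j) ↔ (x1 = i - m ∧ x2 = j - m) := by omega
        simp [h, this]
      · have : ¬ (x1 + m = i ∧ x2 + m = j) := by omega
        simp [h, this]
  ext i j
  rw [meval_apply, msum, peval_ent_append, h1, h2]
  obtain ⟨i, rfl⟩ := finSumFinEquiv.surjective i
  obtain ⟨j, rfl⟩ := finSumFinEquiv.surjective j
  rcases i with i | i <;> rcases j with j | j <;>
    simp [blockSum, meval_apply]

end Eval

/-! ### Approximate projections and approximate partial isometries -/

section Newton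

variable {R : Type*} [CStarAlgebra R]

/-- One step of Newton's iteration for projections. -/
def newtonStep (x : R) : R := (3 : ℂ) • (x * x) + (-2 : ℂ) • (x * (x * x))

theorem newtonStep_eq (x : R) :
    newtonStep x = x * x + x * x + x * x - x * (x * x) - x * (x * x) := by
  rw [newtonStep]
  module

theorem newtonStep_selfAdjoint {x : R} (hx : IsSelfAdjoint x) : IsSelfAdjoint (newtonStep x) := by
  rw [newtonStep_eq, IsSelfAdjoint]
  simp [hx.star_eq, mul_assoc]

/-- The defect of an approximate projection decreases quadratically. -/
theorem newtonStep_defect (x : R) : newtonStep x * newtonStep x - newtonStep x =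
    (x * x - x) * (x * x - x) * ((x * x - x) + (x * x - x) + (x * x - x) + (x * x - x) -
      1 - 1 - 1) := by
  rw [newtonStep_eq]
  noncomm_ring

theorem newtonStep_sub (x : R) : newtonStep x - x = (x * x - x) * (1 - x - x) := by
  rw [newtonStep_eq]
  noncomm_ring

theorem norm_le_two_of_defect {x : R} (hx : IsSelfAdjoint x) (h : ‖x * x - x‖ ≤ 1 / 16) :
    ‖x‖ ≤ 2 := by
  have h1 : ‖x‖ * ‖x‖ = ‖x * x‖ := by
    rw [← CStarRing.norm_star_mul_self, hx.star_eq]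
  have h2 : ‖x * x‖ ≤ ‖x * x - x‖ + ‖x‖ := by
    simpa using norm_add_le (x * x - x) x
  nlinarith [norm_nonneg x]

theorem norm_newtonStep_defect_le {x : R} (h : ‖x * x - x‖ ≤ 1 / 16) :
    ‖newtonStep x * newtonStep x - newtonStep x‖ ≤ ‖x * x - x‖ / 4 := by
  rw [newtonStep_defect]
  set d := x * x - x
  have h1 : ‖d + d + d + d - 1 - 1 - 1‖ ≤ 4 * ‖d‖ + 3 := by
    calc _ ≤ ‖d‖ + ‖d‖ + ‖d‖ + ‖d‖ + ‖(1 : R)‖ + ‖(1 : R)‖ + ‖(1 : R)‖ := by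
          refine (norm_sub_le _ _).trans (add_le_add_left ?_ _)
          refine (norm_sub_le _ _).trans (add_le_add_left ?_ _)
          refine (norm_sub_le _ _).trans (add_le_add_left ?_ _)
          refine (norm_add_le _ _).trans (add_le_add_left ?_ _)
          refine (norm_add_le _ _).trans (add_le_add_left ?_ _)
          exact norm_add_le _ _
      _ ≤ _ := by linarith [norm_one_le_one (U := R)]
  refine (norm_mul_le _ _).trans ?_
  refine (mul_le_mul (norm_mul_le _ _) h1 (norm_nonneg _) (by positivity)).trans ?_
  nlinarith [norm_nonneg d, mul_nonneg (norm_nonneg d) (norm_nonneg d)]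

theorem newton_iterate {x : R} (hx : IsSelfAdjoint x) (h : ‖x * x - x‖ ≤ 1 / 16) (M : ℕ) :
    IsSelfAdjoint (newtonStep^[M] x) ∧
      ‖newtonStep^[M] x * newtonStep^[M] x - newtonStep^[M] x‖ ≤ ‖x * x - x‖ * (1 / 4) ^ M := by
  induction M with
  | zero => simpa using hx
  | succ M ih =>
    rw [Function.iterate_succ_apply']
    have h1 : ‖x * x - x‖ * (1 / 4) ^ M ≤ 1 / 16 :=
      (mul_le_of_le_one_right (norm_nonneg _) (pow_le_one₀ (by norm_num) (by norm_num))).trans h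
    refine ⟨newtonStep_selfAdjoint ih.1, (norm_newtonStep_defect_le (ih.2.trans h1)).trans ?_⟩
    rw [pow_succ]
    linarith [ih.2]

/-- Newton's iteration, started at an approximate projection, converges to a projection. -/
theorem exists_newton_limit {x : R} (hx : IsSelfAdjoint x) {δ : ℝ} (h : ‖x * x - x‖ ≤ δ)
    (hδ : δ ≤ 1 / 16) : ∃ p : R, IsSelfAdjoint p ∧ p * p = p ∧
      ∀ M, ‖newtonStep^[M] x - p‖ ≤ 7 * δ * (1 / 4) ^ M := by
  have key (M : ℕ) := newton_iterate hx (h.trans hδ) M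
  have hstep (M : ℕ) : dist (newtonStep^[M] x) (newtonStep^[M + 1] x) ≤ (5 * δ) * (1 / 4) ^ M := by
    have h1 : ‖x * x - x‖ * (1 / 4) ^ M ≤ 1 / 16 :=
      (mul_le_of_le_one_right (norm_nonneg _) (pow_le_one₀ (by norm_num) (by norm_num))).trans
        (h.trans hδ)
    have h2 := norm_le_two_of_defect (key M).1 ((key M).2.trans h1)
    rw [dist_comm, dist_eq_norm, Function.iterate_succ_apply', newtonStep_sub]
    set y := newtonStep^[M] x
    have h3 : ‖1 - y - y‖ ≤ 5 := by
      refine (norm_sub_le _ _).trans ?_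
      have := norm_sub_le (1 : R) y
      linarith [norm_one_le_one (U := R)]
    refine (norm_mul_le _ _).trans ((mul_le_mul (key M).2 h3 (norm_nonneg _) (by positivity)).trans ?_)
    have h4 : (0 : ℝ) ≤ (1 / 4) ^ M := by positivity
    nlinarith
  obtain ⟨p, hp⟩ := cauchySeq_tendsto_of_complete
    (cauchySeq_of_le_geometric (1 / 4) (5 * δ) (by norm_num) hstep)
  have hd : Filter.Tendsto (fun M => newtonStep^[M] x * newtonStep^[M] x - newtonStep^[M] x)
      Filter.atTop (nhds 0) := by
    refine squeeze_zero_norm (fun M => (key M).2) ?_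
    simpa using (tendsto_pow_atTop_nhds_zero_of_lt_one (r := (1 / 4 : ℝ)) (by norm_num)
      (by norm_num)).const_mul ‖x * x - x‖
  refine ⟨p, ?_, ?_, fun M => ?_⟩
  · have h1 := hp.star
    exact tendsto_nhds_unique (h1.congr fun M => (key M).1.star_eq) hp
  · exact sub_eq_zero.1 (tendsto_nhds_unique ((hp.mul hp).sub hp) hd)
  · rw [← dist_eq_norm]
    refine (dist_le_of_le_geometric_of_tendsto (1 / 4) (5 * δ) (by norm_num) hstep hp M).trans ?_
    have h4 : (0 : ℝ) ≤ (1 / 4) ^ M := by positivity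
    have h5 : 0 ≤ δ := (norm_nonneg _).trans h
    have : 5 * δ * (1 / 4) ^ M / (1 - 1 / 4) = (20 / 3) * (δ * (1 / 4) ^ M) := by ring
    rw [this]
    nlinarith [mul_nonneg h5 h4]

/-- An element close to the unit has an inverse square root in its commutant. -/
theorem exists_inv_sqrt {a : R} (ha : IsSelfAdjoint a) (h : ‖a - 1‖ < 1) :
    ∃ r : R, IsSelfAdjoint r ∧ r * r * a = 1 ∧ ∀ q, Commute a q → Commute r q := by
  have hpos : ∀ t ∈ spectrum ℝ a, 0 < t := by
    intro t ht
    have h1 : t - 1 ∈ spectrum ℝ (a - 1) := by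
      have := spectrum.sub_singleton_eq (R := ℝ) a 1
      rw [map_one] at this
      rw [← this]
      exact ⟨t, ht, 1, rfl, rfl⟩
    have h2 := spectrum.norm_le_norm_mul_of_mem h1
    rw [Real.norm_eq_abs] at h2
    have h3 : ‖a - 1‖ * ‖(1 : R)‖ ≤ ‖a - 1‖ :=
      mul_le_of_le_one_right (norm_nonneg _) norm_one_le_one
    have := (abs_lt.1 (h2.trans_lt (h3.trans_lt h))).1
    linarith
  have hc : ContinuousOn (fun t : ℝ => (Real.sqrt t)⁻¹) (spectrum ℝ a) :=
    Real.continuous_sqrt.continuousOn.inv₀ fun t ht => (Real.sqrt_pos.2 (hpos t ht)).ne'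
  refine ⟨cfc (fun t : ℝ => (Real.sqrt t)⁻¹) a, cfc_predicate _ a, ?_, fun q hq => ?_⟩
  · have e1 := cfc_mul (fun t : ℝ => (Real.sqrt t)⁻¹) (fun t : ℝ => (Real.sqrt t)⁻¹) a hc hc
    have e2 := cfc_mul (fun t : ℝ => (Real.sqrt t)⁻¹ * (Real.sqrt t)⁻¹) (fun t : ℝ => t) a
      (hc.mul hc) continuousOn_id
    rw [cfc_id' ℝ a, e1] at e2
    rw [← e2, ← cfc_one ℝ a]
    refine cfc_congr fun t ht => ?_
    have h0 := hpos t ht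
    change (Real.sqrt t)⁻¹ * (Real.sqrt t)⁻¹ * t = 1
    rw [← mul_inv, Real.mul_self_sqrt h0.le, inv_mul_cancel₀ h0.ne']
  · exact hq.cfc_real _

end Newton

section Matrices

variable {U : Type*} [CStarAlgebra U]

theorem norm_cstarMatrix_le [PartialOrder U] [StarOrderedRing U] {m n : ℕ}
    (M : CStarMatrix (Fin m) (Fin n) U) : ‖M‖ ≤ ∑ j, ∑ i, ‖M i j‖ := by
  rw [CStarMatrix.norm_def]
  refine (CStarMatrix.toCLM M).opNorm_le_bound (by positivity) fun v => ?_
  simp only [CStarMatrix.toCLM_apply_eq_sum, Finset.sum_mul]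
  apply WithCStarModule.pi_norm_le_sum_norm _ |>.trans
  gcongr with i _
  change ‖∑ j, v j * M j i‖ ≤ _
  apply norm_sum_le _ _ |>.trans
  gcongr with j _
  apply norm_mul_le _ _ |>.trans
  rw [mul_comm]
  gcongr
  exact WithCStarModule.norm_apply_le_norm v j

theorem norm_cstarMatrix_le_of_forall [PartialOrder U] [StarOrderedRing U] {n : ℕ}
    {M : CStarMatrix (Fin n) (Fin n) U} {ε : ℝ} (h : ∀ i j, ‖M i j‖ ≤ ε) :
    ‖M‖ ≤ (n : ℝ) ^ 2 * ε := by
  refine (norm_cstarMatrix_le M).trans ?_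
  refine (Finset.sum_le_sum fun j _ => Finset.sum_le_sum fun i _ => h i j).trans ?_
  simp [sq, mul_assoc]

/-- Newton's iteration for projections in a matrix algebra. -/
def newtonMat {n : ℕ} (x : Matrix (Fin n) (Fin n) U) : Matrix (Fin n) (Fin n) U :=
  (3 : ℂ) • (x * x) + (-2 : ℂ) • (x * (x * x))

theorem ofMatrix_iterate_newtonMat [PartialOrder U] [StarOrderedRing U] {n : ℕ}
    (x : Matrix (Fin n) (Fin n) U) (M : ℕ) :
    CStarMatrix.ofMatrix (newtonMat^[M] x) =
      newtonStep^[M] (CStarMatrix.ofMatrix x : CStarMatrix (Fin n) (Fin n) U) :=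
  Function.Semiconj.iterate_right
    (f := (CStarMatrix.ofMatrix : Matrix (Fin n) (Fin n) U → CStarMatrix (Fin n) (Fin n) U))
    (ga := newtonMat) (gb := newtonStep) (fun _ => rfl) M x

/-- Newton's iteration in a matrix algebra, with all norms taken entrywise: matrices over a C⋆-algebra form
a C⋆-algebra, whose norm is comparable to the norms of the entries. -/
theorem exists_newtonMat_limit {n : ℕ} {x : Matrix (Fin n) (Fin n) U} (hx : xᴴ = x) {ε : ℝ}
    (h : ∀ i j, ‖(x * x - x) i j‖ ≤ ε) (hε : (n : ℝ) ^ 2 * ε ≤ 1 / 16) :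
    ∃ p : Matrix (Fin n) (Fin n) U, pᴴ = p ∧ p * p = p ∧
      ∀ M i j, ‖(newtonMat^[M] x) i j - p i j‖ ≤ 7 * ((n : ℝ) ^ 2 * ε) * (1 / 4) ^ M := by
  let _ := CStarAlgebra.spectralOrder U
  have _ := CStarAlgebra.spectralOrderedRing U
  let X : CStarMatrix (Fin n) (Fin n) U := CStarMatrix.ofMatrix x
  have h' : ‖X * X - X‖ ≤ (n : ℝ) ^ 2 * ε := norm_cstarMatrix_le_of_forall h
  obtain ⟨p, h1, h2, h3⟩ := exists_newton_limit (x := X) hx h' hε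
  refine ⟨CStarMatrix.ofMatrix.symm p, h1, h2, fun M i j => ?_⟩
  have h4 := h3 M
  rw [← ofMatrix_iterate_newtonMat] at h4
  exact (CStarMatrix.norm_entry_le_norm (i := i) (j := j)).trans h4

/-- A matrix whose entries are close to those of the unit matrix has an inverse square root in its
commutant. -/
theorem exists_matrix_inv_sqrt {n : ℕ} {a : Matrix (Fin n) (Fin n) U} (ha : aᴴ = a) {ε : ℝ}
    (h : ∀ i j, ‖(a - 1) i j‖ ≤ ε) (hε : (n : ℝ) ^ 2 * ε < 1) :
    ∃ r : Matrix (Fin n) (Fin n) U, rᴴ = r ∧ r * r * a = 1 ∧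
      ∀ q, a * q = q * a → r * q = q * r := by
  let _ := CStarAlgebra.spectralOrder U
  have _ := CStarAlgebra.spectralOrderedRing U
  let X : CStarMatrix (Fin n) (Fin n) U := CStarMatrix.ofMatrix a
  have h' : ‖X - 1‖ ≤ (n : ℝ) ^ 2 * ε := norm_cstarMatrix_le_of_forall h
  obtain ⟨r, h1, h2, h3⟩ := exists_inv_sqrt (a := X) ha (h'.trans_lt hε)
  exact ⟨CStarMatrix.ofMatrix.symm r, h1, h2, fun q hq => h3 (CStarMatrix.ofMatrix q) hq⟩

/-- If `v` is, up to a small error, a partial isometry between two projections, then these are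
equivalent: the polar part of `v` is a partial isometry. -/
theorem MvNRel.of_approx {m n : ℕ} {p : Matrix (Fin m) (Fin m) U} {q : Matrix (Fin n) (Fin n) U}
    (hp : pᴴ = p) (hpp : p * p = p) (hq : qᴴ = q) (hqq : q * q = q) {v : Matrix (Fin m) (Fin n) U}
    (hpv : p * v = v) (hvq : v * q = v) {ε : ℝ}
    (h1 : ∀ i j, ‖(v * vᴴ - p) i j‖ ≤ ε) (h2 : ∀ i j, ‖(vᴴ * v - q) i j‖ ≤ ε)
    (hm : (m : ℝ) ^ 2 * ε < 1) (hn : (n : ℝ) ^ 2 * ε < 1) : MvNRel p q := by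
  have hvp : vᴴ * p = vᴴ := by rw [← hp, ← Matrix.conjTranspose_mul, hpv]
  have hqv : q * vᴴ = vᴴ := by rw [← hq, ← Matrix.conjTranspose_mul, hvq]
  have ha1 : (vᴴ * v + (1 - q)) - 1 = vᴴ * v - q := by abel
  have hb1 : (v * vᴴ + (1 - p)) - 1 = v * vᴴ - p := by abel
  obtain ⟨r, hr, hra, hrq⟩ := exists_matrix_inv_sqrt (a := vᴴ * v + (1 - q))
    (by simp [Matrix.conjTranspose_mul, hq]) (by rw [ha1]; exact h2) hn
  obtain ⟨s, -, hsb, hsq⟩ := exists_matrix_inv_sqrt (a := v * vᴴ + (1 - p))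
    (by simp [Matrix.conjTranspose_mul, hp]) (by rw [hb1]; exact h1) hm
  have hqa : q * (vᴴ * v + (1 - q)) = vᴴ * v := by
    rw [mul_add, ← Matrix.mul_assoc, hqv, mul_sub, mul_one, hqq, sub_self, add_zero]
  have haq : (vᴴ * v + (1 - q)) * q = vᴴ * v := by
    rw [add_mul, Matrix.mul_assoc, hvq, sub_mul, one_mul, hqq, sub_self, add_zero]
  have hrq' := hrq q (haq.trans hqa.symm)
  have hva : v * (vᴴ * v + (1 - q)) = v * vᴴ * v := by
    rw [Matrix.mul_add, Matrix.mul_sub, Matrix.mul_one, hvq, sub_self, add_zero, Matrix.mul_assoc]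
  have hbv : (v * vᴴ + (1 - p)) * v = v * vᴴ * v := by
    rw [Matrix.add_mul, Matrix.sub_mul, Matrix.one_mul, hpv, sub_self, add_zero]
  have har : (vᴴ * v + (1 - q)) * r = r * (vᴴ * v + (1 - q)) := (hrq _ rfl).symm
  refine ⟨v * r, ?_, ?_⟩
  · -- `v` intertwines `v* v + 1 - q` and `v v* + 1 - p`, hence also their inverses
    have hinv : v * (r * r) = s * s * v := by
      have hra' : (vᴴ * v + (1 - q)) * (r * r) = 1 := by
        rw [← Matrix.mul_assoc, har, Matrix.mul_assoc, har, ← Matrix.mul_assoc, hra]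
      calc v * (r * r) = s * s * (v * vᴴ + (1 - p)) * v * (r * r) := by rw [hsb, Matrix.one_mul]
        _ = s * s * (v * (vᴴ * v + (1 - q))) * (r * r) := by
            rw [Matrix.mul_assoc (s * s), hbv, hva]
        _ = s * s * v * ((vᴴ * v + (1 - q)) * (r * r)) := by simp only [Matrix.mul_assoc]
        _ = s * s * v := by rw [hra', Matrix.mul_one]
    have hbp : (v * vᴴ + (1 - p)) * p = v * vᴴ := by
      rw [Matrix.add_mul, Matrix.mul_assoc, hvp, Matrix.sub_mul, Matrix.one_mul, hpp, sub_self,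
        add_zero]
    rw [Matrix.conjTranspose_mul, hr]
    calc p = s * s * (v * vᴴ + (1 - p)) * p := by rw [hsb, Matrix.one_mul]
      _ = s * s * (v * vᴴ) := by rw [Matrix.mul_assoc (s * s), hbp]
      _ = s * s * v * vᴴ := by simp only [Matrix.mul_assoc]
      _ = v * (r * r) * vᴴ := by rw [hinv]
      _ = v * r * (r * vᴴ) := by simp only [Matrix.mul_assoc]
  · rw [Matrix.conjTranspose_mul, hr]
    have hrar : r * (vᴴ * v + (1 - q)) * r = 1 := by
      rw [Matrix.mul_assoc, har, ← Matrix.mul_assoc, hra]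
    calc q = q * (r * (vᴴ * v + (1 - q)) * r) := by rw [hrar, Matrix.mul_one]
      _ = r * (q * (vᴴ * v + (1 - q))) * r := by
          rw [← Matrix.mul_assoc, ← Matrix.mul_assoc, ← hrq', Matrix.mul_assoc r q]
      _ = r * vᴴ * (v * r) := by rw [hqa]; simp only [Matrix.mul_assoc]

end Matrices

/-! ### Codes of projections -/

section Codes

variable {U V : Type*} [CStarAlgebra U] [CStarAlgebra V]

theorem meval_newtonIter (b : ℕ → U) (n M : ℕ) (L : MCode) :
    meval b n n (newtonIter n M L) = newtonMat^[M] (meval b n n L) :=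
  Function.Semiconj.iterate_right (f := meval b n n) (ga := newton n) (gb := newtonMat)
    (fun L => meval_newton b n L) M L

/-- The code `L` converges to the projection `p`: so does Newton's iteration started at the value of
`L`, at a rate that does not depend on `L`. -/
structure Conv (b : ℕ → U) (n : ℕ) (L : MCode) (p : Matrix (Fin n) (Fin n) U) : Prop where
  selfAdj : pᴴ = p
  idem : p * p = p
  lt : ∀ M i j, ‖meval b n n (newtonIter n M L) i j - p i j‖ < (2 : ℝ)⁻¹ ^ M

/-- The projection to which a code converges. -/
def Conv.proj {b : ℕ → U} {n : ℕ} {L : MCode} {p : Matrix (Fin n) (Fin n) U}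
    (h : Conv b n L p) : Proj U := ⟨n, p, h.selfAdj, h.idem⟩

theorem Conv.tendsto {b : ℕ → U} {n : ℕ} {L : MCode} {p : Matrix (Fin n) (Fin n) U}
    (h : Conv b n L p) :
    Filter.Tendsto (fun M => meval b n n (newtonIter n M L)) Filter.atTop (nhds p) := by
  refine tendsto_pi_nhds.2 fun i => tendsto_pi_nhds.2 fun j => ?_
  rw [tendsto_iff_norm_sub_tendsto_zero]
  exact squeeze_zero (fun _ => norm_nonneg _) (fun M => (h.lt M i j).le)
    (tendsto_pow_atTop_nhds_zero_of_lt_one (by norm_num) (by norm_num))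

theorem Conv.unique {b : ℕ → U} {n : ℕ} {L : MCode} {p q : Matrix (Fin n) (Fin n) U}
    (hp : Conv b n L p) (hq : Conv b n L q) : p = q :=
  tendsto_nhds_unique hp.tendsto hq.tendsto

theorem pow_half_pos (k : ℕ) : (0 : ℝ) < 2⁻¹ ^ k := by positivity

theorem sq_mul_pow_le (n k : ℕ) : (n : ℝ) ^ 2 * 2⁻¹ ^ (2 * n + k) ≤ 2⁻¹ ^ k := by
  have h1 : (n : ℝ) * 2⁻¹ ^ n ≤ 1 := by
    rw [inv_pow, ← div_eq_mul_inv, div_le_one (by positivity)]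
    exact_mod_cast Nat.lt_two_pow_self.le
  have h2 : (0 : ℝ) ≤ (n : ℝ) * 2⁻¹ ^ n := by positivity
  calc (n : ℝ) ^ 2 * 2⁻¹ ^ (2 * n + k) = (n * 2⁻¹ ^ n) * (n * 2⁻¹ ^ n) * 2⁻¹ ^ k := by ring
    _ ≤ 1 * 2⁻¹ ^ k := by
        refine mul_le_mul_of_nonneg_right ?_ (pow_half_pos k).le
        nlinarith
    _ = _ := one_mul _

/-- An approximate projection is a code of a projection nearby. The tolerance `2⁻¹ ^ (6 * n + 5)` absorbs
the factor `n ^ 2 ≤ 2 ^ (2 * n)` between the norm of a matrix and those of its entries, and leaves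
`2⁻¹ ^ (4 * n + 5)` to spare, so that nearby codes give equivalent projections. -/
theorem Conv.of_defect {b : ℕ → U} {n : ℕ} {L : MCode}
    (hs : (meval b n n L)ᴴ = meval b n n L)
    (h : ∀ i j, ‖(meval b n n L * meval b n n L - meval b n n L) i j‖ ≤ 2⁻¹ ^ (6 * n + 5)) :
    ∃ p, Conv b n L p ∧ ∀ i j, ‖meval b n n L i j - p i j‖ ≤ 7 * 2⁻¹ ^ (4 * n + 5) := by
  have h1 : (n : ℝ) ^ 2 * 2⁻¹ ^ (6 * n + 5) ≤ 2⁻¹ ^ (4 * n + 5) := by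
    have := sq_mul_pow_le n (4 * n + 5)
    rwa [show 2 * n + (4 * n + 5) = 6 * n + 5 by ring] at this
  have h2 : (2⁻¹ : ℝ) ^ (4 * n + 5) ≤ 2⁻¹ ^ 5 :=
    pow_le_pow_of_le_one (by norm_num) (by norm_num) (by omega)
  obtain ⟨p, hp1, hp2, hp3⟩ := exists_newtonMat_limit hs h (by norm_num at h2 ⊢; linarith)
  refine ⟨p, ⟨hp1, hp2, fun M i j => ?_⟩, fun i j => ?_⟩
  · rw [meval_newtonIter]
    refine (hp3 M i j).trans_lt ?_
    have h3 : ((1 : ℝ) / 4) ^ M ≤ 2⁻¹ ^ M := pow_le_pow_left₀ (by norm_num) (by norm_num) M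
    have h4 := pow_half_pos M
    have h5 : 7 * ((n : ℝ) ^ 2 * 2⁻¹ ^ (6 * n + 5)) ≤ 1 / 2 := by norm_num at h2 ⊢; linarith
    have h6 : (0 : ℝ) ≤ (1 / 4) ^ M := by positivity
    nlinarith
  · have := hp3 0 i j
    simp only [Function.iterate_zero, id, pow_zero, mul_one] at this
    linarith

theorem newtonMat_blockSum {m n : ℕ} (x : Matrix (Fin m) (Fin m) U) (y : Matrix (Fin n) (Fin n) U) :
    newtonMat (blockSum x y) = blockSum (newtonMat x) (newtonMat y) := by
  rw [newtonMat, blockSum_mul, blockSum_mul, newtonMat, newtonMat]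
  ext i j
  obtain ⟨i, rfl⟩ := finSumFinEquiv.surjective i
  obtain ⟨j, rfl⟩ := finSumFinEquiv.surjective j
  rcases i with i | i <;> rcases j with j | j <;>
    simp [blockSum, -finSumFinEquiv_apply_left, -finSumFinEquiv_apply_right]

theorem newtonMat_iterate_blockSum {m n : ℕ} (x : Matrix (Fin m) (Fin m) U)
    (y : Matrix (Fin n) (Fin n) U) (M : ℕ) :
    newtonMat^[M] (blockSum x y) = blockSum (newtonMat^[M] x) (newtonMat^[M] y) := by
  induction M with
  | zero => rfl
  | succ M ih => rw [Function.iterate_succ_apply', Function.iterate_succ_apply',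
      Function.iterate_succ_apply', ih, newtonMat_blockSum]

theorem Conv.msum {b : ℕ → U} {m n : ℕ} {L L' : MCode} {p : Matrix (Fin m) (Fin m) U}
    {q : Matrix (Fin n) (Fin n) U} (hp : Conv b m L p) (hq : Conv b n L' q) :
    Conv b (m + n) (msum m L L') (blockSum p q) := by
  refine ⟨by rw [blockSum_conjTranspose, hp.selfAdj, hq.selfAdj],
    by rw [blockSum_mul, hp.idem, hq.idem], fun M i j => ?_⟩
  have h1 := hp.lt M
  have h2 := hq.lt M
  have h0 := pow_half_pos M
  rw [meval_newtonIter] at h1 h2 ⊢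
  rw [meval_msum, newtonMat_iterate_blockSum]
  obtain ⟨i, rfl⟩ := finSumFinEquiv.surjective i
  obtain ⟨j, rfl⟩ := finSumFinEquiv.surjective j
  rcases i with i | i <;> rcases j with j | j <;>
    simp [blockSum, -finSumFinEquiv_apply_left, -finSumFinEquiv_apply_right, -inv_pow, h0, h1, h2]

theorem Conv.nil (b : ℕ → U) : Conv b 0 [] 0 :=
  ⟨by simp, by simp, fun _ i => i.elim0⟩

theorem Conv.map (φ : U →⋆ₐ[ℂ] V) {b : ℕ → U} {n : ℕ} {L : MCode} {p : Matrix (Fin n) (Fin n) U}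
    (h : Conv b n L p) : Conv (fun k => φ (b k)) n L (p.map φ) := by
  refine ⟨by rw [conjTranspose_map_hom, h.selfAdj], by rw [← mul_map_hom, h.idem],
    fun M i j => ?_⟩
  rw [← meval_map, Matrix.map_apply, Matrix.map_apply, ← map_sub]
  exact (NonUnitalStarAlgHom.norm_apply_le φ _).trans_lt (h.lt M i j)

theorem Conv.mren {b : ℕ → U} {f : ℕ → ℕ} {n : ℕ} {L : MCode} {p : Matrix (Fin n) (Fin n) U}
    (h : Conv (fun k => b (f k)) n L p) : Conv b n (mren f L) p := by
  refine ⟨h.selfAdj, h.idem, fun M i j => ?_⟩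
  have h1 := h.lt M i j
  rw [meval_newtonIter] at h1 ⊢
  rwa [meval_mren]

end Codes

/-! ### Tests for norms and for equivalence of projections -/

section Tests

variable {U : Type*} [CStarAlgebra U]

/-- The relation `T` is a test for upper bounds of norms at the points `b`; it may miss a bound that
is too close to the norm. The test need not be monotone: only the two implications are required. -/
structure IsNormTest (b : ℕ → U) (T : StarPoly → ℕ → Prop) : Prop where
  sound : ∀ r k, T r k → ‖peval b r‖ < (2 : ℝ)⁻¹ ^ k
  complete : ∀ r k, ‖peval b r‖ < (2 : ℝ)⁻¹ ^ (k + 4) → T r k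

/-- The norm test for all entries of a matrix. -/
def MatTest (T : StarPoly → ℕ → Prop) (m n : ℕ) (L : MCode) (k : ℕ) : Prop :=
  ∀ i ∈ List.range m, ∀ j ∈ List.range n, T (ent L i j) k

theorem MatTest.lt {b : ℕ → U} {T : StarPoly → ℕ → Prop} (hT : IsNormTest b T) {m n k : ℕ}
    {L : MCode} (h : MatTest T m n L k) (i : Fin m) (j : Fin n) :
    ‖meval b m n L i j‖ < (2 : ℝ)⁻¹ ^ k :=
  hT.sound _ _ (h i (List.mem_range.2 i.2) j (List.mem_range.2 j.2))

theorem eventually_matTest {b : ℕ → U} {T : StarPoly → ℕ → Prop} (hT : IsNormTest b T) {m n : ℕ}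
    {L : ℕ → MCode}
    (h : Filter.Tendsto (fun M => meval b m n (L M)) Filter.atTop (nhds 0)) (k : ℕ) :
    ∀ᶠ M in Filter.atTop, MatTest T m n (L M) k := by
  have h1 : ∀ i : Fin m, ∀ j : Fin n, ∀ᶠ M in Filter.atTop,
      ‖meval b m n (L M) i j‖ < (2 : ℝ)⁻¹ ^ (k + 4) := by
    intro i j
    have h2 := (tendsto_pi_nhds.1 ((tendsto_pi_nhds.1 h) i)) j
    exact (tendsto_zero_iff_norm_tendsto_zero.1 h2).eventually (gt_mem_nhds (pow_half_pos _))
  filter_upwards [Filter.eventually_all.2 fun i => Filter.eventually_all.2 (h1 i)] with M hM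
  intro i hi j hj
  exact hT.complete _ _ (hM ⟨i, List.mem_range.1 hi⟩ ⟨j, List.mem_range.1 hj⟩)

/-- The test whether a code is an approximate projection. -/
def ValidTest (T : StarPoly → ℕ → Prop) (n : ℕ) (L : MCode) : Prop :=
  MatTest T n n (mmul n L L ++ msmul (gint (-1)) L) (6 * n + 5)

theorem meval_defect (b : ℕ → U) (n : ℕ) (L : MCode) :
    meval b n n (mmul n L L ++ msmul (gint (-1)) L) =
      meval b n n L * meval b n n L - meval b n n L := by
  rw [meval_append, meval_mmul, meval_msmul, val_gint, Int.cast_neg, Int.cast_one, neg_smul,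
    one_smul, sub_eq_add_neg]

theorem meval_msymm_selfAdj (b : ℕ → U) (n : ℕ) (L : MCode) :
    (meval b n n (msymm L))ᴴ = meval b n n (msymm L) := by
  rw [meval_msymm, Matrix.conjTranspose_add, Matrix.conjTranspose_conjTranspose, add_comm]

theorem ValidTest.exists_conv {b : ℕ → U} {T : StarPoly → ℕ → Prop} (hT : IsNormTest b T) {n : ℕ}
    {L : MCode} (h : ValidTest T n (msymm L)) :
    ∃ p, Conv b n (msymm L) p ∧
      ∀ i j, ‖meval b n n (msymm L) i j - p i j‖ ≤ 7 * 2⁻¹ ^ (4 * n + 5) := by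
  refine Conv.of_defect (meval_msymm_selfAdj b n L) fun i j => ?_
  rw [← meval_defect]
  exact (MatTest.lt hT h i j).le

theorem tendsto_msymm {b : ℕ → U} {n : ℕ} {p : Matrix (Fin n) (Fin n) U} (hp : pᴴ = p)
    {y : ℕ → MCode} (h : Filter.Tendsto (fun M => meval b n n (y M)) Filter.atTop
      (nhds ((2⁻¹ : ℂ) • p))) :
    Filter.Tendsto (fun M => meval b n n (msymm (y M))) Filter.atTop (nhds p) := by
  have h1 : (2⁻¹ : ℂ) • p + ((2⁻¹ : ℂ) • p)ᴴ = p := by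
    rw [Matrix.conjTranspose_smul, hp, ← add_smul]
    norm_num
  have h2 : Continuous fun x : Matrix (Fin n) (Fin n) U => x + xᴴ := by fun_prop
  have h3 := (h2.tendsto _).comp h
  rw [h1] at h3
  exact h3.congr fun M => (meval_msymm b n (y M)).symm

/-- Close enough approximations of a projection pass the test. The codes are approximations of half of the
projection since `ValidTest` is applied to `y + y*`. -/
theorem eventually_validTest {b : ℕ → U} {T : StarPoly → ℕ → Prop} (hT : IsNormTest b T) {n : ℕ}
    {p : Matrix (Fin n) (Fin n) U} (hp : pᴴ = p) (hpp : p * p = p) {y : ℕ → MCode}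
    (h : Filter.Tendsto (fun M => meval b n n (y M)) Filter.atTop (nhds ((2⁻¹ : ℂ) • p))) :
    ∀ᶠ M in Filter.atTop, ValidTest T n (msymm (y M)) := by
  refine eventually_matTest hT (L := fun M => _) ?_ _
  have h2 : Continuous fun x : Matrix (Fin n) (Fin n) U => x * x - x := by fun_prop
  have h3 := (h2.tendsto _).comp (tendsto_msymm hp h)
  rw [hpp, sub_self] at h3
  exact h3.congr fun M => (meval_defect b n _).symm

theorem norm_proj_entry_le {n : ℕ} {p : Matrix (Fin n) (Fin n) U} (hp : pᴴ = p) (hpp : p * p = p)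
    (i j : Fin n) : ‖p i j‖ ≤ 1 := by
  let _ := CStarAlgebra.spectralOrder U
  have _ := CStarAlgebra.spectralOrderedRing U
  let X : CStarMatrix (Fin n) (Fin n) U := CStarMatrix.ofMatrix p
  have h1 : ‖X‖ ≤ 1 := by
    have h2 : ‖X‖ * ‖X‖ = ‖X‖ := by
      rw [← CStarRing.norm_star_mul_self, show star X = X from hp, show X * X = X from hpp]
    nlinarith [norm_nonneg X]
  exact (CStarMatrix.norm_entry_le_norm (M := X)).trans h1

theorem norm_mul_entry_le {l m n : ℕ} {x : Matrix (Fin l) (Fin m) U} {y : Matrix (Fin m) (Fin n) U}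
    {α β : ℝ} (hα : 0 ≤ α) (hx : ∀ i j, ‖x i j‖ ≤ α) (hy : ∀ i j, ‖y i j‖ ≤ β) (i : Fin l)
    (j : Fin n) : ‖(x * y) i j‖ ≤ m * (α * β) := by
  rw [Matrix.mul_apply]
  refine (norm_sum_le_of_le _ fun k _ => (norm_mul_le _ _).trans
    (mul_le_mul (hx i k) (hy k j) (norm_nonneg _) hα)).trans ?_
  simp

/-- A compression by a projection increases the entries of a matrix by a factor that depends only on
its size. -/
theorem norm_compression_le {n : ℕ} {p : Matrix (Fin n) (Fin n) U} (hp : pᴴ = p) (hpp : p * p = p)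
    {x : Matrix (Fin n) (Fin n) U} {ε : ℝ} (hx : ∀ i j, ‖x i j‖ ≤ ε) (i j : Fin n) :
    ‖(p * x * p) i j‖ ≤ n ^ 2 * ε := by
  have h1 := norm_mul_entry_le zero_le_one (norm_proj_entry_le hp hpp) hx
  have h0 : 0 ≤ (n : ℝ) * (1 * ε) := by
    have := (norm_nonneg _).trans (hx i j)
    positivity
  refine (norm_mul_entry_le h0 h1 (norm_proj_entry_le hp hpp) i j).trans_eq ?_
  ring

/-- Projections that are close to each other are equivalent. -/
theorem MvNRel.of_close {n : ℕ} {p q : Matrix (Fin n) (Fin n) U} (hp : pᴴ = p) (hpp : p * p = p)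
    (hq : qᴴ = q) (hqq : q * q = q) {ε : ℝ} (h : ∀ i j, ‖p i j - q i j‖ ≤ ε)
    (hε : (n : ℝ) ^ 2 * (n ^ 2 * ε) < 1) : MvNRel p q := by
  have h1 : (p * q) * (p * q)ᴴ - p = p * (q - p) * p := by
    rw [Matrix.conjTranspose_mul, hp, hq, Matrix.mul_assoc p q, ← Matrix.mul_assoc q q, hqq,
      Matrix.mul_sub, Matrix.sub_mul, hpp, hpp, Matrix.mul_assoc]
  have h2 : (p * q)ᴴ * (p * q) - q = q * (p - q) * q := by
    rw [Matrix.conjTranspose_mul, hp, hq, Matrix.mul_assoc q p, ← Matrix.mul_assoc p p, hpp,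
      Matrix.mul_sub, Matrix.sub_mul, hqq, hqq, Matrix.mul_assoc]
  refine MvNRel.of_approx hp hpp hq hqq (v := p * q) (by rw [← Matrix.mul_assoc, hpp])
    (by rw [Matrix.mul_assoc, hqq]) (ε := n ^ 2 * ε) ?_ ?_ hε hε
  · rw [h1]
    refine norm_compression_le hp hpp fun i j => ?_
    rw [Matrix.sub_apply, norm_sub_rev]
    exact h i j
  · rw [h2]
    exact norm_compression_le hq hqq fun i j => h i j

theorem quartic_mul_pow_le (n k : ℕ) : (n : ℝ) ^ 2 * (n ^ 2 * 2⁻¹ ^ (4 * n + k)) ≤ 2⁻¹ ^ k := by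
  have h1 := sq_mul_pow_le n (2 * n + k)
  have h2 := sq_mul_pow_le n k
  rw [show 2 * n + (2 * n + k) = 4 * n + k by ring] at h1
  exact (mul_le_mul_of_nonneg_left h1 (by positivity)).trans h2

/-- The test for equivalence of the projections with codes `X` and `Y`: the certificate is an
approximate partial isometry `v`, with a bound `K + 1` for its entries, and a number of iterations
that makes the codes precise enough. The tolerances absorb the factors `(m + n) ^ 4` and
`(m + n) ^ 6 * (K + 1) ^ 2` by which products of matrices and the passage from entries to norms
increase the errors. -/
def EquivTest (T : StarPoly → ℕ → Prop) (m n : ℕ) (X Y : MCode) : Prop :=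
  ∃ (v : MCode) (K M : ℕ), 6 * (m + n) + 2 * K + 3 ≤ M ∧
    MatTest T m n (msmul ((1, 0), K) v) 0 ∧
    MatTest T m m (mmul n (mmul n v (newtonIter n M Y)) (mstar v) ++
      msmul (gint (-1)) (newtonIter m M X)) (4 * (m + n) + 3) ∧
    MatTest T n n (mmul m (mmul m (mstar v) (newtonIter m M X)) v ++
      msmul (gint (-1)) (newtonIter n M Y)) (4 * (m + n) + 3)

end Tests

section Tests

variable {U V : Type*} [CStarAlgebra U] [CStarAlgebra V]

/-- The error that remains when an approximate partial isometry `w` between approximations `X` and `Y` of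
projections `p` and `q` is replaced by `p * w * q`. -/
theorem norm_compressed_sub_le {m n : ℕ} {p X : Matrix (Fin m) (Fin m) U}
    {q Y : Matrix (Fin n) (Fin n) U} {w : Matrix (Fin m) (Fin n) U} (hp : pᴴ = p) (hpp : p * p = p)
    (hq : qᴴ = q) (hqq : q * q = q) {κ δ τ : ℝ} (hκ : 0 ≤ κ) (hδ : 0 ≤ δ)
    (hw : ∀ i j, ‖w i j‖ ≤ κ)
    (hX : ∀ i j, ‖X i j - p i j‖ ≤ δ) (hY : ∀ i j, ‖Y i j - q i j‖ ≤ δ)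
    (h : ∀ i j, ‖(w * Y * wᴴ - X) i j‖ ≤ τ) (i j : Fin m) :
    ‖((p * w * q) * (p * w * q)ᴴ - p) i j‖ ≤ m ^ 2 * (τ + n ^ 2 * κ ^ 2 * δ + δ) := by
  have h1 : (p * w * q) * (p * w * q)ᴴ - p =
      p * ((w * Y * wᴴ - X) - w * (Y - q) * wᴴ + (X - p)) * p := by
    have e1 : (w * Y * wᴴ - X) - w * (Y - q) * wᴴ + (X - p) = w * q * wᴴ - p := by
      rw [Matrix.mul_sub, Matrix.sub_mul]
      abel
    rw [e1, Matrix.mul_sub, Matrix.sub_mul, hpp, hpp, Matrix.conjTranspose_mul,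
      Matrix.conjTranspose_mul, hp, hq]
    congr 1
    calc p * w * q * (q * (wᴴ * p)) = p * w * (q * q) * (wᴴ * p) := by
          simp only [Matrix.mul_assoc]
      _ = _ := by rw [hqq]; simp only [Matrix.mul_assoc]
  rw [h1]
  refine norm_compression_le hp hpp (fun i j => ?_) i j
  have h2 : ‖(w * (Y - q) * wᴴ) i j‖ ≤ n ^ 2 * κ ^ 2 * δ := by
    have h3 := norm_mul_entry_le hκ hw (y := Y - q) hY
    refine (norm_mul_entry_le (by positivity) h3 (y := wᴴ) (β := κ) (fun i j => ?_) i j).trans_eq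
      (by ring)
    rw [Matrix.conjTranspose_apply, norm_star]
    exact hw j i
  rw [Matrix.add_apply, Matrix.sub_apply]
  exact (norm_add_le _ _).trans (add_le_add ((norm_sub_le _ _).trans (add_le_add (h i j) h2))
    (hX i j))

theorem nat_pow_mul_pow_le (s a : ℕ) : (s : ℝ) ^ a ≤ 2 ^ (a * s) := by
  rw [mul_comm, pow_mul]
  exact pow_le_pow_left₀ (by positivity) (by exact_mod_cast Nat.lt_two_pow_self.le) a

/-- The compression `p * v * q` of the certificate is an approximate partial isometry between the
projections. -/
theorem EquivTest.sound {b : ℕ → U} {T : StarPoly → ℕ → Prop} (hT : IsNormTest b T) {m n : ℕ}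
    {X Y : MCode} {p : Matrix (Fin m) (Fin m) U} {q : Matrix (Fin n) (Fin n) U}
    (hp : Conv b m X p) (hq : Conv b n Y q) (h : EquivTest T m n X Y) : MvNRel p q := by
  obtain ⟨v, K, M, hM, h1, h2, h3⟩ := h
  set w := meval b m n v
  have hK : (0 : ℝ) < (K : ℝ) + 1 := by positivity
  have hw (i : Fin m) (j : Fin n) : ‖w i j‖ ≤ (K : ℝ) + 1 := by
    have h4 := MatTest.lt hT h1 i j
    rw [meval_msmul, Matrix.smul_apply, norm_smul, norm_val_eq, pow_zero] at h4
    simp only [Int.cast_one, Int.cast_zero, zero_mul, add_zero, norm_one] at h4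
    rw [one_div, inv_mul_lt_iff₀ hK, mul_one] at h4
    exact h4.le
  have h2' (i j : Fin m) : ‖(w * meval b n n (newtonIter n M Y) * wᴴ -
      meval b m m (newtonIter m M X)) i j‖ ≤ 2⁻¹ ^ (4 * (m + n) + 3) := by
    have h4 := (MatTest.lt hT h2 i j).le
    rwa [meval_append, meval_mmul, meval_mmul, meval_mstar, meval_msmul, val_gint, Int.cast_neg,
      Int.cast_one, neg_smul, one_smul, ← sub_eq_add_neg] at h4
  have h3' (i j : Fin n) : ‖(wᴴ * meval b m m (newtonIter m M X) * wᴴᴴ -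
      meval b n n (newtonIter n M Y)) i j‖ ≤ 2⁻¹ ^ (4 * (m + n) + 3) := by
    have h4 := (MatTest.lt hT h3 i j).le
    rw [Matrix.conjTranspose_conjTranspose]
    rwa [meval_append, meval_mmul, meval_mmul, meval_mstar, meval_msmul, val_gint, Int.cast_neg,
      Int.cast_one, neg_smul, one_smul, ← sub_eq_add_neg] at h4
  set s : ℝ := ((m + n : ℕ) : ℝ) with hs
  set δ : ℝ := 2⁻¹ ^ M with hδ
  set τ : ℝ := 2⁻¹ ^ (4 * (m + n) + 3) with hτ
  have hδ0 : 0 < δ := pow_half_pos M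
  have hτ0 : 0 < τ := pow_half_pos _
  have a1 := norm_compressed_sub_le hp.selfAdj hp.idem hq.selfAdj hq.idem hK.le hδ0.le hw
    (fun i j => (hp.lt M i j).le) (fun i j => (hq.lt M i j).le) h2'
  have a2 := norm_compressed_sub_le hq.selfAdj hq.idem hp.selfAdj hp.idem hK.le hδ0.le
    (w := wᴴ) (fun i j => by rw [Matrix.conjTranspose_apply, norm_star]; exact hw j i)
    (fun i j => (hq.lt M i j).le) (fun i j => (hp.lt M i j).le) h3'
  have hms : (m : ℝ) ≤ s := by rw [hs]; push_cast; linarith [(Nat.cast_nonneg n : (0 : ℝ) ≤ n)]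
  have hns : (n : ℝ) ≤ s := by rw [hs]; push_cast; linarith [(Nat.cast_nonneg m : (0 : ℝ) ≤ m)]
  have hm0 : (0 : ℝ) ≤ m := Nat.cast_nonneg m
  have hn0 : (0 : ℝ) ≤ n := Nat.cast_nonneg n
  have hs0 : (0 : ℝ) ≤ s := hm0.trans hms
  set ε : ℝ := s ^ 2 * (τ + s ^ 2 * ((K : ℝ) + 1) ^ 2 * δ + δ) with hε
  have hcomp (l k : ℝ) (hl0 : 0 ≤ l) (hk0 : 0 ≤ k) (hl : l ≤ s) (hk : k ≤ s) :
      l ^ 2 * (τ + k ^ 2 * ((K : ℝ) + 1) ^ 2 * δ + δ) ≤ ε := by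
    rw [hε]
    gcongr
  have hfin : s ^ 2 * ε < 1 := by
    have e1 : s ^ 4 * τ ≤ 1 / 8 := by
      have := mul_le_mul_of_nonneg_right (nat_pow_mul_pow_le (m + n) 4) hτ0.le
      refine this.trans_eq ?_
      rw [hτ, pow_add, inv_pow, ← mul_assoc, mul_inv_cancel₀ (by positivity)]
      norm_num
    have hMle : δ ≤ 2⁻¹ ^ (6 * (m + n) + 2 * K + 3) :=
      pow_le_pow_of_le_one (by norm_num) (by norm_num) hM
    have e2 : s ^ 6 * ((K : ℝ) + 1) ^ 2 * δ ≤ 1 / 8 := by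
      have hK2 : ((K : ℝ) + 1) ^ 2 ≤ 2 ^ (2 * K) := by
        have : ((K : ℝ) + 1) ≤ 2 ^ K := by exact_mod_cast Nat.lt_two_pow_self
        rw [mul_comm 2 K, pow_mul]
        exact pow_le_pow_left₀ hK.le this 2
      calc s ^ 6 * ((K : ℝ) + 1) ^ 2 * δ
          ≤ 2 ^ (6 * (m + n)) * 2 ^ (2 * K) * 2⁻¹ ^ (6 * (m + n) + 2 * K + 3) := by
            gcongr
            exact nat_pow_mul_pow_le (m + n) 6
        _ = 1 / 8 := by
            rw [pow_add, ← pow_add 2 (6 * (m + n)), inv_pow, ← mul_assoc,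
              mul_inv_cancel₀ (by positivity)]
            norm_num
    have e3 : s ^ 4 * δ ≤ 1 / 8 := by
      refine le_trans ?_ e1
      gcongr
      exact pow_le_pow_of_le_one (by norm_num) (by norm_num) (by omega)
    have : s ^ 2 * ε = s ^ 4 * τ + s ^ 6 * ((K : ℝ) + 1) ^ 2 * δ + s ^ 4 * δ := by
      rw [hε]; ring
    linarith
  have hε0 : 0 ≤ ε := by rw [hε]; positivity
  refine MvNRel.of_approx hp.selfAdj hp.idem hq.selfAdj hq.idem (v := p * w * q)
    (by rw [Matrix.mul_assoc, ← Matrix.mul_assoc, hp.idem])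
    (by rw [Matrix.mul_assoc, hq.idem]) (ε := ε)
    (fun i j => (a1 i j).trans (hcomp _ _ hm0 hn0 hms hns)) (fun i j => ?_)
    (lt_of_le_of_lt (by gcongr) hfin) (lt_of_le_of_lt (by gcongr) hfin)
  have e : (p * w * q)ᴴ * (p * w * q) = q * wᴴ * p * (q * wᴴ * p)ᴴ := by
    simp only [Matrix.conjTranspose_mul, Matrix.conjTranspose_conjTranspose, hp.selfAdj,
      hq.selfAdj, Matrix.mul_assoc]
  rw [e]
  exact (a2 i j).trans (hcomp _ _ hn0 hm0 hns hms)

theorem peval_ent_flatMap {ι : Type*} (b : ℕ → U) (l : List ι) (g : ι → MCode) (i j : ℕ) :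
    peval b (ent (l.flatMap g) i j) = (l.map fun x => peval b (ent (g x) i j)).sum := by
  induction l with
  | nil => rfl
  | cons x l ih => rw [List.flatMap_cons, peval_ent_append, ih, List.map_cons, List.sum_cons]

theorem peval_ent_single (b : ℕ → U) (i₀ j₀ : ℕ) (r : StarPoly) (i j : ℕ) :
    peval b (ent (r.map fun x => ((i₀, j₀), x)) i j) =
      if i₀ = i ∧ j₀ = j then peval b r else 0 := by
  induction r with
  | nil => simp [ent]
  | cons x r ih =>
    rw [List.map_cons, peval_ent_cons, ih]
    by_cases h : i₀ = i ∧ j₀ = j <;> simp [h, Prod.ext_iff]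

/-- Every matrix of polynomials has a code. -/
theorem exists_meval_eq (b : ℕ → U) {m n : ℕ} (r : Fin m → Fin n → StarPoly) :
    ∃ L, meval b m n L = Matrix.of fun i j => peval b (r i j) := by
  refine ⟨(List.finRange m).flatMap fun i => (List.finRange n).flatMap fun j =>
    (r i j).map fun x => (((i : ℕ), (j : ℕ)), x), ?_⟩
  ext i j
  rw [meval_apply]
  simp only [peval_ent_flatMap, peval_ent_single, ← Fin.sum_univ_def, Fin.val_inj, Matrix.of_apply]
  rw [Finset.sum_eq_single i, Finset.sum_eq_single j] <;> simp +contextual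

theorem exists_tendsto_meval {b : ℕ → U} (hb : DenseRange (peval b)) {m n : ℕ}
    (u : Matrix (Fin m) (Fin n) U) : ∃ y : ℕ → MCode,
      Filter.Tendsto (fun M => meval b m n (y M)) Filter.atTop (nhds u) := by
  have h1 (M : ℕ) : ∃ L, ∀ i j, ‖meval b m n L i j - u i j‖ < (2 : ℝ)⁻¹ ^ M := by
    have h2 (i : Fin m) (j : Fin n) : ∃ r, ‖peval b r - u i j‖ < (2 : ℝ)⁻¹ ^ M := by
      obtain ⟨r, hr⟩ := hb.exists_dist_lt (u i j) (pow_half_pos M)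
      exact ⟨r, by rwa [dist_comm, dist_eq_norm] at hr⟩
    choose r hr using h2
    obtain ⟨L, hL⟩ := exists_meval_eq b r
    exact ⟨L, fun i j => by rw [hL]; exact hr i j⟩
  choose y hy using h1
  refine ⟨y, tendsto_pi_nhds.2 fun i => tendsto_pi_nhds.2 fun j => ?_⟩
  rw [tendsto_iff_norm_sub_tendsto_zero]
  exact squeeze_zero (fun _ => norm_nonneg _) (fun M => (hy M i j).le)
    (tendsto_pow_atTop_nhds_zero_of_lt_one (by norm_num) (by norm_num))

/-- Approximations of a partial isometry between the projections are eventually certificates. -/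
theorem EquivTest.complete {b : ℕ → U} {T : StarPoly → ℕ → Prop} (hT : IsNormTest b T)
    (hb : DenseRange (peval b)) {m n : ℕ}
    {X Y : MCode} {p : Matrix (Fin m) (Fin m) U} {q : Matrix (Fin n) (Fin n) U}
    (hp : Conv b m X p) (hq : Conv b n Y q) (h : MvNRel p q) : EquivTest T m n X Y := by
  obtain ⟨v, h1, h2⟩ := h
  obtain ⟨w, hw⟩ := exists_tendsto_meval hb v
  obtain ⟨K, hK⟩ : ∃ K : ℕ, ∀ i j, 16 * (‖v i j‖ + 1) ≤ K := by
    obtain ⟨K, hK⟩ := exists_nat_ge (∑ i, ∑ j, 16 * (‖v i j‖ + 1))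
    refine ⟨K, fun i j => le_trans ?_ hK⟩
    refine (Finset.single_le_sum (f := fun j => 16 * (‖v i j‖ + 1)) (fun _ _ => by positivity)
      (Finset.mem_univ j)).trans ?_
    exact Finset.single_le_sum (f := fun i => ∑ j, 16 * (‖v i j‖ + 1))
      (fun _ _ => by positivity) (Finset.mem_univ i)
  have t1 : ∀ᶠ k in Filter.atTop, MatTest T m n (msmul ((1, 0), K) (w k)) 0 := by
    have a1 : ∀ i : Fin m, ∀ j : Fin n, ∀ᶠ k in Filter.atTop,
        ‖meval b m n (w k) i j‖ < ‖v i j‖ + 1 := fun i j =>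
      (((tendsto_pi_nhds.1 ((tendsto_pi_nhds.1 hw) i)) j).norm).eventually
        (gt_mem_nhds (lt_add_one _))
    filter_upwards [Filter.eventually_all.2 fun i => Filter.eventually_all.2 (a1 i)] with k hk
    intro i hi j hj
    have hi := List.mem_range.1 hi
    have hj := List.mem_range.1 hj
    refine hT.complete _ _ ?_
    rw [peval_ent_msmul, norm_smul, norm_val_eq]
    simp only [Int.cast_one, Int.cast_zero, zero_mul, add_zero, norm_one]
    rw [one_div, inv_mul_lt_iff₀ (by positivity)]
    have a2 := hk ⟨i, hi⟩ ⟨j, hj⟩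
    rw [meval_apply] at a2
    have a3 := hK ⟨i, hi⟩ ⟨j, hj⟩
    norm_num
    simp only at a2
    linarith
  have c1 : Continuous fun z : Matrix (Fin m) (Fin n) U × Matrix (Fin m) (Fin m) U ×
      Matrix (Fin n) (Fin n) U => z.1 * z.2.2 * z.1ᴴ - z.2.1 := by fun_prop
  have c2 : Continuous fun z : Matrix (Fin m) (Fin n) U × Matrix (Fin m) (Fin m) U ×
      Matrix (Fin n) (Fin n) U => z.1ᴴ * z.2.1 * z.1 - z.2.2 := by fun_prop
  have hz := hw.prodMk_nhds (hp.tendsto.prodMk_nhds hq.tendsto)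
  have e1 : v * q * vᴴ - p = 0 := by
    rw [sub_eq_zero, h2, ← Matrix.mul_assoc, Matrix.mul_assoc, ← h1, hp.idem]
  have e2 : vᴴ * p * v - q = 0 := by
    rw [sub_eq_zero, h1, ← Matrix.mul_assoc, Matrix.mul_assoc, ← h2, hq.idem]
  have t2 : ∀ᶠ k in Filter.atTop, MatTest T m m (mmul n (mmul n (w k) (newtonIter n k Y))
      (mstar (w k)) ++ msmul (gint (-1)) (newtonIter m k X)) (4 * (m + n) + 3) := by
    refine eventually_matTest hT (L := fun k => _) ?_ _
    have h3 := (c1.tendsto _).comp hz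
    simp only at h3
    rw [e1] at h3
    refine h3.congr fun k => ?_
    rw [meval_append, meval_mmul, meval_mmul, meval_mstar, meval_msmul, val_gint, Int.cast_neg,
      Int.cast_one, neg_smul, one_smul, ← sub_eq_add_neg]
    rfl
  have t3 : ∀ᶠ k in Filter.atTop, MatTest T n n (mmul m (mmul m (mstar (w k)) (newtonIter m k X))
      (w k) ++ msmul (gint (-1)) (newtonIter n k Y)) (4 * (m + n) + 3) := by
    refine eventually_matTest hT (L := fun k => _) ?_ _
    have h3 := (c2.tendsto _).comp hz
    simp only at h3
    rw [e2] at h3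
    refine h3.congr fun k => ?_
    rw [meval_append, meval_mmul, meval_mmul, meval_mstar, meval_msmul, val_gint, Int.cast_neg,
      Int.cast_one, neg_smul, one_smul, ← sub_eq_add_neg]
    rfl
  obtain ⟨k, k1, k2, k3, k4⟩ := (t1.and (t2.and (t3.and (Filter.eventually_ge_atTop
    (6 * (m + n) + 2 * K + 3))))).exists
  exact ⟨w k, K, k, k4, k1, k2, k3⟩

end Tests

/-! ### Codes of elements of `K₀` -/

section Rep

variable {U V : Type*} [CStarAlgebra U] [CStarAlgebra V]

/-- A code of a square matrix of polynomials: its size and its entries. -/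
abbrev SCode : Type := ℕ × MCode

/-- The block-diagonal sum on codes. -/
def ssum (X Y : SCode) : SCode := (X.1 + Y.1, msum X.1 X.2 Y.2)

/-- The self-adjoint matrix `X + X*`, on codes. -/
def ssymm (X : SCode) : SCode := (X.1, msymm X.2)

/-- The result of renaming the variables of a matrix. -/
def sren (f : ℕ → ℕ) (X : SCode) : SCode := (X.1, mren f X.2)

/-- The test whether `X + X*` is an approximate projection. -/
def SValid (T : StarPoly → ℕ → Prop) (X : SCode) : Prop := ValidTest T X.1 (msymm X.2)

/-- The test for equivalence of projections, on codes. -/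
def SEquiv (T : StarPoly → ℕ → Prop) (X Y : SCode) : Prop := EquivTest T X.1 Y.1 X.2 Y.2

/-- The code `X` converges to a projection of class `x`. -/
def Rep (b : ℕ → U) (X : SCode) (x : MvNSemigroup U) : Prop :=
  ∃ p, ∃ h : Conv b X.1 X.2 p, MvNSemigroup.mk h.proj = x

theorem mk_eq_mk_iff {p q : Proj U} : MvNSemigroup.mk p = MvNSemigroup.mk q ↔ MvN p q :=
  Quotient.eq (r := mvnSetoid U)

theorem Rep.unique {b : ℕ → U} {X : SCode} {x y : MvNSemigroup U} (hx : Rep b X x)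
    (hy : Rep b X y) : x = y := by
  obtain ⟨p, hp, rfl⟩ := hx
  obtain ⟨q, hq, rfl⟩ := hy
  obtain rfl := hp.unique hq
  rfl

theorem Rep.ssum {b : ℕ → U} {X Y : SCode} {x y : MvNSemigroup U} (hx : Rep b X x)
    (hy : Rep b Y y) : Rep b (ssum X Y) (x + y) := by
  obtain ⟨p, hp, rfl⟩ := hx
  obtain ⟨q, hq, rfl⟩ := hy
  exact ⟨_, hp.msum hq, rfl⟩

theorem Rep.zero (b : ℕ → U) : Rep b (0, []) 0 := ⟨_, Conv.nil b, rfl⟩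

theorem Rep.map (φ : U →⋆ₐ[ℂ] V) {b : ℕ → U} {X : SCode} {x : MvNSemigroup U} (hx : Rep b X x) :
    Rep (fun k => φ (b k)) X (MvNSemigroup.map φ x) := by
  obtain ⟨p, hp, rfl⟩ := hx
  exact ⟨_, hp.map φ, rfl⟩

theorem Rep.sren {b : ℕ → U} {f : ℕ → ℕ} {X : SCode} {x : MvNSemigroup U}
    (hx : Rep (fun k => b (f k)) X x) : Rep b (sren f X) x := by
  obtain ⟨p, hp, rfl⟩ := hx
  exact ⟨_, hp.mren, rfl⟩

theorem SValid.exists_rep {b : ℕ → U} {T : StarPoly → ℕ → Prop} (hT : IsNormTest b T) {X : SCode}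
    (h : SValid T X) : ∃ x, Rep b (ssymm X) x := by
  obtain ⟨p, hp, -⟩ := ValidTest.exists_conv hT h
  exact ⟨_, p, hp, rfl⟩

/-- Valid codes that are close to each other represent the same class. -/
theorem SValid.eq_of_close {b : ℕ → U} {T : StarPoly → ℕ → Prop} (hT : IsNormTest b T) {n : ℕ}
    {L : MCode} {x : MvNSemigroup U} (hL : SValid T (n, L)) (hx : Rep b (n, msymm L) x)
    {q : Matrix (Fin n) (Fin n) U} (hq : qᴴ = q) (hqq : q * q = q)
    (h : ∀ i j, ‖meval b n n (msymm L) i j - q i j‖ ≤ 2⁻¹ ^ (4 * n + 1)) :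
    MvNSemigroup.mk ⟨n, q, hq, hqq⟩ = x := by
  obtain ⟨p, hp, hp'⟩ := ValidTest.exists_conv hT hL
  obtain ⟨p', hp'', rfl⟩ := hx
  obtain rfl := hp.unique hp''
  refine mk_eq_mk_iff.2 ?_
  change MvNRel q p
  have h1 := quartic_mul_pow_le n 0
  simp only [add_zero, pow_zero] at h1
  refine MvNRel.of_close hq hqq hp.selfAdj hp.idem (ε := 2⁻¹ ^ (4 * n) * (3 / 4))
    (fun i j => ?_) ?_
  · have h2 := norm_sub_le_norm_sub_add_norm_sub (q i j) (meval b n n (msymm L) i j) (p i j)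
    have h3 := hp' i j
    have h4 := h i j
    rw [norm_sub_rev] at h4
    rw [pow_add] at h3 h4
    have := pow_half_pos (4 * n)
    norm_num at h3 h4
    linarith
  · nlinarith

/-- Every Murray-von Neumann class is represented by a valid code. -/
theorem exists_valid_rep {b : ℕ → U} {T : StarPoly → ℕ → Prop} (hT : IsNormTest b T)
    (hb : DenseRange (peval b)) (x : MvNSemigroup U) : ∃ X, SValid T X ∧ Rep b (ssymm X) x := by
  obtain ⟨p⟩ := x
  obtain ⟨y, hy⟩ := exists_tendsto_meval hb ((2⁻¹ : ℂ) • p.mat)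
  have h1 := tendsto_msymm p.selfAdj hy
  have h2 : ∀ i j : Fin p.n, ∀ᶠ k in Filter.atTop,
      ‖meval b p.n p.n (msymm (y k)) i j - p.mat i j‖ < 2⁻¹ ^ (4 * p.n + 1) := fun i j =>
    (tendsto_iff_norm_sub_tendsto_zero.1 ((tendsto_pi_nhds.1 ((tendsto_pi_nhds.1 h1) i)) j)).eventually
      (gt_mem_nhds (pow_half_pos _))
  obtain ⟨k, k1, k2⟩ := ((eventually_validTest hT p.selfAdj p.idem hy).and
    (Filter.eventually_all.2 fun i => Filter.eventually_all.2 (h2 i))).exists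
  refine ⟨(p.n, y k), k1, ?_⟩
  obtain ⟨x, hx⟩ := SValid.exists_rep hT (X := (p.n, y k)) k1
  obtain rfl := SValid.eq_of_close hT (L := y k) k1 hx p.selfAdj p.idem fun i j => (k2 i j).le
  exact hx

theorem sEquiv_iff {b : ℕ → U} {T : StarPoly → ℕ → Prop} (hT : IsNormTest b T)
    (hb : DenseRange (peval b)) {X Y : SCode} {x y : MvNSemigroup U} (hx : Rep b X x)
    (hy : Rep b Y y) : SEquiv T X Y ↔ x = y := by
  obtain ⟨p, hp, rfl⟩ := hx
  obtain ⟨q, hq, rfl⟩ := hy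
  rw [mk_eq_mk_iff]
  exact ⟨fun h => EquivTest.sound hT hp hq h, fun h => EquivTest.complete hT hb hp hq h⟩

/-- The class in `K₀` of a formal difference. -/
def diff (x y : MvNSemigroup U) : UnitalK0 U :=
  Algebra.GrothendieckAddGroup.of x - Algebra.GrothendieckAddGroup.of y

/-- Equality in a Grothendieck group is stable equality, even for a monoid without cancellation. -/
theorem of_eq_of_iff {M : Type*} [AddCommMonoid M] {x y : M} :
    Algebra.GrothendieckAddGroup.of x = Algebra.GrothendieckAddGroup.of y ↔
      ∃ c, x + c = y + c := by
  refine ((AddLocalization.addMonoidOf (⊤ : AddSubmonoid M)).eq_iff_exists).trans ?_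
  simp [add_comm]

theorem diff_eq_diff_iff {x y x' y' : MvNSemigroup U} :
    diff x y = diff x' y' ↔ ∃ c, x + y' + c = x' + y + c := by
  rw [diff, diff, sub_eq_sub_iff_add_eq_add, ← map_add, ← map_add, of_eq_of_iff]

theorem exists_eq_diff (z : UnitalK0 U) : ∃ x y, z = diff x y := by
  obtain ⟨x, y, h⟩ : ∃ x y : MvNSemigroup U, z + Algebra.GrothendieckAddGroup.of y =
      Algebra.GrothendieckAddGroup.of x := by
    obtain ⟨⟨x, y⟩, h⟩ := (AddLocalization.addMonoidOf (⊤ : AddSubmonoid (MvNSemigroup U))).surj z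
    exact ⟨x, y, h⟩
  exact ⟨x, y, eq_sub_of_add_eq h⟩

theorem map_diff (φ : U →⋆ₐ[ℂ] V) (x y : MvNSemigroup U) :
    UnitalK0.map φ (diff x y) = diff (MvNSemigroup.map φ x) (MvNSemigroup.map φ y) := by
  rw [diff, map_sub, UnitalK0.map_of, UnitalK0.map_of, diff]

/-- The test for equality in `K₀` of two formal differences: the certificate is a projection that
makes them stably equivalent. -/
def DiffTest (T : StarPoly → ℕ → Prop) (X Y : SCode × SCode) : Prop :=
  ∃ c : SCode, SValid T c ∧
    SEquiv T (ssum (ssum X.1 Y.2) (ssymm c)) (ssum (ssum Y.1 X.2) (ssymm c))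

theorem diffTest_iff {b : ℕ → U} {T : StarPoly → ℕ → Prop} (hT : IsNormTest b T)
    (hb : DenseRange (peval b)) {X Y : SCode × SCode} {x y x' y' : MvNSemigroup U}
    (hx : Rep b X.1 x) (hy : Rep b X.2 y) (hx' : Rep b Y.1 x') (hy' : Rep b Y.2 y') :
    DiffTest T X Y ↔ diff x y = diff x' y' := by
  rw [diff_eq_diff_iff]
  constructor
  · rintro ⟨C, hC, h⟩
    obtain ⟨c, hc⟩ := hC.exists_rep hT
    exact ⟨c, (sEquiv_iff hT hb ((hx.ssum hy').ssum hc) ((hx'.ssum hy).ssum hc)).1 h⟩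
  · rintro ⟨c, h⟩
    obtain ⟨C, hC, hc⟩ := exists_valid_rep hT hb c
    exact ⟨C, hC, (sEquiv_iff hT hb ((hx.ssum hy').ssum hc) ((hx'.ssum hy).ssum hc)).2 h⟩

end Rep

/-! ### Semidecidability of the tests -/

section Computability

variable {α γ : Type*} [Primcodable α] [Primcodable γ] {T : γ → StarPoly → ℕ → Prop}

theorem sigmaOne_matTest (hT : SigmaOne fun x : γ × StarPoly × ℕ => T x.1 x.2.1 x.2.2)
    {c : α → γ} {m n k : α → ℕ} {L : α → MCode} (hc : Primrec c)
    (hm : Primrec m) (hn : Primrec n) (hL : Primrec L) (hk : Primrec k) :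
    SigmaOne fun a => MatTest (T (c a)) (m a) (n a) (L a) (k a) := by
  have h1 : Primrec fun x : (α × ℕ) × ℕ => (c x.1.1, ent (L x.1.1) x.1.2 x.2, k x.1.1) :=
    have f := Primrec.fst.comp (Primrec.fst (α := α × ℕ) (β := ℕ))
    Primrec.pair (hc.comp f) (Primrec.pair (primrec_ent (hL.comp f)
      (Primrec.snd.comp Primrec.fst) Primrec.snd) (hk.comp f))
  exact SigmaOne.forall_mem (R := fun a i => ∀ j ∈ List.range (n a), T (c a) (ent (L a) i j) (k a))
    (SigmaOne.forall_mem (R := fun (x : α × ℕ) j => T (c x.1) (ent (L x.1) x.2 j) (k x.1))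
      (hT.comp h1) (Primrec.list_range.comp (hn.comp Primrec.fst)))
    (Primrec.list_range.comp hm)

theorem primrec_linear (k l : ℕ) {f : α → ℕ} (hf : Primrec f) : Primrec fun a => k * f a + l :=
  Primrec.nat_add.comp (Primrec.nat_mul.comp (Primrec.const k) hf) (Primrec.const l)

theorem sigmaOne_sValid (hT : SigmaOne fun x : γ × StarPoly × ℕ => T x.1 x.2.1 x.2.2)
    {c : α → γ} {X : α → SCode} (hc : Primrec c) (hX : Primrec X) :
    SigmaOne fun a => SValid (T (c a)) (X a) := by
  have h1 := Primrec.fst.comp hX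
  have h2 := primrec_msymm (Primrec.snd.comp hX)
  exact sigmaOne_matTest hT hc h1 h1 (Primrec.list_append.comp (primrec_mmul h1 h2 h2)
    (primrec_msmul (Primrec.const _) h2)) (primrec_linear 6 5 h1)

theorem sigmaOne_sEquiv (hT : SigmaOne fun x : γ × StarPoly × ℕ => T x.1 x.2.1 x.2.2)
    {c : α → γ} {X Y : α → SCode} (hc : Primrec c) (hX : Primrec X) (hY : Primrec Y) :
    SigmaOne fun a => SEquiv (T (c a)) (X a) (Y a) := by
  refine SigmaOne.exists (SigmaOne.exists (SigmaOne.exists ?_))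
  let δ := ((α × MCode) × ℕ) × ℕ
  have fa : Primrec fun x : δ => x.1.1.1 := Primrec.fst.comp (Primrec.fst.comp Primrec.fst)
  have fv : Primrec fun x : δ => x.1.1.2 := Primrec.snd.comp (Primrec.fst.comp Primrec.fst)
  have fK : Primrec fun x : δ => x.1.2 := Primrec.snd.comp Primrec.fst
  have fM : Primrec fun x : δ => x.2 := Primrec.snd
  have fm := Primrec.fst.comp (hX.comp fa)
  have fn := Primrec.fst.comp (hY.comp fa)
  have fX := primrec_newtonIter fm fM (Primrec.snd.comp (hX.comp fa))
  have fY := primrec_newtonIter fn fM (Primrec.snd.comp (hY.comp fa))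
  have fv' := primrec_mstar.comp fv
  have fs := Primrec.nat_add.comp fm fn
  have ft := primrec_linear 4 3 fs
  refine SigmaOne.and (PrimrecPred.sigmaOne (Primrec.nat_le.comp (Primrec.nat_add.comp
    (Primrec.nat_add.comp (Primrec.nat_mul.comp (Primrec.const 6) fs)
      (Primrec.nat_mul.comp (Primrec.const 2) fK)) (Primrec.const 3)) fM)) ?_
  refine SigmaOne.and (sigmaOne_matTest hT (hc.comp fa) fm fn (primrec_msmul
    (Primrec.pair (Primrec.const _) fK) fv) (Primrec.const 0)) ?_
  exact SigmaOne.and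
    (sigmaOne_matTest hT (hc.comp fa) fm fm (Primrec.list_append.comp
      (primrec_mmul fn (primrec_mmul fn fv fY) fv') (primrec_msmul (Primrec.const _) fX)) ft)
    (sigmaOne_matTest hT (hc.comp fa) fn fn (Primrec.list_append.comp
      (primrec_mmul fm (primrec_mmul fm fv' fX) fv) (primrec_msmul (Primrec.const _) fY)) ft)

theorem primrec_ssum {X Y : α → SCode} (hX : Primrec X) (hY : Primrec Y) :
    Primrec fun a => ssum (X a) (Y a) :=
  Primrec.pair (Primrec.nat_add.comp (Primrec.fst.comp hX) (Primrec.fst.comp hY))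
    (primrec_msum (Primrec.fst.comp hX) (Primrec.snd.comp hX) (Primrec.snd.comp hY))

theorem primrec_ssymm {X : α → SCode} (hX : Primrec X) : Primrec fun a => ssymm (X a) :=
  Primrec.pair (Primrec.fst.comp hX) (primrec_msymm (Primrec.snd.comp hX))

theorem sigmaOne_diffTest (hT : SigmaOne fun x : γ × StarPoly × ℕ => T x.1 x.2.1 x.2.2)
    {c : α → γ} {X Y : α → SCode × SCode} (hc : Primrec c) (hX : Primrec X) (hY : Primrec Y) :
    SigmaOne fun a => DiffTest (T (c a)) (X a) (Y a) := by
  refine SigmaOne.exists (R := fun a C => _) ?_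
  have fa : Primrec fun x : α × SCode => x.1 := Primrec.fst
  have fC : Primrec fun x : α × SCode => x.2 := Primrec.snd
  exact SigmaOne.and (sigmaOne_sValid hT (hc.comp fa) fC) (sigmaOne_sEquiv hT (hc.comp fa)
    (primrec_ssum (primrec_ssum (Primrec.fst.comp (hX.comp fa)) (Primrec.snd.comp (hY.comp fa)))
      (primrec_ssymm fC))
    (primrec_ssum (primrec_ssum (Primrec.fst.comp (hY.comp fa)) (Primrec.snd.comp (hX.comp fa)))
      (primrec_ssymm fC)))

end Computability

/-! ### The special points of the unitization of the suspension -/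

section Letters

variable {A : Type*} [NonUnitalCStarAlgebra A]

/-- Evaluation at a point of the space, as a `*`-homomorphism. -/
def evalAt {X : Type*} [TopologicalSpace X] (t : X) : C₀(X, A) →⋆ₙₐ[ℂ] A where
  toFun f := f t
  map_smul' _ _ := rfl
  map_zero' := rfl
  map_add' _ _ := rfl
  map_mul' _ _ := rfl
  map_star' _ := rfl

theorem norm_zeroAtInfty_apply_le {X : Type*} [TopologicalSpace X] (f : C₀(X, A)) (t : X) :
    ‖f t‖ ≤ ‖f‖ := NonUnitalStarAlgHom.norm_apply_le (evalAt t) f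

theorem norm_zeroAtInfty_le {X : Type*} [TopologicalSpace X] {f : C₀(X, A)} {C : ℝ} (hC : 0 ≤ C)
    (h : ∀ t, ‖f t‖ ≤ C) : ‖f‖ ≤ C := by
  rw [← ZeroAtInftyContinuousMap.norm_toBCF_eq_norm]
  exact (BoundedContinuousFunction.norm_le hC).2 h

theorem norm_inl_le (z : ℂ) : ‖(Unitization.inl z : Unitization ℂ A)‖ ≤ ‖z‖ := by
  rw [← Unitization.algebraMap_eq_inl]
  exact NonUnitalStarAlgHom.norm_apply_le (StarAlgHom.ofId ℂ (Unitization ℂ A)) z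

theorem norm_fst_le (x : Unitization ℂ A) : ‖x.fst‖ ≤ ‖x‖ :=
  NonUnitalStarAlgHom.norm_apply_le (unitizationProj A) x

theorem norm_unitization_le (x : Unitization ℂ A) : ‖x‖ ≤ ‖x.fst‖ + ‖x.snd‖ := by
  conv_lhs => rw [← Unitization.inl_fst_add_inr_snd_eq x]
  refine (norm_add_le _ _).trans (add_le_add (norm_inl_le _) ?_)
  rw [Unitization.norm_inr]

/-- The factor `2` reflects that `x.snd` is the difference of `x` and a scalar of norm at most `‖x‖`. -/
theorem norm_snd_le (x : Unitization ℂ A) : ‖x.snd‖ ≤ 2 * ‖x‖ := by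
  have h : (Unitization.inr x.snd : Unitization ℂ A) = x - Unitization.inl x.fst := by
    rw [eq_sub_iff_add_eq', Unitization.inl_fst_add_inr_snd_eq]
  have h1 := norm_sub_le x (Unitization.inl x.fst)
  rw [← h, Unitization.norm_inr] at h1
  linarith [norm_inl_le (A := A) x.fst, norm_fst_le x]

/-- The data of the special point with number `n` of the unitization of the suspension: the scalar,
and the two factors of the elementary tensor. They are `0` where `n` codes nothing. -/
def letterData (n : ℕ) : GaussCode × RatPoly × RatPoly :=
  ((Encodable.decode n : Option (ℕ × GaussCode)).map fun x =>
    (x.2, (Encodable.decode x.1 : Option (RatPoly × RatPoly)).getD ([], []))).getD (gint 0, [], [])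

theorem suspensionPt_eq (P : CStarPresentation A) (m : ℕ) : suspensionPt P m =
    tensor (RatPoly.eval curvePt ((Encodable.decode m : Option (RatPoly × RatPoly)).getD ([], [])).1)
      (P.ratPt ((Encodable.decode m : Option (RatPoly × RatPoly)).getD ([], [])).2) := by
  unfold suspensionPt
  cases (Encodable.decode m : Option (RatPoly × RatPoly)) with
  | none => ext t; simp [tensor, RatPoly.eval]
  | some x => rfl

theorem letterPt_eq (P : CStarPresentation A) (n : ℕ) :
    unitizationPt (suspensionPt P) n = Unitization.inl (letterData n).1.val + Unitization.inr
      (tensor (RatPoly.eval curvePt (letterData n).2.1) (P.ratPt (letterData n).2.2)) := by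
  unfold unitizationPt letterData
  cases (Encodable.decode n : Option (ℕ × GaussCode)) with
  | none =>
    have : tensor (RatPoly.eval curvePt []) (P.ratPt []) = 0 := by
      ext t; simp [tensor, RatPoly.eval]
    simp [this, val_gint]
  | some x => simp [suspensionPt_eq]

/-- Evaluation at `t`, as a homomorphism between the unitizations. -/
def evalUnit (A : Type*) [NonUnitalCStarAlgebra A] (t : Set.Ioo (0 : ℝ) 1) :
    Unitization ℂ (Suspension A) →⋆ₐ[ℂ] Unitization ℂ A :=
  Unitization.starMap (evalAt t)

theorem evalUnit_fst (t : Set.Ioo (0 : ℝ) 1) (x : Unitization ℂ (Suspension A)) :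
    (evalUnit A t x).fst = x.fst := by
  conv_lhs => rw [← Unitization.inl_fst_add_inr_snd_eq x]
  simp [evalUnit, Unitization.algebraMap_eq_inl]

theorem evalUnit_snd (t : Set.Ioo (0 : ℝ) 1) (x : Unitization ℂ (Suspension A)) :
    (evalUnit A t x).snd = x.snd t := by
  conv_lhs => rw [← Unitization.inl_fst_add_inr_snd_eq x]
  simp [evalUnit, Unitization.algebraMap_eq_inl]
  rfl

/-- The value of the curve with code `p` at time `t`. -/
def curveVal (p : RatPoly) (t : Set.Ioo (0 : ℝ) 1) : ℂ := RatPoly.eval curvePt p t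

theorem curveVal_eq (p : RatPoly) (t : Set.Ioo (0 : ℝ) 1) :
    curveVal p t = peval (fun n => curvePt n t) (ofRat p) := by
  rw [peval_ofRat]
  exact ratEval_map (evalAt t) curvePt p

theorem evalUnit_letterPt (P : CStarPresentation A) (t : Set.Ioo (0 : ℝ) 1) (n : ℕ) :
    evalUnit A t (unitizationPt (suspensionPt P) n) = Unitization.inl (letterData n).1.val +
      Unitization.inr (curveVal (letterData n).2.1 t • P.ratPt (letterData n).2.2) := by
  rw [letterPt_eq, map_add, evalUnit, Unitization.starMap_inl, Unitization.starMap_inr,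
    Unitization.algebraMap_eq_inl]
  rfl

/-! ### Bounds for the special points -/

/-- A bound for the polygonal curve with number `n` and for its Lipschitz constant. -/
def curveLetterBound (n : ℕ) : ℕ :=
  ((Encodable.decode n : Option (List GaussCode)).map fun z =>
    (z.length + 1) * (z.map gbound).sum).getD 0

/-- A bound for the curve with code `p` and for its Lipschitz constant. -/
def curveBound (p : RatPoly) : ℕ :=
  polyBound (1 + ((ofRat p).flatMap fun x => x.2.map fun l => curveLetterBound l.1).sum) (ofRat p) *
    (1 + ((ofRat p).flatMap fun x => x.2.map fun l => curveLetterBound l.1).sum)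

theorem sum_gbound (z : List GaussCode) :
    (((z.map gbound).sum : ℕ) : ℝ) = ∑ i : Fin z.length, (gbound z[i] : ℝ) := by
  have : (z.map gbound).sum = ∑ i : Fin z.length, gbound z[i] :=
    (Fin.sum_univ_fun_getElem z gbound).symm
  rw [this, Nat.cast_sum]

theorem tent_le_one (n i : ℕ) (t : ℝ) : tent n i t ≤ 1 := by
  refine max_le zero_le_one ?_
  have := abs_nonneg (((n : ℝ) + 1) * t - ((i : ℝ) + 1))
  linarith

theorem tent_nonneg (n i : ℕ) (t : ℝ) : 0 ≤ tent n i t := le_max_left _ _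

theorem abs_tent_sub_le (n i : ℕ) (t s : ℝ) : |tent n i t - tent n i s| ≤ (n + 1) * |t - s| := by
  have h1 : |tent n i t - tent n i s| ≤ |(1 - |((n : ℝ) + 1) * t - ((i : ℝ) + 1)|) -
      (1 - |((n : ℝ) + 1) * s - ((i : ℝ) + 1)|)| := by
    unfold tent
    rw [max_comm 0, max_comm 0]
    exact abs_max_sub_max_le_abs _ _ _
  refine h1.trans ?_
  rw [sub_sub_sub_cancel_left, abs_sub_comm]
  refine (abs_abs_sub_abs_le _ _).trans_eq ?_
  rw [sub_sub_sub_cancel_right, ← mul_sub, abs_mul, abs_of_pos (by positivity : (0 : ℝ) < n + 1)]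

theorem norm_curvePt_le (n : ℕ) (t : Set.Ioo (0 : ℝ) 1) : ‖curvePt n t‖ ≤ curveLetterBound n := by
  unfold curvePt curveLetterBound
  cases (Encodable.decode n : Option (List GaussCode)) with
  | none => simp
  | some z =>
    simp only [Option.map_some, Option.getD_some]
    change ‖polygon z t‖ ≤ _
    have h1 : ‖polygon z t‖ ≤ ((z.map gbound).sum : ℕ) := by
      rw [sum_gbound]
      refine norm_sum_le_of_le _ fun i _ => ?_
      rw [norm_mul, Complex.norm_real, Real.norm_of_nonneg (tent_nonneg _ _ _)]
      calc _ ≤ 1 * (gbound z[i] : ℝ) := mul_le_mul (tent_le_one _ _ _) (norm_val_le _)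
            (norm_nonneg _) zero_le_one
        _ = _ := one_mul _
    refine h1.trans ?_
    exact_mod_cast Nat.le_mul_of_pos_left _ (Nat.succ_pos _)

theorem norm_curvePt_sub_le (n : ℕ) (t s : Set.Ioo (0 : ℝ) 1) :
    ‖curvePt n t - curvePt n s‖ ≤ curveLetterBound n * |(t : ℝ) - s| := by
  unfold curvePt curveLetterBound
  cases (Encodable.decode n : Option (List GaussCode)) with
  | none => simp
  | some z =>
    simp only [Option.map_some, Option.getD_some]
    change ‖polygon z t - polygon z s‖ ≤ _
    rw [polygon, polygon, ← Finset.sum_sub_distrib]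
    rw [Nat.cast_mul, sum_gbound, Finset.mul_sum, Finset.sum_mul, Nat.cast_succ]
    refine norm_sum_le_of_le _ fun i _ => ?_
    rw [← sub_mul, norm_mul, ← Complex.ofReal_sub, Complex.norm_real, Real.norm_eq_abs]
    calc _ ≤ (z.length + 1) * |(t : ℝ) - s| * (gbound z[i] : ℝ) :=
          mul_le_mul (abs_tent_sub_le _ _ _ _) (norm_val_le _) (norm_nonneg _) (by positivity)
      _ = _ := by ring

theorem curveLetterBound_le {p : RatPoly} {x : Mono} (hx : x ∈ ofRat p) {l : Letter}
    (hl : l ∈ x.2) : curveLetterBound l.1 ≤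
      1 + ((ofRat p).flatMap fun x => x.2.map fun l => curveLetterBound l.1).sum := by
  refine le_add_left (List.le_sum_of_mem ?_)
  exact List.mem_flatMap.2 ⟨x, hx, List.mem_map.2 ⟨l, hl, rfl⟩⟩

theorem norm_curveVal_le (p : RatPoly) (t : Set.Ioo (0 : ℝ) 1) : ‖curveVal p t‖ ≤ curveBound p := by
  rw [curveVal_eq]
  refine (norm_peval_le fun x hx l hl => (norm_curvePt_le _ _).trans
    (Nat.cast_le.2 (curveLetterBound_le hx hl))).trans ?_
  exact Nat.cast_le.2 (Nat.le_mul_of_pos_right _ (by omega))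

theorem norm_curveVal_sub_le (p : RatPoly) (t s : Set.Ioo (0 : ℝ) 1) :
    ‖curveVal p t - curveVal p s‖ ≤ curveBound p * |(t : ℝ) - s| := by
  rw [curveVal_eq, curveVal_eq, curveBound]
  push_cast [mul_assoc]
  refine (norm_peval_sub_le (b := fun n => curvePt n t) (c := fun n => curvePt n s)
    (Nat.le_add_right 1 _) (by positivity)
    (fun x hx l hl => (norm_curvePt_le _ _).trans (Nat.cast_le.2 (curveLetterBound_le hx hl)))
    (fun x hx l hl => (norm_curvePt_le _ _).trans (Nat.cast_le.2 (curveLetterBound_le hx hl)))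
    (fun x hx l hl => (norm_curvePt_sub_le _ _ _).trans
      (mul_le_mul_of_nonneg_right (Nat.cast_le.2 (curveLetterBound_le hx hl))
        (abs_nonneg _)))).trans_eq ?_
  push_cast
  ring

/-- A bound for the special point with number `n` and for its Lipschitz constant, if `N` bounds the
norm of the second factor of the elementary tensor. -/
def letterBound (n N : ℕ) : ℕ := gbound (letterData n).1 + curveBound (letterData n).2.1 * N

theorem norm_smul_curveVal_le {a : A} {N : ℕ} (ha : ‖a‖ ≤ N) (p : RatPoly)
    (t : Set.Ioo (0 : ℝ) 1) : ‖curveVal p t • a‖ ≤ curveBound p * N := by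
  rw [norm_smul]
  exact mul_le_mul (norm_curveVal_le p t) ha (norm_nonneg _) (by positivity)

theorem norm_evalUnit_letterPt_sub_le (P : CStarPresentation A) {n N : ℕ}
    (h : ‖P.ratPt (letterData n).2.2‖ ≤ N) (t s : Set.Ioo (0 : ℝ) 1) :
    ‖evalUnit A t (unitizationPt (suspensionPt P) n) -
      evalUnit A s (unitizationPt (suspensionPt P) n)‖ ≤ letterBound n N * |(t : ℝ) - s| := by
  rw [evalUnit_letterPt, evalUnit_letterPt, add_sub_add_left_eq_sub, ← Unitization.inr_sub,
    Unitization.norm_inr, ← sub_smul, norm_smul]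
  refine (mul_le_mul (norm_curveVal_sub_le _ t s) h (norm_nonneg _) (by positivity)).trans ?_
  have h1 : (0 : ℝ) ≤ gbound (letterData n).1 * |(t : ℝ) - s| := by positivity
  rw [letterBound]
  push_cast
  linarith

theorem norm_letterPt_le (P : CStarPresentation A) {n N : ℕ}
    (h : ‖P.ratPt (letterData n).2.2‖ ≤ N) :
    ‖unitizationPt (suspensionPt P) n‖ ≤ letterBound n N := by
  rw [letterPt_eq, letterBound]
  push_cast
  refine (norm_add_le _ _).trans (add_le_add ((norm_inl_le _).trans (norm_val_le _)) ?_)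
  rw [Unitization.norm_inr]
  exact norm_zeroAtInfty_le (by positivity) fun t => norm_smul_curveVal_le h _ t

/-! ### Evaluation on codes -/

/-- The value of the tent function `tent n i` at `(j + 1) / (N + 2)`, on codes. The truncated
subtraction of natural numbers is the maximum with `0`. -/
def tentCode (N j n i : ℕ) : GaussCode :=
  ((((N + 2 - (((n + 1) * (j + 1) - (i + 1) * (N + 2)) +
    ((i + 1) * (N + 2) - (n + 1) * (j + 1))) : ℕ) : ℤ), 0), N + 1)

/-- The value of the polygonal curve with number `n` at `(j + 1) / (N + 2)`, on codes. -/
def curveLetterCode (N j n : ℕ) : StarPoly :=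
  ((Encodable.decode n : Option (List GaussCode)).map fun z =>
    (List.range z.length).map fun i =>
      ((gmul (tentCode N j z.length i) (z.getD i (gint 0)), []) : Mono)).getD []

/-- The value of the special point with number `n` at `(j + 1) / (N + 2)`, on codes. -/
def letterCode (N j n : ℕ) : StarPoly :=
  ((letterData n).1, []) :: mulP (substP (curveLetterCode N j) (ofRat (letterData n).2.1))
    (ofRat (letterData n).2.2)

theorem val_tentCode {N j n i : ℕ} {t : ℝ} (ht : t = (j + 1) / (N + 2)) :
    (tentCode N j n i).val = (tent n i t : ℂ) := by
  have hN : (0 : ℝ) < (N : ℝ) + 2 := by positivity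
  have h1 (a b : ℕ) : (((a - b) + (b - a) : ℕ) : ℝ) = |(a : ℝ) - b| := by
    rcases le_total a b with h | h
    · rw [Nat.sub_eq_zero_of_le h, zero_add, Nat.cast_sub h, abs_sub_comm, abs_of_nonneg]
      exact sub_nonneg.2 (Nat.cast_le.2 h)
    · rw [Nat.sub_eq_zero_of_le h, add_zero, Nat.cast_sub h, abs_of_nonneg]
      exact sub_nonneg.2 (Nat.cast_le.2 h)
  have h2 (a b : ℕ) : ((a - b : ℕ) : ℝ) = max 0 ((a : ℝ) - b) := by
    rcases le_total a b with h | h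
    · rw [Nat.sub_eq_zero_of_le h, Nat.cast_zero, max_eq_left]
      exact sub_nonpos.2 (Nat.cast_le.2 h)
    · rw [Nat.cast_sub h, max_eq_right]
      exact sub_nonneg.2 (Nat.cast_le.2 h)
  have h3 : tent n i t * (N + 2) = ((N + 2 - (((n + 1) * (j + 1) - (i + 1) * (N + 2)) +
      ((i + 1) * (N + 2) - (n + 1) * (j + 1))) : ℕ) : ℝ) := by
    rw [h2, h1, tent, max_mul_of_nonneg _ _ hN.le, zero_mul, sub_mul, one_mul, ht]
    congr 1
    push_cast
    congr 1
    rw [← abs_of_pos hN, ← abs_mul, abs_of_pos hN]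
    congr 1
    field_simp
  rw [GaussCode.val, tentCode]
  simp only [Int.cast_natCast, Int.cast_zero, zero_mul, add_zero]
  rw [div_eq_iff (by exact_mod_cast (by positivity : ((N + 1 : ℕ) : ℝ) + 1 ≠ 0))]
  have h4 := congrArg (fun x : ℝ => (x : ℂ)) h3
  push_cast at h4 ⊢
  rw [← h4]
  ring

theorem peval_const_map {ι : Type*} {U : Type*} [CStarAlgebra U] (b : ℕ → U) (l : List ι)
    (g : ι → GaussCode) :
    peval b (l.map fun i => ((g i, []) : Mono)) = (l.map fun i => (g i).val • (1 : U)).sum := by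
  simp [peval, monoEval, Function.comp_def]

theorem peval_curveLetterCode {U : Type*} [CStarAlgebra U] (b : ℕ → U) {N j : ℕ} (n : ℕ)
    {t : Set.Ioo (0 : ℝ) 1} (ht : (t : ℝ) = (j + 1) / (N + 2)) :
    peval b (curveLetterCode N j n) = algebraMap ℂ U (curvePt n t) := by
  unfold curvePt curveLetterCode
  cases (Encodable.decode n : Option (List GaussCode)) with
  | none => simp
  | some z =>
    simp only [Option.map_some, Option.getD_some]
    change _ = algebraMap ℂ U (polygon z t)
    have h (f : ℕ → U) : ((List.range z.length).map f).sum = ∑ i : Fin z.length, f i := by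
      rw [← Finset.sum_range]
      rfl
    rw [peval_const_map, polygon, map_sum, h]
    refine Finset.sum_congr rfl fun i _ => ?_
    rw [val_gmul, val_tentCode ht, List.getD_eq_getElem _ _ i.2, Algebra.algebraMap_eq_smul_one]
    rfl

theorem peval_letterCode (P : CStarPresentation A) {N j : ℕ} (n : ℕ)
    {t : Set.Ioo (0 : ℝ) 1} (ht : (t : ℝ) = (j + 1) / (N + 2)) :
    peval (fun n => (Unitization.inr (P.pt n) : Unitization ℂ A)) (letterCode N j n) =
      evalUnit A t (unitizationPt (suspensionPt P) n) := by
  have h1 : peval (fun n => (Unitization.inr (P.pt n) : Unitization ℂ A))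
      (substP (curveLetterCode N j) (ofRat (letterData n).2.1)) =
      algebraMap ℂ _ (curveVal (letterData n).2.1 t) := by
    rw [peval_substP, curveVal_eq]
    refine Eq.trans ?_ (peval_map (StarAlgHom.ofId ℂ (Unitization ℂ A)) _ _).symm
    congr 1
    ext1 m
    exact peval_curveLetterCode _ m ht
  have h2 : peval (fun n => (Unitization.inr (P.pt n) : Unitization ℂ A))
      (ofRat (letterData n).2.2) = Unitization.inr (P.ratPt (letterData n).2.2) := by
    rw [peval_ofRat]
    exact (ratEval_map (Unitization.inrNonUnitalStarAlgHom ℂ A) P.pt _).symm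
  rw [letterCode, peval_cons, peval_mulP, h1, h2, evalUnit_letterPt, monoEval, List.map_nil,
    List.prod_nil, ← Algebra.smul_def, ← Unitization.inr_smul, ← Algebra.algebraMap_eq_smul_one,
    Unitization.algebraMap_eq_inl]

/-- The values of a polynomial in the special points on codes, at the points of a grid. -/
theorem evalUnit_peval (P : CStarPresentation A) {N j : ℕ} (r : StarPoly)
    {t : Set.Ioo (0 : ℝ) 1} (ht : (t : ℝ) = (j + 1) / (N + 2)) :
    evalUnit A t (peval (unitizationPt (suspensionPt P)) r) =
      Unitization.inl (constP (substP (letterCode N j) r)).val +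
        Unitization.inr (P.ratPt (nonconst (substP (letterCode N j) r))) := by
  rw [peval_map, CStarPresentation.ratPt, ← peval_inr, peval_substP]
  congr 1
  ext1 n
  exact (peval_letterCode P n ht).symm

end Letters

/-! ### The norm test for the unitization of the suspension -/

section NormTest

/-- The algorithm `e`, given the rational point `h`, enumerates a bound less than `2⁻ᵏ`. -/
def NormBelow (e : ℕ) (h : RatPoly) (k : ℕ) : Prop :=
  ∃ (n : ℕ) (x : ℤ × ℕ), Encodable.encode x ∈ phi e (Encodable.encode (h, n)) ∧
    x.1.toNat * 2 ^ k < x.2 + 1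

/-- The number `K` is a bound for the special point with number `n` and for its Lipschitz constant,
certified by the algorithm `e`. -/
def LetterBelow (e n K : ℕ) : Prop :=
  ∃ x : ℤ × ℕ, Encodable.encode x ∈ phi e (Encodable.encode ((letterData n).2.2, 0)) ∧
    letterBound n x.1.natAbs ≤ K

/-- The bound `K` is certified for all special points that occur in `r`. -/
def LettersBelow (e : ℕ) (r : StarPoly) (K : ℕ) : Prop :=
  ∀ l ∈ r.flatMap Prod.snd, LetterBelow e l.1 K

/-- The norm test: the norm of a polynomial in the special points is tested at the points of a grid
that is fine enough with respect to a Lipschitz constant. The scalar part, the values at the points of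
the grid and the oscillation between them are each required to be less than `2⁻¹ ^ (k + 2)`. -/
def NormTest (e : ℕ) (r : StarPoly) (k : ℕ) : Prop :=
  ∃ N K : ℕ, 1 ≤ K ∧ LettersBelow e r K ∧
    gbound (constP (substP (letterCode N 0) r)) * 2 ^ (k + 2) <
      (constP (substP (letterCode N 0) r)).2 + 1 ∧
    (∀ j ∈ List.range (N + 1), NormBelow e (nonconst (substP (letterCode N j) r)) (k + 2)) ∧
    polyBound K r * K * 2 ^ (k + 2) ≤ N

variable {A : Type*} [NonUnitalCStarAlgebra A] {P : CStarPresentation A} {e : ℕ}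

theorem ratVal_cast (x : ℤ × ℕ) : ((ratVal x : ℚ) : ℝ) = x.1 / (x.2 + 1) := by
  simp [ratVal]

theorem IsIndex.norm_le (he : P.IsIndex e) {h : RatPoly} {n : ℕ} {x : ℤ × ℕ}
    (hx : Encodable.encode x ∈ phi e (Encodable.encode (h, n))) : ‖P.ratPt h‖ ≤ ratVal x := by
  obtain ⟨r, h1, h2, h3⟩ := he h
  rw [h1, Part.mem_some_iff] at hx
  rw [Encodable.encode_injective hx]
  have h4 : Antitone fun n => (ratVal (r n) : ℝ) := fun a b hab => Rat.cast_le.2 (h2 hab)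
  exact h4.le_of_tendsto h3 n

theorem IsIndex.exists_lt (he : P.IsIndex e) {h : RatPoly} {ε : ℝ} (hε : ‖P.ratPt h‖ < ε) :
    ∃ (n : ℕ) (x : ℤ × ℕ), Encodable.encode x ∈ phi e (Encodable.encode (h, n)) ∧
      (ratVal x : ℝ) < ε := by
  obtain ⟨r, h1, h2, h3⟩ := he h
  obtain ⟨n, hn⟩ := (h3.eventually (gt_mem_nhds hε)).exists
  exact ⟨n, r n, by rw [h1]; exact Part.mem_some _, hn⟩

theorem lt_pow_half_iff {y c : ℝ} (hc : 0 < c) (k : ℕ) : y / c < 2⁻¹ ^ k ↔ y * 2 ^ k < c := by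
  rw [div_lt_iff₀ hc, inv_pow, ← div_eq_inv_mul, lt_div_iff₀ (by positivity)]

theorem NormBelow.lt (he : P.IsIndex e) {h : RatPoly} {k : ℕ} (hh : NormBelow e h k) :
    ‖P.ratPt h‖ < 2⁻¹ ^ k := by
  obtain ⟨n, x, hx, hk⟩ := hh
  refine (IsIndex.norm_le he hx).trans_lt ?_
  rw [ratVal_cast, lt_pow_half_iff (by positivity)]
  have h1 : (x.1 : ℝ) ≤ (x.1.toNat : ℝ) := by exact_mod_cast Int.self_le_toNat x.1
  have h2 : (x.1.toNat : ℝ) * 2 ^ k < x.2 + 1 := by exact_mod_cast hk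
  have h3 : (0 : ℝ) < 2 ^ k := by positivity
  nlinarith

theorem NormBelow.of_lt (he : P.IsIndex e) {h : RatPoly} {k : ℕ} (hh : ‖P.ratPt h‖ < 2⁻¹ ^ k) :
    NormBelow e h k := by
  obtain ⟨n, x, hx, hk⟩ := IsIndex.exists_lt he hh
  refine ⟨n, x, hx, ?_⟩
  have h0 : (0 : ℝ) ≤ x.1 := by
    have := (norm_nonneg _).trans (IsIndex.norm_le he hx)
    rw [ratVal_cast] at this
    by_contra hc
    exact absurd this (not_le.2 (div_neg_of_neg_of_pos (not_le.1 hc) (by positivity)))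
  rw [ratVal_cast, lt_pow_half_iff (by positivity)] at hk
  have h1 : (x.1 : ℝ) = (x.1.toNat : ℝ) := by
    exact_mod_cast (Int.toNat_of_nonneg (Int.cast_nonneg_iff.1 h0)).symm
  rw [h1] at hk
  exact_mod_cast hk

theorem LetterBelow.norm_le (he : P.IsIndex e) {n K : ℕ} (h : LetterBelow e n K) :
    ‖unitizationPt (suspensionPt P) n‖ ≤ K ∧ ∀ t s, ‖evalUnit A t (unitizationPt (suspensionPt P) n) -
      evalUnit A s (unitizationPt (suspensionPt P) n)‖ ≤ K * |(t : ℝ) - s| := by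
  obtain ⟨x, hx, hK⟩ := h
  have h1 : ‖P.ratPt (letterData n).2.2‖ ≤ x.1.natAbs := by
    refine (IsIndex.norm_le he hx).trans ?_
    rw [ratVal_cast, Nat.cast_natAbs, Int.cast_abs]
    refine (le_abs_self _).trans ?_
    rw [abs_div]
    refine div_le_self (abs_nonneg _) ?_
    rw [abs_of_pos (by positivity)]
    linarith [(Nat.cast_nonneg x.2 : (0 : ℝ) ≤ x.2)]
  have h2 : (letterBound n x.1.natAbs : ℝ) ≤ K := by exact_mod_cast hK
  exact ⟨(norm_letterPt_le P h1).trans h2, fun t s => (norm_evalUnit_letterPt_sub_le P h1 t s).trans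
    (mul_le_mul_of_nonneg_right h2 (abs_nonneg _))⟩

theorem LetterBelow.mono {n K K' : ℕ} (h : LetterBelow e n K) (hK : K ≤ K') :
    LetterBelow e n K' := by
  obtain ⟨x, hx, h1⟩ := h
  exact ⟨x, hx, h1.trans hK⟩

theorem LettersBelow.mono {r : StarPoly} {K K' : ℕ} (h : LettersBelow e r K) (hK : K ≤ K') :
    LettersBelow e r K' := fun l hl => (h l hl).mono hK

theorem exists_lettersBelow (he : P.IsIndex e) (r : StarPoly) : ∃ K, LettersBelow e r K := by
  have h1 (n : ℕ) : ∃ K, LetterBelow e n K := by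
    obtain ⟨r, h1, -⟩ := he (letterData n).2.2
    exact ⟨_, r 0, by rw [h1]; exact Part.mem_some _, le_rfl⟩
  unfold LettersBelow
  induction r.flatMap Prod.snd with
  | nil => exact ⟨0, by simp⟩
  | cons l L ih =>
    obtain ⟨K, hK⟩ := ih
    obtain ⟨K', hK'⟩ := h1 l.1
    refine ⟨max K K', fun l' hl' => ?_⟩
    rcases List.mem_cons.1 hl' with rfl | hl'
    · exact hK'.mono (le_max_right _ _)
    · exact (hK l' hl').mono (le_max_left _ _)

theorem LettersBelow.letter {r : StarPoly} {K : ℕ} (h : LettersBelow e r K) {x : Mono} (hx : x ∈ r)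
    {l : Letter} (hl : l ∈ x.2) : LetterBelow e l.1 K :=
  h l (List.mem_flatMap.2 ⟨x, hx, hl⟩)

/-- The point `(j + 1) / (N + 2)` of the open unit interval. -/
def gridPt (N j : ℕ) (hj : j ≤ N) : Set.Ioo (0 : ℝ) 1 :=
  ⟨(j + 1) / (N + 2), by positivity, by
    rw [div_lt_one (by positivity)]
    have : (j : ℝ) ≤ N := by exact_mod_cast hj
    linarith⟩

theorem exists_gridPt (N : ℕ) (t : Set.Ioo (0 : ℝ) 1) :
    ∃ j, ∃ hj : j ≤ N, |(t : ℝ) - gridPt N j hj| ≤ 1 / (N + 2) := by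
  have h0 : (0 : ℝ) < (N : ℝ) + 2 := by positivity
  have h1 := t.2.1
  have h2 := t.2.2
  refine ⟨min N ⌊(t : ℝ) * (N + 2)⌋₊, min_le_left _ _, ?_⟩
  have h3 := Nat.floor_le (a := (t : ℝ) * (N + 2)) (by positivity)
  have h4 := Nat.lt_floor_add_one ((t : ℝ) * (N + 2))
  have h5 : (t : ℝ) * (N + 2) < N + 2 := by nlinarith
  change |(t : ℝ) - (((min N ⌊(t : ℝ) * (N + 2)⌋₊ : ℕ) : ℝ) + 1) / (N + 2)| ≤ _
  rw [← mul_le_mul_iff_left₀ h0, ← abs_of_pos h0, ← abs_mul, abs_of_pos h0, sub_mul,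
    div_mul_cancel₀ _ h0.ne', div_mul_cancel₀ _ h0.ne', abs_le]
  rcases le_total N ⌊(t : ℝ) * (N + 2)⌋₊ with h | h
  · rw [min_eq_left h]
    have : (N : ℝ) ≤ (⌊(t : ℝ) * (N + 2)⌋₊ : ℕ) := by exact_mod_cast h
    constructor <;> linarith
  · rw [min_eq_right h]
    constructor <;> linarith

theorem fst_peval (P : CStarPresentation A) (N : ℕ) {j : ℕ} (hj : j ≤ N) (r : StarPoly) :
    (peval (unitizationPt (suspensionPt P)) r).fst = (constP (substP (letterCode N j) r)).val := by
  rw [← evalUnit_fst (gridPt N j hj), evalUnit_peval P r rfl]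
  simp

theorem snd_peval (P : CStarPresentation A) (N : ℕ) {j : ℕ} (hj : j ≤ N) (r : StarPoly) :
    (peval (unitizationPt (suspensionPt P)) r).snd (gridPt N j hj) =
      P.ratPt (nonconst (substP (letterCode N j) r)) := by
  rw [← evalUnit_snd, evalUnit_peval P r rfl]
  simp

/-- A polynomial in the special points is a Lipschitz function of time. -/
theorem norm_snd_sub_le (he : P.IsIndex e) {r : StarPoly} {K : ℕ} (hK : 1 ≤ K)
    (h : LettersBelow e r K) (t s : Set.Ioo (0 : ℝ) 1) :
    ‖(peval (unitizationPt (suspensionPt P)) r).snd t -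
      (peval (unitizationPt (suspensionPt P)) r).snd s‖ ≤ polyBound K r * (K * |(t : ℝ) - s|) := by
  set u := peval (unitizationPt (suspensionPt P)) r with hu
  have h1 : (Unitization.inr (u.snd t - u.snd s) : Unitization ℂ A) =
      evalUnit A t u - evalUnit A s u := by
    refine Unitization.ext ?_ ?_
    · change (0 : ℂ) = (evalUnit A t u).fst - (evalUnit A s u).fst
      rw [evalUnit_fst, evalUnit_fst, sub_self]
    · change _ = (evalUnit A t u).snd - (evalUnit A s u).snd
      rw [evalUnit_snd, evalUnit_snd]
      rfl
  rw [← Unitization.norm_inr (𝕜 := ℂ), h1, hu, peval_map, peval_map]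
  have h2 (t : Set.Ioo (0 : ℝ) 1) (x) (hx : x ∈ r) (l : Letter) (hl : l ∈ x.2) :
      ‖evalUnit A t (unitizationPt (suspensionPt P) l.1)‖ ≤ K :=
    (NonUnitalStarAlgHom.norm_apply_le _ _).trans ((h.letter hx hl).norm_le he).1
  exact norm_peval_sub_le hK (by positivity) (h2 t) (h2 s) fun x hx l hl =>
    ((h.letter hx hl).norm_le he).2 t s

/-- The upper bounds enumerated by an index of a presentation make norms in the unitization of the
suspension effectively bounded from above. -/
theorem isNormTest (he : P.IsIndex e) :
    IsNormTest (unitizationPt (suspensionPt P)) (NormTest e) where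
  sound := by
    rintro r k ⟨N, K, hK, hL, hc, hj, hN⟩
    set u := peval (unitizationPt (suspensionPt P)) r with hu
    have hk := pow_half_pos (k + 2)
    have h1 : ‖u.fst‖ < 2⁻¹ ^ (k + 2) := by
      rw [hu, fst_peval P N (Nat.zero_le N)]
      set c := constP (substP (letterCode N 0) r)
      have h2 := norm_val_mul_le c
      have h3 : (0 : ℝ) < (c.2 : ℝ) + 1 := by positivity
      rw [← le_div_iff₀ h3] at h2
      refine h2.trans_lt ?_
      rw [lt_pow_half_iff h3]
      exact_mod_cast hc
    have h2 : ‖u.snd‖ ≤ 2⁻¹ ^ (k + 2) + 2⁻¹ ^ (k + 2) := by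
      refine norm_zeroAtInfty_le (by positivity) fun t => ?_
      obtain ⟨j, hjN, htj⟩ := exists_gridPt N t
      have h3 := NormBelow.lt he (hj j (List.mem_range.2 (Nat.lt_succ_of_le hjN)))
      rw [← snd_peval P N hjN r] at h3
      have h4 := norm_snd_sub_le he hK hL t (gridPt N j hjN)
      have h5 : (polyBound K r : ℝ) * (K * |(t : ℝ) - gridPt N j hjN|) ≤ 2⁻¹ ^ (k + 2) := by
        have h6 : (polyBound K r : ℝ) * K * 2 ^ (k + 2) ≤ N := by exact_mod_cast hN
        have h7 : (0 : ℝ) < (N : ℝ) + 2 := by positivity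
        calc (polyBound K r : ℝ) * (K * |(t : ℝ) - gridPt N j hjN|)
            ≤ polyBound K r * (K * (1 / (N + 2))) := by gcongr
          _ = (polyBound K r : ℝ) * K / (N + 2) := by ring
          _ ≤ _ := by
              rw [div_le_iff₀ h7, inv_pow, ← div_eq_inv_mul, le_div_iff₀ (by positivity)]
              linarith
      have h8 : ‖u.snd t‖ ≤ ‖u.snd t - u.snd (gridPt N j hjN)‖ + ‖u.snd (gridPt N j hjN)‖ := by
        simpa using norm_add_le (u.snd t - u.snd (gridPt N j hjN)) (u.snd (gridPt N j hjN))
      linarith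
    have h3 := norm_unitization_le u
    have h4 : (2⁻¹ : ℝ) ^ (k + 2) = 2⁻¹ ^ k / 4 := by rw [pow_add]; norm_num; ring
    have := pow_half_pos k
    linarith
  complete := by
    intro r k h
    obtain ⟨K, hK⟩ := exists_lettersBelow he r
    have hK1 : LettersBelow e r (K + 1) := hK.mono (Nat.le_succ K)
    refine ⟨polyBound (K + 1) r * (K + 1) * 2 ^ (k + 2), K + 1, by omega, hK1, ?_, fun j hj => ?_,
      le_rfl⟩
    · set N := polyBound (K + 1) r * (K + 1) * 2 ^ (k + 2)
      have h1 := (norm_fst_le _).trans_lt h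
      rw [fst_peval P N (Nat.zero_le N)] at h1
      set c := constP (substP (letterCode N 0) r)
      have h2 := gbound_le c
      have h3 : (0 : ℝ) < (c.2 : ℝ) + 1 := by positivity
      have h4 : (gbound c : ℝ) / (c.2 + 1) < 2⁻¹ ^ (k + 2) := by
        rw [div_lt_iff₀ h3]
        refine h2.trans_lt (mul_lt_mul_of_pos_right ?_ h3)
        have h5 : (2⁻¹ : ℝ) ^ (k + 4) = 2⁻¹ ^ (k + 2) / 4 := by rw [pow_add, pow_add]; norm_num; ring
        have := pow_half_pos (k + 2)
        linarith
      rw [lt_pow_half_iff h3] at h4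
      exact_mod_cast h4
    · have hj' := Nat.le_of_lt_succ (List.mem_range.1 hj)
      refine NormBelow.of_lt he ?_
      rw [← snd_peval P _ hj' r]
      refine ((norm_zeroAtInfty_apply_le _ _).trans (norm_snd_le _)).trans_lt ?_
      have h5 : (2⁻¹ : ℝ) ^ (k + 4) = 2⁻¹ ^ (k + 2) / 4 := by rw [pow_add, pow_add]; norm_num; ring
      have := pow_half_pos (k + 2)
      linarith

end NormTest

section Computability

variable {α : Type*} [Primcodable α]

theorem primrec_letterData : Primrec letterData := by
  refine Primrec.option_getD.comp (Primrec.option_map Primrec.decode ?_)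
    (Primrec.const _)
  exact Primrec.pair (Primrec.snd.comp Primrec.snd) (Primrec.option_getD.comp
    (Primrec.decode.comp (Primrec.fst.comp Primrec.snd)) (Primrec.const _))

theorem primrec_curveLetterBound : Primrec curveLetterBound := by
  refine Primrec.option_getD.comp (Primrec.option_map Primrec.decode ?_)
    (Primrec.const _)
  exact Primrec.nat_mul.comp (Primrec.succ.comp (Primrec.list_length.comp Primrec.snd))
    (primrec_sum (Primrec.list_map Primrec.snd (primrec_gbound.comp Primrec.snd).to₂))

theorem primrec_curveBound : Primrec curveBound := by
  have h : Primrec fun p : RatPoly =>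
      1 + ((ofRat p).flatMap fun x => x.2.map fun l => curveLetterBound l.1).sum :=
    Primrec.nat_add.comp (Primrec.const 1) (primrec_sum (Primrec.list_flatMap primrec_ofRat
      (Primrec.list_map (Primrec.snd.comp Primrec.snd)
        (primrec_curveLetterBound.comp (Primrec.fst.comp Primrec.snd)).to₂).to₂))
  exact Primrec.nat_mul.comp (primrec_polyBound h primrec_ofRat) h

theorem primrec_letterBound {n N : α → ℕ} (hn : Primrec n) (hN : Primrec N) :
    Primrec fun a => letterBound (n a) (N a) :=
  have h := primrec_letterData.comp hn
  Primrec.nat_add.comp (primrec_gbound.comp (Primrec.fst.comp h))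
    (Primrec.nat_mul.comp (primrec_curveBound.comp (Primrec.fst.comp (Primrec.snd.comp h))) hN)

theorem primrec_tentCode {N j n i : α → ℕ} (hN : Primrec N) (hj : Primrec j) (hn : Primrec n)
    (hi : Primrec i) : Primrec fun a => tentCode (N a) (j a) (n a) (i a) := by
  have h1 := Primrec.nat_mul.comp (Primrec.succ.comp hn) (Primrec.succ.comp hj)
  have h3 := Primrec.nat_add.comp hN (Primrec.const 2)
  have h2 := Primrec.nat_mul.comp (Primrec.succ.comp hi) h3
  exact Primrec.pair (Primrec.pair (primrec_natCast (Primrec.nat_sub.comp h3 (Primrec.nat_add.comp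
    (Primrec.nat_sub.comp h1 h2) (Primrec.nat_sub.comp h2 h1)))) (Primrec.const 0))
    (Primrec.succ.comp hN)

theorem primrec_curveLetterCode {N j n : α → ℕ} (hN : Primrec N) (hj : Primrec j)
    (hn : Primrec n) : Primrec fun a => curveLetterCode (N a) (j a) (n a) := by
  refine Primrec.option_getD.comp (Primrec.option_map (Primrec.decode.comp hn) ?_)
    (Primrec.const _)
  refine Primrec.list_map (Primrec.list_range.comp (Primrec.list_length.comp Primrec.snd))
    ?_
  let δ := (α × List GaussCode) × ℕ
  have fa : Primrec fun x : δ => x.1.1 := Primrec.fst.comp Primrec.fst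
  have fz : Primrec fun x : δ => x.1.2 := Primrec.snd.comp Primrec.fst
  have fi : Primrec fun x : δ => x.2 := Primrec.snd
  exact Primrec.pair (primrec_gmul (primrec_tentCode (hN.comp fa) (hj.comp fa)
    (Primrec.list_length.comp fz) fi) ((Primrec.list_getD _).comp fz fi)) (Primrec.const [])

theorem primrec_letterCode {N j n : α → ℕ} (hN : Primrec N) (hj : Primrec j)
    (hn : Primrec n) : Primrec fun a => letterCode (N a) (j a) (n a) := by
  have h := primrec_letterData.comp hn
  refine Primrec.list_cons.comp (Primrec.pair (Primrec.fst.comp h) (Primrec.const []))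
    (primrec_mulP (primrec_substP (f := fun a => curveLetterCode (N a) (j a)) ?_
      (primrec_ofRat.comp (Primrec.fst.comp (Primrec.snd.comp h))))
      (primrec_ofRat.comp (Primrec.snd.comp (Primrec.snd.comp h))))
  exact (primrec_curveLetterCode (hN.comp Primrec.fst) (hj.comp Primrec.fst) Primrec.snd).to₂

theorem primrec_substP_letterCode {N j : α → ℕ} {r : α → StarPoly} (hN : Primrec N)
    (hj : Primrec j) (hr : Primrec r) : Primrec fun a => substP (letterCode (N a) (j a)) (r a) :=
  primrec_substP (primrec_letterCode (hN.comp Primrec.fst) (hj.comp Primrec.fst) Primrec.snd).to₂ hr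

theorem sigmaOne_normBelow {e k : α → ℕ} {h : α → RatPoly} (he : Primrec e) (hh : Primrec h)
    (hk : Primrec k) : SigmaOne fun a => NormBelow (e a) (h a) (k a) := by
  refine SigmaOne.exists (SigmaOne.exists ?_)
  let δ := (α × ℕ) × (ℤ × ℕ)
  have fa : Primrec fun x : δ => x.1.1 := Primrec.fst.comp Primrec.fst
  have fn : Primrec fun x : δ => x.1.2 := Primrec.snd.comp Primrec.fst
  have fx : Primrec fun x : δ => x.2 := Primrec.snd
  refine SigmaOne.and (sigmaOne_phi.comp (f := fun x : δ => (e x.1.1,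
    Encodable.encode (h x.1.1, x.1.2), Encodable.encode x.2)) (Primrec.pair (he.comp fa)
      (Primrec.pair (Primrec.encode.comp (Primrec.pair (hh.comp fa) fn)) (Primrec.encode.comp fx))))
    (PrimrecPred.sigmaOne ?_)
  exact Primrec.nat_lt.comp (Primrec.nat_mul.comp (primrec_toNat.comp (Primrec.fst.comp fx))
    (primrec_pow (Primrec.const 2) (hk.comp fa))) (Primrec.succ.comp (Primrec.snd.comp fx))

theorem sigmaOne_letterBelow {e n K : α → ℕ} (he : Primrec e) (hn : Primrec n) (hK : Primrec K) :
    SigmaOne fun a => LetterBelow (e a) (n a) (K a) := by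
  refine SigmaOne.exists (R := fun a x => _) ?_
  let δ := α × (ℤ × ℕ)
  have fa : Primrec fun x : δ => x.1 := Primrec.fst
  have fx : Primrec fun x : δ => x.2 := Primrec.snd
  refine SigmaOne.and (sigmaOne_phi.comp (f := fun x : δ => (e x.1,
    Encodable.encode ((letterData (n x.1)).2.2, 0), Encodable.encode x.2)) (Primrec.pair (he.comp fa)
      (Primrec.pair (Primrec.encode.comp (Primrec.pair (Primrec.snd.comp (Primrec.snd.comp
        (primrec_letterData.comp (hn.comp fa)))) (Primrec.const 0))) (Primrec.encode.comp fx))))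
    (PrimrecPred.sigmaOne ?_)
  exact Primrec.nat_le.comp (primrec_letterBound (hn.comp fa) (primrec_natAbs (Primrec.fst.comp fx)))
    (hK.comp fa)

theorem sigmaOne_lettersBelow {e K : α → ℕ} {r : α → StarPoly} (he : Primrec e) (hr : Primrec r)
    (hK : Primrec K) : SigmaOne fun a => LettersBelow (e a) (r a) (K a) :=
  SigmaOne.forall_mem (R := fun a (l : Letter) => LetterBelow (e a) l.1 (K a))
    (sigmaOne_letterBelow (he.comp Primrec.fst) (Primrec.fst.comp Primrec.snd) (hK.comp Primrec.fst))
    (Primrec.list_flatMap hr (Primrec.snd.comp Primrec.snd).to₂)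

theorem sigmaOne_normTest :
    SigmaOne fun x : ℕ × StarPoly × ℕ => NormTest x.1 x.2.1 x.2.2 := by
  refine SigmaOne.exists (SigmaOne.exists ?_)
  let δ := ((ℕ × StarPoly × ℕ) × ℕ) × ℕ
  have fe : Primrec fun x : δ => x.1.1.1 := Primrec.fst.comp (Primrec.fst.comp Primrec.fst)
  have fr : Primrec fun x : δ => x.1.1.2.1 :=
    Primrec.fst.comp (Primrec.snd.comp (Primrec.fst.comp Primrec.fst))
  have fk : Primrec fun x : δ => x.1.1.2.2 + 2 := Primrec.nat_add.comp
    (Primrec.snd.comp (Primrec.snd.comp (Primrec.fst.comp Primrec.fst))) (Primrec.const 2)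
  have fN : Primrec fun x : δ => x.1.2 := Primrec.snd.comp Primrec.fst
  have fK : Primrec fun x : δ => x.2 := Primrec.snd
  have fc : Primrec fun x : δ => constP (substP (letterCode x.1.2 0) x.1.1.2.1) :=
    primrec_constP.comp (primrec_substP_letterCode fN (Primrec.const 0) fr)
  have fp := primrec_pow (Primrec.const 2) fk
  refine SigmaOne.and (PrimrecPred.sigmaOne (Primrec.nat_le.comp (Primrec.const 1) fK)) ?_
  refine SigmaOne.and (sigmaOne_lettersBelow fe fr fK) ?_
  refine SigmaOne.and (PrimrecPred.sigmaOne (Primrec.nat_lt.comp (Primrec.nat_mul.comp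
    (primrec_gbound.comp fc) fp) (Primrec.succ.comp (Primrec.snd.comp fc)))) ?_
  refine SigmaOne.and ?_ (PrimrecPred.sigmaOne (Primrec.nat_le.comp (Primrec.nat_mul.comp
    (Primrec.nat_mul.comp (primrec_polyBound fK fr) fK) fp) fN))
  refine SigmaOne.forall_mem (R := fun (x : δ) j => NormBelow x.1.1.1
    (nonconst (substP (letterCode x.1.2 j) x.1.1.2.1)) (x.1.1.2.2 + 2)) ?_
    (Primrec.list_range.comp (Primrec.succ.comp fN))
  exact sigmaOne_normBelow (fe.comp Primrec.fst) (primrec_nonconst.comp (primrec_substP_letterCode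
    (fN.comp Primrec.fst) Primrec.snd (fr.comp Primrec.fst))) (fk.comp Primrec.fst)

end Computability

/-! ### Density of the rational points -/

section Density

variable {U : Type*} [CStarAlgebra U]

theorem dense_gaussCode : DenseRange GaussCode.val := by
  intro z
  rw [Metric.mem_closure_range_iff]
  intro ε hε
  obtain ⟨N, hN⟩ := exists_nat_gt (2 / ε)
  have hN0 : (0 : ℝ) < (N : ℝ) + 1 := by positivity
  have key (y : ℝ) : |y - (⌊y * (N + 1)⌋ : ℝ) / (N + 1)| ≤ 1 / (N + 1) := by
    have h1 := Int.floor_le (y * (N + 1))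
    have h2 := Int.lt_floor_add_one (y * ((N : ℝ) + 1))
    rw [← mul_le_mul_iff_left₀ hN0, ← abs_of_pos hN0, ← abs_mul, abs_of_pos hN0, sub_mul,
      div_mul_cancel₀ _ hN0.ne', div_mul_cancel₀ _ hN0.ne', abs_le]
    constructor <;> linarith
  refine ⟨((⌊z.re * (N + 1)⌋, ⌊z.im * (N + 1)⌋), N), ?_⟩
  have e : GaussCode.val ((⌊z.re * (N + 1)⌋, ⌊z.im * (N + 1)⌋), N) =
      (((⌊z.re * (N + 1)⌋ : ℝ) / (N + 1) : ℝ) : ℂ) +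
        (((⌊z.im * (N + 1)⌋ : ℝ) / (N + 1) : ℝ) : ℂ) * Complex.I := by
    simp only [GaussCode.val]
    push_cast
    ring
  rw [e, dist_eq_norm]
  have h3 := Complex.norm_le_abs_re_add_abs_im (z - ((((⌊z.re * (N + 1)⌋ : ℝ) / (N + 1) : ℝ) : ℂ) +
        (((⌊z.im * (N + 1)⌋ : ℝ) / (N + 1) : ℝ) : ℂ) * Complex.I))
  simp only [Complex.sub_re, Complex.add_re, Complex.mul_re, Complex.ofReal_re, Complex.ofReal_im,
    Complex.I_re, Complex.I_im, Complex.sub_im, Complex.add_im, Complex.mul_im, mul_zero, mul_one,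
    sub_zero, add_zero, zero_add] at h3
  refine h3.trans_lt ((add_le_add (key _) (key _)).trans_lt ?_)
  rw [← add_div, div_lt_iff₀ hN0]
  rw [div_lt_iff₀ hε] at hN
  nlinarith

/-- The closed `*`-subalgebra of all limits of polynomials in the points `b`. -/
def polyClosure (b : ℕ → U) : StarSubalgebra ℂ U where
  carrier := closure (Set.range (peval b))
  mul_mem' hx hy := map_mem_closure₂ continuous_mul hx hy (by
    rintro _ ⟨p, rfl⟩ _ ⟨q, rfl⟩
    exact ⟨mulP p q, peval_mulP b p q⟩)
  add_mem' hx hy := map_mem_closure₂ continuous_add hx hy (by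
    rintro _ ⟨p, rfl⟩ _ ⟨q, rfl⟩
    exact ⟨p ++ q, by simp [peval]⟩)
  algebraMap_mem' z := by
    refine map_mem_closure (f := algebraMap ℂ U) (continuous_algebraMap ℂ U) (dense_gaussCode z) ?_
    rintro _ ⟨c, rfl⟩
    exact ⟨[(c, [])], by simp [monoEval, Algebra.algebraMap_eq_smul_one]⟩
  star_mem' hx := map_mem_closure continuous_star hx (by
    rintro _ ⟨p, rfl⟩
    exact ⟨starP p, peval_starP b p⟩)

theorem mem_polyClosure {b : ℕ → U} {x : U} :
    x ∈ polyClosure b ↔ x ∈ closure (Set.range (peval b)) := Iff.rfl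

theorem isClosed_polyClosure (b : ℕ → U) : IsClosed (polyClosure b : Set U) := isClosed_closure

theorem pt_mem_polyClosure (b : ℕ → U) (n : ℕ) : b n ∈ polyClosure b :=
  subset_closure ⟨[(gint 1, [(n, false)])], by simp [monoEval, val_gint, Letter.eval]⟩

/-- The unitization makes it possible to work with polynomials with a constant term, which form a unital
algebra. -/
theorem polyClosure_inr {A : Type*} [NonUnitalCStarAlgebra A] (P : CStarPresentation A) (x : A) :
    (Unitization.inr x : Unitization ℂ A) ∈ polyClosure fun n => Unitization.inr (P.pt n) := by
  set S := polyClosure fun n => (Unitization.inr (P.pt n) : Unitization ℂ A) with hS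
  have h1 : ∀ y ∈ NonUnitalStarAlgebra.adjoin ℂ (Set.range P.pt),
      (Unitization.inr y : Unitization ℂ A) ∈ S := by
    intro y hy
    induction hy using NonUnitalStarAlgebra.adjoin_induction with
    | mem x hx =>
      obtain ⟨n, rfl⟩ := hx
      exact pt_mem_polyClosure _ n
    | add x y _ _ hx hy => rw [Unitization.inr_add]; exact add_mem hx hy
    | zero => rw [Unitization.inr_zero]; exact zero_mem S
    | mul x y _ _ hx hy => rw [Unitization.inr_mul]; exact mul_mem hx hy
    | smul r x _ hx => rw [Unitization.inr_smul]; exact S.smul_mem hx r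
    | star x _ hx => rw [Unitization.inr_star]; exact star_mem hx
  have h2 : Continuous fun y : A => (Unitization.inr y : Unitization ℂ A) :=
    starHom_continuous (Unitization.inrNonUnitalStarAlgHom ℂ A)
  have h3 : IsClosed {y : A | (Unitization.inr y : Unitization ℂ A) ∈ S} :=
    (isClosed_polyClosure _).preimage h2
  exact h3.closure_subset_iff.2 h1 (P.dense x)

/-- The rational points of a presentation are dense. -/
theorem dense_ratPt {A : Type*} [NonUnitalCStarAlgebra A] (P : CStarPresentation A) :
    DenseRange P.ratPt := by
  intro x
  have h1 := polyClosure_inr P x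
  rw [mem_polyClosure] at h1
  have h2 : Continuous fun y : Unitization ℂ A => y.snd :=
    AddMonoidHomClass.continuous_of_bound (Unitization.sndHom ℂ ℂ A) 2 fun y => norm_snd_le y
  have h3 := map_mem_closure (t := Set.range P.ratPt) h2 h1 ?_
  · simpa using h3
  · rintro _ ⟨p, rfl⟩
    refine ⟨nonconst p, ?_⟩
    rw [peval_inr]
    simp [CStarPresentation.ratPt]

/-- The function that is `0` on the left of `0`, `1` on the right of `1`, and linear between. -/
def ramp (y : ℝ) : ℝ := max 0 (min y 1)

theorem ramp_sub_ramp (x i : ℝ) : ramp (x - i) - ramp (x - (i + 1)) =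
    max 0 (1 - |x - (i + 1)|) := by
  unfold ramp
  rcases le_total (x - (i + 1)) 0 with h | h
  · rw [abs_of_nonpos h, min_eq_left (by linarith : x - i ≤ 1), min_eq_left (by linarith),
      max_eq_left h, sub_zero]
    congr 1
    ring
  · rw [abs_of_nonneg h, min_eq_right (by linarith : 1 ≤ x - i), max_eq_right zero_le_one]
    rcases le_total (x - (i + 1)) 1 with h' | h'
    · rw [min_eq_left h', max_eq_right h, max_eq_right (by linarith)]
    · rw [min_eq_right h', max_eq_right zero_le_one, max_eq_left (by linarith), sub_self]

/-- The tent functions form a telescoping sum. -/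
theorem sum_tent (n : ℕ) (t : ℝ) : ∑ i ∈ Finset.range n, tent n i t =
    ramp ((n + 1) * t) - ramp ((n + 1) * t - n) := by
  have h := Finset.sum_range_sub' (fun i : ℕ => ramp ((n + 1) * t - i)) n
  rw [Nat.cast_zero, sub_zero] at h
  rw [← h]
  refine Finset.sum_congr rfl fun i _ => ?_
  rw [tent, ← ramp_sub_ramp]
  push_cast
  rfl

theorem sum_tent_le_one (n : ℕ) (t : ℝ) : ∑ i ∈ Finset.range n, tent n i t ≤ 1 := by
  rw [sum_tent]
  have h1 : ramp ((n + 1) * t) ≤ 1 := max_le zero_le_one (min_le_right _ _)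
  have h2 : 0 ≤ ramp ((n + 1) * t - n) := le_max_left _ _
  linarith

theorem sum_tent_eq_one {n : ℕ} {t : ℝ} (h1 : 1 ≤ (n + 1) * t) (h2 : (n + 1) * t ≤ n) :
    ∑ i ∈ Finset.range n, tent n i t = 1 := by
  rw [sum_tent, ramp, ramp, min_eq_right h1, min_eq_left (by linarith), max_eq_right zero_le_one,
    max_eq_left (by linarith), sub_zero]

/-- The curve that is the tent function `tent n i`. -/
def tentCurve (n i : ℕ) : List GaussCode :=
  (List.range n).map fun k => if k = i then gint 1 else gint 0

theorem polygon_tentCurve {n i : ℕ} (hi : i < n) (t : ℝ) :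
    polygon (tentCurve n i) t = tent n i t := by
  have hl : (tentCurve n i).length = n := by simp [tentCurve]
  rw [polygon, Finset.sum_eq_single (⟨i, by omega⟩ : Fin (tentCurve n i).length)]
  · simp [tentCurve, val_gint]
  · intro k _ hk
    have hk' : (k : ℕ) ≠ i := fun h => hk (Fin.ext h)
    have h0 : (tentCurve n i)[k] = gint 0 := by
      change (tentCurve n i)[(k : ℕ)] = gint 0
      simp [tentCurve, hk']
    rw [h0, val_gint, Int.cast_zero, mul_zero]
  · simp

variable {A : Type*} [NonUnitalCStarAlgebra A]

theorem continuous_inr_tensor (F : C₀(Set.Ioo (0 : ℝ) 1, ℂ)) : Continuous fun a : A =>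
    (Unitization.inr (tensor F a) : Unitization ℂ (Suspension A)) := by
  let f : A →+ Unitization ℂ (Suspension A) :=
    { toFun := fun a => Unitization.inr (tensor F a)
      map_zero' := by rw [← Unitization.inr_zero]; congr 1; ext t; simp [tensor]
      map_add' := fun a b => by
        rw [← Unitization.inr_add]; congr 1; ext t; exact smul_add _ _ _ }
  refine AddMonoidHomClass.continuous_of_bound f ‖F‖ fun a => ?_
  change ‖(Unitization.inr (tensor F a) : Unitization ℂ (Suspension A))‖ ≤ _
  rw [Unitization.norm_inr]
  refine norm_zeroAtInfty_le (by positivity) fun t => ?_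
  change ‖F t • a‖ ≤ _
  rw [norm_smul]
  gcongr
  exact norm_zeroAtInfty_apply_le F t

theorem curvePt_encode (z : List GaussCode) : curvePt (Encodable.encode z) = curve z := by
  simp only [curvePt, Encodable.encodek]

theorem suspensionPt_encode (P : CStarPresentation A) (p q : RatPoly) :
    suspensionPt P (Encodable.encode (p, q)) = tensor (RatPoly.eval curvePt p) (P.ratPt q) := by
  simp only [suspensionPt, Encodable.encodek]

theorem unitizationPt_encode (a : ℕ → A) (m : ℕ) (z : GaussCode) :
    unitizationPt a (Encodable.encode (m, z)) =
      Unitization.inl z.val + Unitization.inr (a m) := by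
  simp only [unitizationPt, Encodable.encodek]

theorem inr_tensor_mem (P : CStarPresentation A) (z : List GaussCode) (a : A) :
    (Unitization.inr (tensor (curve z) a) : Unitization ℂ (Suspension A)) ∈
      polyClosure (unitizationPt (suspensionPt P)) := by
  have h1 : IsClosed {a : A | (Unitization.inr (tensor (curve z) a) :
      Unitization ℂ (Suspension A)) ∈ polyClosure (unitizationPt (suspensionPt P))} :=
    (isClosed_polyClosure _).preimage (continuous_inr_tensor _)
  refine h1.closure_subset_iff.2 ?_ (dense_ratPt P a)
  rintro _ ⟨q, rfl⟩
  have h2 := pt_mem_polyClosure (unitizationPt (suspensionPt P)) (Encodable.encode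
    (Encodable.encode (([(gint 1, ((Encodable.encode z, false), []))], q) : RatPoly × RatPoly),
      gint 0))
  have h3 : RatPoly.eval curvePt [(gint 1, ((Encodable.encode z, false), []))] = curve z := by
    simp [RatPoly.eval, Monomial.eval, Letter.eval, val_gint, curvePt_encode]
  rw [unitizationPt_encode, suspensionPt_encode, h3, val_gint, Int.cast_zero,
    Unitization.inl_zero, zero_add] at h2
  exact h2

/-- A function in the suspension is a limit of sums of elementary tensors: it is uniformly continuous and
vanishes at the ends, and the tent functions are a partition of unity away from the ends. -/
theorem inr_mem_polyClosure (P : CStarPresentation A) (h : Suspension A) :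
    (Unitization.inr h : Unitization ℂ (Suspension A)) ∈
      polyClosure (unitizationPt (suspensionPt P)) := by
  rw [← SetLike.mem_coe, ← (isClosed_polyClosure _).closure_eq, Metric.mem_closure_iff]
  intro ε hε
  have hε2 : 0 < ε / 3 := by positivity
  -- the function is small outside of a compact interval
  obtain ⟨η, hη, hη2⟩ : ∃ η > 0, ∀ t : Set.Ioo (0 : ℝ) 1, (t : ℝ) < η ∨ 1 - η < t →
      ‖h t‖ < ε / 3 := by
    obtain ⟨K, hK, hK2⟩ := Filter.mem_cocompact.1 ((tendsto_zero_iff_norm_tendsto_zero.1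
      h.zero_at_infty').eventually (gt_mem_nhds hε2))
    obtain ⟨δ, hδ, hδ2⟩ := (hK.image continuous_subtype_val).exists_thickening_subset_open
      (isOpen_Ioo (a := (0 : ℝ)) (b := 1)) (by rintro _ ⟨t, -, rfl⟩; exact t.2)
    refine ⟨δ / 2, by positivity, fun t ht => hK2 fun htK => ?_⟩
    have h1 (x : ℝ) (hx : |x| < δ) : (t : ℝ) + x ∈ Set.Ioo (0 : ℝ) 1 :=
      hδ2 (Metric.mem_thickening_iff.2 ⟨t, ⟨t, htK, rfl⟩, by simpa [Real.dist_eq] using hx⟩)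
    rcases ht with ht | ht
    · have := (h1 (-(δ / 2)) (by rw [abs_neg, abs_of_pos (by positivity)]; linarith)).1
      linarith
    · have := (h1 (δ / 2) (by rw [abs_of_pos (by positivity)]; linarith)).2
      linarith
  obtain ⟨δ, hδ, hδ2⟩ := Metric.uniformContinuous_iff.1
    (ZeroAtInftyContinuousMap.uniformContinuous h) (ε / 3) hε2
  obtain ⟨n, hn⟩ := exists_nat_gt (1 / η + 1 / δ + 1)
  have hn0 : (0 : ℝ) < (n : ℝ) + 1 := by positivity
  have hη1 : 0 < 1 / η := by positivity
  have hδ1 : 0 < 1 / δ := by positivity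
  have hnη : 1 < (n + 1) * η := by
    have : 1 / η < n + 1 := by linarith
    rwa [div_lt_iff₀ hη] at this
  have hnδ : 1 < (n + 1) * δ := by
    have : 1 / δ < n + 1 := by linarith
    rwa [div_lt_iff₀ hδ] at this
  let s (i : Fin n) : Set.Ioo (0 : ℝ) 1 := ⟨(i + 1) / (n + 1), by positivity, by
    rw [div_lt_one hn0]
    have : ((i : ℕ) : ℝ) < n := by exact_mod_cast i.2
    linarith⟩
  let g : Suspension A := ∑ i : Fin n, tensor (curve (tentCurve n i)) (h (s i))
  refine ⟨Unitization.inr g, ?_, ?_⟩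
  · have : (Unitization.inr g : Unitization ℂ (Suspension A)) =
        ∑ i : Fin n, Unitization.inr (tensor (curve (tentCurve n i)) (h (s i))) :=
      map_sum (Unitization.inrHom ℂ ℂ (Suspension A)) _ _
    rw [this]
    exact sum_mem fun i _ => inr_tensor_mem P _ _
  · rw [dist_eq_norm, ← Unitization.inr_sub, Unitization.norm_inr]
    refine (norm_zeroAtInfty_le (by positivity) fun t => ?_).trans_lt
      (by linarith : ε / 3 + ε / 3 < ε)
    have hg : g t = ∑ i : Fin n, tent n i t • h (s i) := by
      have : g t = evalAt t g := rfl
      rw [this, map_sum]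
      refine Finset.sum_congr rfl fun i _ => ?_
      change polygon (tentCurve n i) t • h (s i) = _
      rw [polygon_tentCurve i.2, Complex.coe_smul]
    have hsum : ∑ i : Fin n, tent n i t = ∑ i ∈ Finset.range n, tent n i t :=
      (Finset.sum_range fun i => tent n i t).symm
    have e : (h - g) t = (1 - ∑ i : Fin n, tent n i t) • h t +
        ∑ i : Fin n, tent n i t • (h t - h (s i)) := by
      rw [ZeroAtInftyContinuousMap.sub_apply, hg, sub_smul, one_smul, Finset.sum_smul]
      simp only [smul_sub, Finset.sum_sub_distrib]
      abel
    rw [e]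
    refine (norm_add_le _ _).trans (add_le_add ?_ ?_)
    · have h1 := sum_tent_le_one n t
      have h0 : 0 ≤ ∑ i : Fin n, tent n i t := Finset.sum_nonneg fun i _ => tent_nonneg _ _ _
      rw [norm_smul, Real.norm_of_nonneg (by rw [hsum]; linarith)]
      by_cases ht : (t : ℝ) < η ∨ 1 - η < t
      · have := hη2 t ht
        nlinarith [norm_nonneg (h t)]
      · push Not at ht
        rw [hsum, sum_tent_eq_one (by nlinarith) (by nlinarith), sub_self, zero_mul]
        exact hε2.le
    · calc _ ≤ ∑ i : Fin n, tent n i t * (ε / 3) := by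
            refine norm_sum_le_of_le _ fun i _ => ?_
            rw [norm_smul, Real.norm_of_nonneg (tent_nonneg _ _ _)]
            by_cases hi : tent n i t = 0
            · simp [hi]
            · refine mul_le_mul_of_nonneg_left ?_ (tent_nonneg _ _ _)
              rw [← dist_eq_norm]
              refine (hδ2 ?_).le
              rw [Subtype.dist_eq, Real.dist_eq]
              have h2 : |((n : ℝ) + 1) * t - (i + 1)| < 1 := by
                by_contra hc
                exact hi (max_eq_left (by linarith))
              have h3 : ((n : ℝ) + 1) * |(t : ℝ) - s i| < 1 := by
                rw [← abs_of_pos hn0, ← abs_mul]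
                change |((n : ℝ) + 1) * ((t : ℝ) - (((i : ℕ) : ℝ) + 1) / (n + 1))| < 1
                rwa [mul_sub, mul_div_cancel₀ _ hn0.ne']
              nlinarith
        _ = (∑ i ∈ Finset.range n, tent n i t) * (ε / 3) := by rw [← Finset.sum_mul, hsum]
        _ ≤ 1 * (ε / 3) := mul_le_mul_of_nonneg_right (sum_tent_le_one _ _) hε2.le
        _ = _ := one_mul _

theorem denseRange_peval (P : CStarPresentation A) :
    DenseRange (peval (unitizationPt (suspensionPt P))) := by
  intro x
  rw [← mem_polyClosure, ← Unitization.inl_fst_add_inr_snd_eq x, ← Unitization.algebraMap_eq_inl]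
  exact add_mem (algebraMap_mem _ _) (inr_mem_polyClosure P _)

end Density

/-! ### Functoriality of `K₀` and `K₁` -/

section Functoriality

variable {U V W : Type*} [CStarAlgebra U] [CStarAlgebra V] [CStarAlgebra W]

theorem UnitalK0.map_eq_of_of {f : UnitalK0 U →+ UnitalK0 V} {g : UnitalK0 U →+ UnitalK0 V}
    (h : ∀ x, f (Algebra.GrothendieckAddGroup.of x) = g (Algebra.GrothendieckAddGroup.of x)) :
    f = g := by
  refine Algebra.GrothendieckAddGroup.lift.symm.injective ?_
  ext y
  exact h y

theorem UnitalK0.map_comp (φ : U →⋆ₐ[ℂ] V) (ψ : V →⋆ₐ[ℂ] W) :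
    UnitalK0.map (ψ.comp φ) = (UnitalK0.map ψ).comp (UnitalK0.map φ) := by
  refine UnitalK0.map_eq_of_of fun x => ?_
  rw [AddMonoidHom.comp_apply, UnitalK0.map_of, UnitalK0.map_of, UnitalK0.map_of]
  obtain ⟨p⟩ := x
  rfl

theorem UnitalK0.map_id : UnitalK0.map (StarAlgHom.id ℂ U) = AddMonoidHom.id (UnitalK0 U) := by
  refine UnitalK0.map_eq_of_of fun x => ?_
  rw [UnitalK0.map_of]
  obtain ⟨p⟩ := x
  rfl

variable {A B C : Type*} [NonUnitalCStarAlgebra A] [NonUnitalCStarAlgebra B]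
  [NonUnitalCStarAlgebra C]

/-- The homomorphism between the unitizations of the suspensions that is induced by `φ`. -/
def suspUnit (φ : A →⋆ₙₐ[ℂ] B) :
    Unitization ℂ (Suspension A) →⋆ₐ[ℂ] Unitization ℂ (Suspension B) :=
  Unitization.starMap (Suspension.map φ)

theorem suspUnit_inl_add_inr (φ : A →⋆ₙₐ[ℂ] B) (z : ℂ) (h : Suspension A) :
    suspUnit φ (Unitization.inl z + Unitization.inr h) =
      Unitization.inl z + Unitization.inr (Suspension.map φ h) := by
  rw [map_add, suspUnit, Unitization.starMap_inl, Unitization.starMap_inr,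
    Unitization.algebraMap_eq_inl]

theorem suspUnit_id : suspUnit (NonUnitalStarAlgHom.id ℂ A) = StarAlgHom.id ℂ _ := by
  refine StarAlgHom.ext fun x => ?_
  rw [← Unitization.inl_fst_add_inr_snd_eq x, suspUnit_inl_add_inr]
  rfl

theorem suspUnit_comp (φ : A →⋆ₙₐ[ℂ] B) (ψ : B →⋆ₙₐ[ℂ] C) :
    suspUnit (ψ.comp φ) = (suspUnit ψ).comp (suspUnit φ) := by
  refine StarAlgHom.ext fun x => ?_
  rw [← Unitization.inl_fst_add_inr_snd_eq x, StarAlgHom.comp_apply, suspUnit_inl_add_inr,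
    suspUnit_inl_add_inr, suspUnit_inl_add_inr]
  rfl

theorem K1.coe_map (φ : A →⋆ₙₐ[ℂ] B) (z : K1 A) :
    (K1.map φ z : UnitalK0 (Unitization ℂ (Suspension B))) = UnitalK0.map (suspUnit φ) z.1 := rfl

theorem K1.map_id : K1.map (NonUnitalStarAlgHom.id ℂ A) = AddMonoidHom.id (K1 A) := by
  ext z
  rw [K1.coe_map, suspUnit_id, UnitalK0.map_id]
  rfl

theorem K1.map_comp (φ : A →⋆ₙₐ[ℂ] B) (ψ : B →⋆ₙₐ[ℂ] C) :
    K1.map (ψ.comp φ) = (K1.map ψ).comp (K1.map φ) := by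
  ext z
  rw [K1.coe_map, suspUnit_comp, UnitalK0.map_comp]
  rfl

/-- The homomorphism `(a, α) ↦ (0, α)`. -/
def scalarHom (A : Type*) [NonUnitalCStarAlgebra A] : Unitization ℂ A →⋆ₐ[ℂ] Unitization ℂ A :=
  (StarAlgHom.ofId ℂ (Unitization ℂ A)).comp (unitizationProj A)

/-- Since the unitization is a split extension, the elements of `K₀` are those that are killed by the
homomorphism `(a, α) ↦ (0, α)`. -/
theorem mem_K0_iff {z : UnitalK0 (Unitization ℂ A)} :
    z ∈ (UnitalK0.map (unitizationProj A)).ker ↔ UnitalK0.map (scalarHom A) z = 0 := by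
  rw [scalarHom, UnitalK0.map_comp, AddMonoidHom.mem_ker, AddMonoidHom.comp_apply]
  refine ⟨fun h => by rw [h, map_zero], fun h => ?_⟩
  have h1 : (unitizationProj A).comp (StarAlgHom.ofId ℂ (Unitization ℂ A)) = StarAlgHom.id ℂ ℂ :=
    StarAlgHom.ext fun x => rfl
  have h2 := congrArg (UnitalK0.map (unitizationProj A)) h
  rw [← AddMonoidHom.comp_apply, ← UnitalK0.map_comp, h1, UnitalK0.map_id, map_zero] at h2
  exact h2

end Functoriality

/-! ### The presentation of `K₁` -/

section Generators

/-- A special point of the suspension that is `0` for every presentation. -/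
def zeroPt : ℕ := Encodable.encode (([], []) : RatPoly × RatPoly)

/-- The special point that is the scalar part of the special point with number `n`. -/
def scalarPt (n : ℕ) : ℕ := Encodable.encode (zeroPt, (letterData n).1)

/-- The special point that is the unit. -/
def unitPt : ℕ := Encodable.encode (zeroPt, gint 1)

/-- A pair of codes; it stands for the formal difference of the projections to which they
converge. -/
abbrev PCode : Type := SCode × SCode

/-- The code of the formal difference `0 - 0`. -/
def zeroCode : PCode := ((0, []), (0, []))

/-- The test whether two codes give projections whose difference belongs to `K₁`. -/
def GenValid (e : ℕ) (X : PCode) : Prop :=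
  SValid (NormTest e) X.1 ∧ SValid (NormTest e) X.2 ∧
    DiffTest (NormTest e) (sren scalarPt (ssymm X.1), sren scalarPt (ssymm X.2)) zeroCode

theorem primrec_scalarPt : Primrec scalarPt :=
  Primrec.encode.comp (Primrec.pair (Primrec.const _) (Primrec.fst.comp primrec_letterData))

theorem sigmaOne_genValid : SigmaOne fun x : ℕ × PCode => GenValid x.1 x.2 := by
  have f1 : Primrec fun x : ℕ × PCode => x.2.1 := Primrec.fst.comp Primrec.snd
  have f2 : Primrec fun x : ℕ × PCode => x.2.2 := Primrec.snd.comp Primrec.snd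
  have hs {X : ℕ × PCode → SCode} (hX : Primrec X) :
      Primrec fun x => sren scalarPt (ssymm (X x)) :=
    Primrec.pair (Primrec.fst.comp (primrec_ssymm hX))
      (primrec_mren (primrec_scalarPt.comp Primrec.snd).to₂ (Primrec.snd.comp (primrec_ssymm hX)))
  exact (sigmaOne_sValid sigmaOne_normTest Primrec.fst f1).and
    ((sigmaOne_sValid sigmaOne_normTest Primrec.fst f2).and
      (sigmaOne_diffTest sigmaOne_normTest Primrec.fst (Primrec.pair (hs f1) (hs f2))
        (Primrec.const zeroCode)))

/-- The decidable notion of certificate for `GenValid`. -/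
def genCert : ℕ × PCode → ℕ → Bool := sigmaOne_genValid.exists_bool.choose

theorem primrec_genCert : Primrec₂ genCert := sigmaOne_genValid.exists_bool.choose_spec.1

theorem genValid_iff {e : ℕ} {X : PCode} : GenValid e X ↔ ∃ s, genCert (e, X) s = true :=
  sigmaOne_genValid.exists_bool.choose_spec.2 (e, X)

/-- The formal difference that is the generator with number `i`: a generator consists of codes of two
projections and of a certificate that their difference belongs to `K₁`. All other numbers give the
generator `0`. -/
def genCode (e i : ℕ) : PCode :=
  ((Encodable.decode i : Option (PCode × ℕ)).map fun x =>
    bif genCert (e, x.1) x.2 then (ssymm x.1.1, ssymm x.1.2) else zeroCode).getD zeroCode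

/-- The formal difference labelled by a word. -/
def wordCode (e : ℕ) (w : List (ℕ × Bool)) : PCode :=
  w.foldr (fun l Z => bif l.2
    then (ssum (genCode e l.1).1 Z.1, ssum (genCode e l.1).2 Z.2)
    else (ssum (genCode e l.1).2 Z.1, ssum (genCode e l.1).1 Z.2)) zeroCode

theorem primrec_genCode : Primrec₂ genCode := by
  refine Primrec.option_getD.comp (Primrec.option_map (Primrec.decode.comp Primrec.snd) ?_)
    (Primrec.const _)
  let δ := (ℕ × ℕ) × (PCode × ℕ)
  have fX : Primrec fun x : δ => x.2.1 := Primrec.fst.comp Primrec.snd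
  exact Primrec.cond (primrec_genCert.comp (Primrec.pair (Primrec.fst.comp Primrec.fst) fX)
    (Primrec.snd.comp Primrec.snd)) (Primrec.pair (primrec_ssymm (Primrec.fst.comp fX))
      (primrec_ssymm (Primrec.snd.comp fX))) (Primrec.const _)

theorem primrec_wordCode : Primrec₂ wordCode := by
  refine Primrec.list_foldr (h := fun (x : ℕ × List (ℕ × Bool)) (y : (ℕ × Bool) × PCode) =>
    bif y.1.2 then (ssum (genCode x.1 y.1.1).1 y.2.1, ssum (genCode x.1 y.1.1).2 y.2.2)
    else (ssum (genCode x.1 y.1.1).2 y.2.1, ssum (genCode x.1 y.1.1).1 y.2.2))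
    Primrec.snd (Primrec.const zeroCode) ?_
  let δ := (ℕ × List (ℕ × Bool)) × ((ℕ × Bool) × PCode)
  have fg : Primrec fun x : δ => genCode x.1.1 x.2.1.1 := primrec_genCode.comp
    (Primrec.fst.comp Primrec.fst) (Primrec.fst.comp (Primrec.fst.comp Primrec.snd))
  have fZ : Primrec fun x : δ => x.2.2 := Primrec.snd.comp Primrec.snd
  have f1 := Primrec.fst.comp fg
  have f2 := Primrec.snd.comp fg
  have g1 := Primrec.fst.comp fZ
  have g2 := Primrec.snd.comp fZ
  exact Primrec.cond (Primrec.snd.comp (Primrec.fst.comp Primrec.snd))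
    (Primrec.pair (primrec_ssum f1 g1) (primrec_ssum f2 g2))
    (Primrec.pair (primrec_ssum f2 g1) (primrec_ssum f1 g2))

/-- The pair `X` of codes represents the element `z` of `K₀`. -/
def PairRep {U : Type*} [CStarAlgebra U] (b : ℕ → U) (X : PCode) (z : UnitalK0 U) : Prop :=
  ∃ x y, Rep b X.1 x ∧ Rep b X.2 y ∧ z = diff x y

theorem PairRep.zero {U : Type*} [CStarAlgebra U] (b : ℕ → U) : PairRep b zeroCode 0 :=
  ⟨0, 0, Rep.zero b, Rep.zero b, (sub_self _).symm⟩

theorem PairRep.add {U : Type*} [CStarAlgebra U] {b : ℕ → U} {X Y : PCode} {z z' : UnitalK0 U}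
    (h : PairRep b X z) (h' : PairRep b Y z') :
    PairRep b (ssum X.1 Y.1, ssum X.2 Y.2) (z + z') := by
  obtain ⟨x, y, hx, hy, rfl⟩ := h
  obtain ⟨x', y', hx', hy', rfl⟩ := h'
  exact ⟨_, _, hx.ssum hx', hy.ssum hy', by simp only [diff, map_add]; abel⟩

theorem PairRep.neg {U : Type*} [CStarAlgebra U] {b : ℕ → U} {X : PCode} {z : UnitalK0 U}
    (h : PairRep b X z) : PairRep b (X.2, X.1) (-z) := by
  obtain ⟨x, y, hx, hy, rfl⟩ := h
  exact ⟨y, x, hy, hx, neg_sub _ _⟩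

theorem PairRep.unique {U : Type*} [CStarAlgebra U] {b : ℕ → U} {X : PCode} {z z' : UnitalK0 U}
    (h : PairRep b X z) (h' : PairRep b X z') : z = z' := by
  obtain ⟨x, y, hx, hy, rfl⟩ := h
  obtain ⟨x', y', hx', hy', rfl⟩ := h'
  rw [hx.unique hx', hy.unique hy']

theorem PairRep.diffTest_iff {U : Type*} [CStarAlgebra U] {b : ℕ → U} {T : StarPoly → ℕ → Prop}
    (hT : IsNormTest b T) (hb : DenseRange (peval b)) {X Y : PCode} {z z' : UnitalK0 U}
    (h : PairRep b X z) (h' : PairRep b Y z') : DiffTest T X Y ↔ z = z' := by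
  obtain ⟨x, y, hx, hy, rfl⟩ := h
  obtain ⟨x', y', hx', hy', rfl⟩ := h'
  exact EffectiveK.diffTest_iff hT hb hx hy hx' hy'

variable {A : Type*} [NonUnitalCStarAlgebra A] {P : CStarPresentation A} {e : ℕ}

/-- The special points of the unitization of the suspension. -/
abbrev lpt (P : CStarPresentation A) : ℕ → Unitization ℂ (Suspension A) :=
  unitizationPt (suspensionPt P)

theorem suspensionPt_zeroPt (P : CStarPresentation A) : suspensionPt P zeroPt = 0 := by
  rw [zeroPt, suspensionPt_encode]
  ext t
  simp [tensor, RatPoly.eval]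

theorem lpt_unitPt (P : CStarPresentation A) : lpt P unitPt = 1 := by
  rw [lpt, unitPt, unitizationPt_encode, suspensionPt_zeroPt, val_gint, Int.cast_one,
    Unitization.inr_zero, add_zero, Unitization.inl_one]

theorem lpt_scalarPt (P : CStarPresentation A) (n : ℕ) :
    lpt P (scalarPt n) = scalarHom (Suspension A) (lpt P n) := by
  rw [lpt, scalarPt, unitizationPt_encode, suspensionPt_zeroPt, Unitization.inr_zero, add_zero,
    letterPt_eq]
  change _ = algebraMap ℂ _ (Unitization.inl _ + Unitization.inr _ : Unitization ℂ (Suspension A)).fst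
  simp [Unitization.algebraMap_eq_inl]

theorem Rep.scalar {X : SCode} {x : MvNSemigroup (Unitization ℂ (Suspension A))}
    (h : Rep (lpt P) X x) :
    Rep (lpt P) (EffectiveK.sren scalarPt X) (MvNSemigroup.map (scalarHom (Suspension A)) x) := by
  refine Rep.sren ?_
  simp only [lpt_scalarPt]
  exact h.map _

/-- A valid pair of codes represents an element of `K₁`, since the test includes a certificate that the
scalar part of the difference vanishes. -/
theorem genValid_rep (he : P.IsIndex e) {X : PCode} (h : GenValid e X) :
    ∃ z : K1 A, PairRep (lpt P) (ssymm X.1, ssymm X.2) z.1 := by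
  obtain ⟨h1, h2, h3⟩ := h
  obtain ⟨x, hx⟩ := h1.exists_rep (isNormTest he)
  obtain ⟨y, hy⟩ := h2.exists_rep (isNormTest he)
  refine ⟨⟨diff x y, ?_⟩, x, y, hx, hy, rfl⟩
  rw [mem_K0_iff, map_diff]
  exact (PairRep.diffTest_iff (isNormTest he) (denseRange_peval P)
    ⟨_, _, hx.scalar, hy.scalar, rfl⟩ (PairRep.zero _)).1 h3

theorem genCode_rep (he : P.IsIndex e) (i : ℕ) :
    ∃ z : K1 A, PairRep (lpt P) (genCode e i) z.1 := by
  unfold genCode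
  cases (Encodable.decode i : Option (PCode × ℕ)) with
  | none => exact ⟨0, PairRep.zero _⟩
  | some x =>
    simp only [Option.map_some, Option.getD_some]
    cases hx : genCert (e, x.1) x.2 with
    | false => exact ⟨0, PairRep.zero _⟩
    | true => exact genValid_rep he (genValid_iff.2 ⟨_, hx⟩)

theorem genValid_of_rep (he : P.IsIndex e) {X : PCode} {z : K1 A} (h1 : SValid (NormTest e) X.1)
    (h2 : SValid (NormTest e) X.2) (h : PairRep (lpt P) (ssymm X.1, ssymm X.2) z.1) :
    GenValid e X := by
  obtain ⟨x, y, hx, hy, hz⟩ := h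
  refine ⟨h1, h2, (PairRep.diffTest_iff (isNormTest he) (denseRange_peval P)
    ⟨_, _, hx.scalar, hy.scalar, rfl⟩ (PairRep.zero _)).2 ?_⟩
  rw [← map_diff, ← hz]
  exact mem_K0_iff.1 z.2

theorem genCode_encode {X : PCode} {s : ℕ} (h : genCert (e, X) s = true) :
    genCode e (Encodable.encode (X, s)) = (ssymm X.1, ssymm X.2) := by
  simp only [genCode, Encodable.encodek, Option.map_some, Option.getD_some, h, cond_true]

/-- The element of `K₁` that is the generator with number `i`. -/
def genVal (he : P.IsIndex e) (i : ℕ) : K1 A := (genCode_rep he i).choose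

theorem pairRep_genVal (he : P.IsIndex e) (i : ℕ) :
    PairRep (lpt P) (genCode e i) (genVal he i).1 := (genCode_rep he i).choose_spec

theorem genVal_encode (he : P.IsIndex e) {X : PCode} {s : ℕ} (h : genCert (e, X) s = true)
    {z : K1 A} (hz : PairRep (lpt P) (ssymm X.1, ssymm X.2) z.1) :
    genVal he (Encodable.encode (X, s)) = z := by
  have h1 := pairRep_genVal he (Encodable.encode (X, s))
  rw [genCode_encode h] at h1
  exact Subtype.ext (h1.unique hz)

theorem exists_genVal_eq (he : P.IsIndex e) (z : K1 A) : ∃ i, genVal he i = z := by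
  obtain ⟨x, y, hz⟩ := exists_eq_diff z.1
  obtain ⟨X, hX, hx⟩ := exists_valid_rep (isNormTest he) (denseRange_peval P) x
  obtain ⟨Y, hY, hy⟩ := exists_valid_rep (isNormTest he) (denseRange_peval P) y
  have h : PairRep (lpt P) (ssymm X, ssymm Y) z.1 := ⟨x, y, hx, hy, hz⟩
  obtain ⟨s, hs⟩ := genValid_iff.1 (genValid_of_rep he (X := (X, Y)) hX hY h)
  exact ⟨_, genVal_encode he hs h⟩

/-- The presentation of `K₁(A)` induced by a presentation of `A` with index `e`. -/
def k1Pres (he : P.IsIndex e) : GroupPresentation (Multiplicative (K1 A)) where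
  hom := FreeGroup.lift fun i => Multiplicative.ofAdd (genVal he i)
  surj z := by
    obtain ⟨i, hi⟩ := exists_genVal_eq he z.toAdd
    exact ⟨FreeGroup.of i, by rw [FreeGroup.lift_apply_of, hi]; rfl⟩

theorem pairRep_wordCode (he : P.IsIndex e) (w : List (ℕ × Bool)) :
    PairRep (lpt P) (wordCode e w) ((k1Pres he).val w).toAdd.1 := by
  induction w with
  | nil => exact PairRep.zero _
  | cons l w ih =>
    have h : (k1Pres he).val (l :: w) = (bif l.2 then Multiplicative.ofAdd (genVal he l.1)
        else (Multiplicative.ofAdd (genVal he l.1))⁻¹) * (k1Pres he).val w := by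
      simp only [GroupPresentation.val, k1Pres, FreeGroup.lift_mk, List.map_cons, List.prod_cons]
    rw [h]
    rcases l with ⟨i, _ | _⟩
    · exact (pairRep_genVal he i).neg.add ih
    · exact (pairRep_genVal he i).add ih

/-- An index of the presentation of `K₁` can be computed: equality of labels is semidecidable. -/
theorem exists_k1Pres_index : ∃ f : ℕ → ℕ, Primrec f ∧
    ∀ (A : Type u) [NonUnitalCStarAlgebra A] (P : CStarPresentation A) (e : ℕ)
      (he : P.IsIndex e), (k1Pres he).IsIndex (f e) := by
  obtain ⟨f, hf, h⟩ := SigmaOne.exists_W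
    (R := fun (e : ℕ) (w : List (ℕ × Bool) × List (ℕ × Bool)) =>
      DiffTest (NormTest e) (wordCode e w.1) (wordCode e w.2))
    (sigmaOne_diffTest sigmaOne_normTest Primrec.fst
      (primrec_wordCode.comp Primrec.fst (Primrec.fst.comp Primrec.snd))
      (primrec_wordCode.comp Primrec.fst (Primrec.snd.comp Primrec.snd)))
  refine ⟨f, hf, fun A _ P e he w w' => (h e (w, w')).trans ?_⟩
  refine (PairRep.diffTest_iff (isNormTest he) (denseRange_peval P) (pairRep_wordCode he w)
    (pairRep_wordCode he w')).trans ?_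
  exact Subtype.val_inj.trans Multiplicative.toAdd.injective.eq_iff

/-- A code gives an index of a projection of the class that it represents: the iterates converge at a
known rate. -/
theorem exists_projIndex : ∃ c : SCode → ℕ, Primrec c ∧
    ∀ (A : Type u) [NonUnitalCStarAlgebra A] (P : CStarPresentation A) (X : SCode)
      (x : MvNSemigroup (Unitization ℂ (Suspension A))), Rep (lpt P) X x →
      ∃ p : Proj (Unitization ℂ (Suspension A)), p.n = X.1 ∧ IsProjIndex (lpt P) p (c X) ∧
        MvNSemigroup.mk p = x := by
  have hF : Primrec fun y : SCode × (ℕ × ℕ × ℕ) =>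
      toRat unitPt (ent (newtonIter y.1.1 y.2.1 y.1.2) y.2.2.1 y.2.2.2) :=
    (primrec_toRat unitPt).comp (primrec_ent (primrec_newtonIter (Primrec.fst.comp Primrec.fst)
      (Primrec.fst.comp Primrec.snd) (Primrec.snd.comp Primrec.fst))
      (Primrec.fst.comp (Primrec.snd.comp Primrec.snd))
      (Primrec.snd.comp (Primrec.snd.comp Primrec.snd)))
  obtain ⟨c, hc, h⟩ := exists_index (Computable.partrec hF.to_comp)
  refine ⟨c, hc, ?_⟩
  rintro A _ P ⟨n, L⟩ _ ⟨p, hp, rfl⟩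
  refine ⟨hp.proj, rfl, fun k i j => ⟨_, (h (n, L) (k, (i : ℕ), (j : ℕ))).trans (Part.map_some _ _),
    ?_⟩, rfl⟩
  rw [eval_toRat _ (lpt_unitPt P), norm_sub_rev]
  exact hp.lt k i j

/-- The labels stand, effectively, for differences of projections. -/
theorem exists_supports : ∃ s : ℕ × List (ℕ × Bool) → (ℕ × ℕ) × (ℕ × ℕ), Primrec s ∧
    ∀ (A : Type u) [NonUnitalCStarAlgebra A] (P : CStarPresentation A) (e : ℕ)
      (he : P.IsIndex e), Supports P (k1Pres he) fun w => s (e, w) := by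
  obtain ⟨c, hc, h⟩ := exists_projIndex.{u}
  refine ⟨fun x => (((wordCode x.1 x.2).1.1, c (wordCode x.1 x.2).1),
    ((wordCode x.1 x.2).2.1, c (wordCode x.1 x.2).2)), ?_, fun A _ P e he w => ?_⟩
  · have h1 := Primrec.fst.comp primrec_wordCode
    have h2 := Primrec.snd.comp primrec_wordCode
    exact Primrec.pair (Primrec.pair (Primrec.fst.comp h1) (hc.comp h1))
      (Primrec.pair (Primrec.fst.comp h2) (hc.comp h2))
  · obtain ⟨x, y, hx, hy, hz⟩ := pairRep_wordCode he w
    obtain ⟨p, hp1, hp2, rfl⟩ := h A P _ _ hx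
    obtain ⟨q, hq1, hq2, rfl⟩ := h A P _ _ hy
    exact ⟨p, q, hp1, hp2, hq1, hq2, hz⟩

end Generators

/-! ### Images of codes under a computable homomorphism -/

section Image

/-- The special point with the same data as the special point with number `n`, but with `q` as the
second factor of the elementary tensor. -/
def imagePt (n : ℕ) (q : RatPoly) : ℕ :=
  Encodable.encode (Encodable.encode ((letterData n).2.1, q), (letterData n).1)

/-- The special point with number `n'` is the image, up to `2⁻ᵏ`, of the special point with number
`n`, as computed by the algorithm `d`. -/
def LetterImage (d k n n' : ℕ) : Prop :=
  ∃ q : RatPoly, Encodable.encode q ∈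
      phi d (Encodable.encode ((letterData n).2.2, k + curveBound (letterData n).2.1)) ∧
    n' = imagePt n q

/-- The code of the Gaussian rational `1 / 2`. -/
def ghalf : GaussCode := ((1, 0), 1)

/-- The code `Y` is half of an approximate image of the code `X`: it arises from some iterate of `X`
by a renaming of the variables, which is given by the list `t`. The bound `K` is certified for the
variables of the source, where it does not depend on the precision `k`; the variables of the target
are then bounded by `K + 1`. -/
def ImageTest (e d : ℕ) (X Y : SCode) : Prop :=
  ∃ (M K k : ℕ) (t : List ℕ), 4 * X.1 + 2 ≤ M ∧
    LettersBelow e ((newtonIter X.1 M X.2).map Prod.snd) K ∧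
    (∀ l ∈ ((newtonIter X.1 M X.2).map Prod.snd).flatMap Prod.snd,
      LetterImage d k l.1 (t.getD l.1 0)) ∧
    (∀ i ∈ List.range X.1, ∀ j ∈ List.range X.1,
      polyBound (K + 1) (ent (newtonIter X.1 M X.2) i j) * 2 ^ (4 * X.1 + 2) ≤ 2 ^ k) ∧
    Y = (X.1, msmul ghalf (mren (fun n => t.getD n 0) (newtonIter X.1 M X.2)))

variable {A B : Type*} [NonUnitalCStarAlgebra A] [NonUnitalCStarAlgebra B]
  {P : CStarPresentation A} {P' : CStarPresentation B} {φ : A →⋆ₙₐ[ℂ] B} {e e' d : ℕ}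

theorem lpt_imagePt (P : CStarPresentation A) (n : ℕ) (q : RatPoly) : lpt P (imagePt n q) =
    Unitization.inl (letterData n).1.val +
      Unitization.inr (tensor (RatPoly.eval curvePt (letterData n).2.1) (P.ratPt q)) := by
  rw [lpt, imagePt, unitizationPt_encode, suspensionPt_encode]

theorem suspUnit_lpt (P : CStarPresentation A) (φ : A →⋆ₙₐ[ℂ] B) (n : ℕ) : suspUnit φ (lpt P n) =
    Unitization.inl (letterData n).1.val + Unitization.inr
      (tensor (RatPoly.eval curvePt (letterData n).2.1) (φ (P.ratPt (letterData n).2.2))) := by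
  rw [lpt, letterPt_eq, suspUnit_inl_add_inr]
  congr 2
  ext t
  exact map_smul φ _ _

theorem nat_mul_pow_half_le (C k : ℕ) : (C : ℝ) * 2⁻¹ ^ (k + C) ≤ 2⁻¹ ^ k := by
  have h2 : (C : ℝ) * 2⁻¹ ^ C ≤ 1 := by
    rw [inv_pow, ← div_eq_mul_inv, div_le_one (by positivity)]
    exact_mod_cast Nat.lt_two_pow_self.le
  have h3 := mul_le_mul_of_nonneg_right h2 (pow_half_pos k).le
  rw [pow_add]
  linarith

theorem LetterImage.norm_sub_le (hd : CStarPresentation.IsMapIndex P P' φ d) {k n n' : ℕ}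
    (h : LetterImage d k n n') : ‖suspUnit φ (lpt P n) - lpt P' n'‖ ≤ 2⁻¹ ^ k := by
  obtain ⟨q, hq, rfl⟩ := h
  obtain ⟨q', hq', hlt⟩ := hd (letterData n).2.2 (k + curveBound (letterData n).2.1)
  rw [hq', Part.mem_some_iff] at hq
  obtain rfl := Encodable.encode_injective hq
  rw [suspUnit_lpt, lpt_imagePt, add_sub_add_left_eq_sub, ← Unitization.inr_sub,
    Unitization.norm_inr]
  refine norm_zeroAtInfty_le (by positivity) fun t => ?_
  change ‖curveVal (letterData n).2.1 t • φ (P.ratPt (letterData n).2.2) -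
    curveVal (letterData n).2.1 t • P'.ratPt q‖ ≤ _
  rw [← smul_sub, norm_smul]
  exact (mul_le_mul (norm_curveVal_le _ t) hlt.le (norm_nonneg _) (Nat.cast_nonneg _)).trans
    (nat_mul_pow_half_le _ k)

theorem exists_letterImage (hd : CStarPresentation.IsMapIndex P P' φ d) (k n : ℕ) :
    ∃ n', LetterImage d k n n' := by
  obtain ⟨q', hq', -⟩ := hd (letterData n).2.2 (k + curveBound (letterData n).2.1)
  exact ⟨_, q', by rw [hq']; exact Part.mem_some _, rfl⟩

theorem mem_of_mem_ent {L : MCode} {i j : ℕ} {x : Mono} (hx : x ∈ ent L i j) :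
    x ∈ L.map Prod.snd := by
  obtain ⟨y, hy, rfl⟩ := List.mem_map.1 hx
  exact List.mem_map.2 ⟨y, (List.mem_filter.1 hy).1, rfl⟩

theorem norm_image_sub_le (he : P.IsIndex e) (hd : CStarPresentation.IsMapIndex P P' φ d)
    {n K k : ℕ} {f : ℕ → ℕ} {L : MCode} (hK : LettersBelow e (L.map Prod.snd) K)
    (hf : ∀ l ∈ (L.map Prod.snd).flatMap Prod.snd, LetterImage d k l.1 (f l.1)) (i j : Fin n) :
    ‖meval (lpt P') n n (mren f L) i j - suspUnit φ (meval (lpt P) n n L i j)‖ ≤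
      polyBound (K + 1) (ent L i j) * 2⁻¹ ^ k := by
  rw [norm_sub_rev, meval_mren, meval_apply, meval_apply, peval_map]
  have h1 (x) (hx : x ∈ ent L i j) (l : Letter) (hl : l ∈ x.2) :
      ‖suspUnit φ (lpt P l.1)‖ ≤ K :=
    (NonUnitalStarAlgHom.norm_apply_le _ _).trans ((hK.letter (mem_of_mem_ent hx) hl).norm_le he).1
  have h2 (x) (hx : x ∈ ent L i j) (l : Letter) (hl : l ∈ x.2) :
      ‖suspUnit φ (lpt P l.1) - lpt P' (f l.1)‖ ≤ 2⁻¹ ^ k :=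
    (hf l (List.mem_flatMap.2 ⟨x, mem_of_mem_ent hx, hl⟩)).norm_sub_le hd
  refine norm_peval_sub_le (Nat.le_add_left 1 K) (pow_half_pos k).le (fun x hx l hl => ?_)
    (fun x hx l hl => ?_) h2
  · push_cast
    exact (h1 x hx l hl).trans (by linarith)
  · have h3 : (2⁻¹ : ℝ) ^ k ≤ 1 := pow_le_one₀ (by norm_num) (by norm_num)
    have h4 := norm_sub_norm_le (lpt P' (f l.1)) (suspUnit φ (lpt P l.1))
    rw [norm_sub_rev] at h4
    push_cast
    linarith [h1 x hx l hl, h2 x hx l hl]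

theorem val_ghalf : ghalf.val = 2⁻¹ := by
  norm_num [ghalf, GaussCode.val]

theorem norm_symm_half_sub_le {U : Type*} [CStarAlgebra U] {b : ℕ → U} {n : ℕ} {L : MCode}
    {p : Matrix (Fin n) (Fin n) U} (hp : pᴴ = p) {ε : ℝ}
    (h : ∀ i j, ‖meval b n n L i j - p i j‖ ≤ ε) (i j : Fin n) :
    ‖meval b n n (msymm (msmul ghalf L)) i j - p i j‖ ≤ ε := by
  have hji : p i j = star (p j i) := by
    conv_lhs => rw [← hp]
    rfl
  have e : meval b n n (msymm (msmul ghalf L)) i j - p i j =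
      (2⁻¹ : ℂ) • (meval b n n L i j - p i j) + (2⁻¹ : ℂ) • star (meval b n n L j i - p j i) := by
    have h2 : p i j = (2⁻¹ : ℂ) • p i j + (2⁻¹ : ℂ) • p i j := by
      rw [← add_smul]
      norm_num
    rw [meval_msymm, Matrix.add_apply, Matrix.conjTranspose_apply, meval_msmul, Matrix.smul_apply,
      Matrix.smul_apply, val_ghalf, star_smul, star_sub, smul_sub, smul_sub, ← hji]
    conv_lhs => rw [h2]
    rw [show star (2⁻¹ : ℂ) = 2⁻¹ by simp]
    abel
  rw [e]
  refine (norm_add_le _ _).trans ?_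
  rw [norm_smul, norm_smul, norm_star]
  have h1 := h i j
  have h2 := h j i
  norm_num
  linarith

/-- The total error `2⁻¹ ^ (4 * n + 1)` of an approximate image is small enough to determine the class of
its limit. -/
theorem ImageTest.rep (he : P.IsIndex e) (he' : P'.IsIndex e')
    (hd : CStarPresentation.IsMapIndex P P' φ d) {X Y : SCode}
    {x : MvNSemigroup (Unitization ℂ (Suspension A))} (hx : Rep (lpt P) X x)
    (h : ImageTest e d X Y) (hY : SValid (NormTest e') Y) :
    Rep (lpt P') (ssymm Y) (MvNSemigroup.map (suspUnit φ) x) := by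
  obtain ⟨M, K, k, t, hM, hK, ht, hk, rfl⟩ := h
  obtain ⟨p, hp, rfl⟩ := hx
  obtain ⟨n, L⟩ := X
  simp only at hM hK ht hk hY p hp
  have hq := hp.map (suspUnit φ)
  obtain ⟨y, hy⟩ := hY.exists_rep (isNormTest he')
  have h1 (i j : Fin n) : ‖meval (lpt P') n n (mren (fun n => t.getD n 0) (newtonIter n M L)) i j -
      (p.map (suspUnit φ)) i j‖ ≤ 2⁻¹ ^ (4 * n + 1) := by
    have h2 := norm_image_sub_le he hd (f := fun n => t.getD n 0) hK ht i j
    have h3 : (polyBound (K + 1) (ent (newtonIter n M L) i j) : ℝ) * 2⁻¹ ^ k ≤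
        2⁻¹ ^ (4 * n + 2) := by
      have h4 : (polyBound (K + 1) (ent (newtonIter n M L) i j) : ℝ) * 2 ^ (4 * n + 2) ≤ 2 ^ k := by
        exact_mod_cast hk i (List.mem_range.2 i.2) j (List.mem_range.2 j.2)
      rw [inv_pow, inv_pow, ← div_eq_mul_inv, div_le_iff₀ (by positivity), ← div_eq_inv_mul,
        le_div_iff₀ (by positivity)]
      exact h4
    have h5 : ‖suspUnit φ (meval (lpt P) n n (newtonIter n M L) i j) - suspUnit φ (p i j)‖ ≤
        2⁻¹ ^ (4 * n + 2) := by
      rw [← map_sub]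
      exact (NonUnitalStarAlgHom.norm_apply_le _ _).trans ((hp.lt M i j).le.trans
        (pow_le_pow_of_le_one (by norm_num) (by norm_num) hM))
    have h6 := norm_sub_le_norm_sub_add_norm_sub
      (meval (lpt P') n n (mren (fun n => t.getD n 0) (newtonIter n M L)) i j)
      (suspUnit φ (meval (lpt P) n n (newtonIter n M L) i j)) (suspUnit φ (p i j))
    have h7 : (2⁻¹ : ℝ) ^ (4 * n + 1) = 2⁻¹ ^ (4 * n + 2) + 2⁻¹ ^ (4 * n + 2) := by
      rw [pow_succ _ (4 * n + 1)]
      ring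
    rw [h7]
    exact h6.trans (add_le_add (h2.trans h3) h5)
  have h2 := SValid.eq_of_close (isNormTest he') hY hy hq.selfAdj hq.idem
    (norm_symm_half_sub_le hq.selfAdj h1)
  rw [← h2] at hy
  exact hy

/-- Images of late iterates, computed with high precision, pass both tests. -/
theorem exists_imageTest (he : P.IsIndex e) (he' : P'.IsIndex e')
    (hd : CStarPresentation.IsMapIndex P P' φ d) {X : SCode}
    {x : MvNSemigroup (Unitization ℂ (Suspension A))} (hx : Rep (lpt P) X x) :
    ∃ Y, ImageTest e d X Y ∧ SValid (NormTest e') Y := by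
  obtain ⟨p, hp, rfl⟩ := hx
  obtain ⟨n, L⟩ := X
  simp only at p hp
  have hq := hp.map (suspUnit φ)
  have key (M : ℕ) : ∃ (K k : ℕ) (t : List ℕ),
      LettersBelow e ((newtonIter n M L).map Prod.snd) K ∧
      (∀ l ∈ ((newtonIter n M L).map Prod.snd).flatMap Prod.snd,
        LetterImage d k l.1 (t.getD l.1 0)) ∧
      ∀ i ∈ List.range n, ∀ j ∈ List.range n,
        polyBound (K + 1) (ent (newtonIter n M L) i j) * 2 ^ (4 * n + 2 + M) ≤ 2 ^ k := by
    obtain ⟨K, hK⟩ := exists_lettersBelow he ((newtonIter n M L).map Prod.snd)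
    set B := ∑ i ∈ Finset.range n, ∑ j ∈ Finset.range n,
      polyBound (K + 1) (ent (newtonIter n M L) i j) * 2 ^ (4 * n + 2 + M) with hB
    choose g hg using exists_letterImage hd B
    obtain ⟨m, hm⟩ : ∃ m, ∀ l ∈ ((newtonIter n M L).map Prod.snd).flatMap Prod.snd, l.1 < m := by
      refine ⟨((((newtonIter n M L).map Prod.snd).flatMap Prod.snd).map Prod.fst).sum + 1,
        fun l hl => Nat.lt_succ_of_le (List.le_sum_of_mem (List.mem_map.2 ⟨l, hl, rfl⟩))⟩
    refine ⟨K, B, (List.range m).map g, hK, fun l hl => ?_, fun i hi j hj => ?_⟩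
    · have : ((List.range m).map g).getD l.1 0 = g l.1 := by
        simp [List.getD, hm l hl]
      rw [this]
      exact hg l.1
    · refine le_trans ?_ Nat.lt_two_pow_self.le
      rw [hB]
      refine le_trans ?_ (Finset.single_le_sum (f := fun i => ∑ j ∈ Finset.range n,
        polyBound (K + 1) (ent (newtonIter n M L) i j) * 2 ^ (4 * n + 2 + M))
        (fun _ _ => Nat.zero_le _) (Finset.mem_range.2 (List.mem_range.1 hi)))
      exact Finset.single_le_sum (f := fun j =>
        polyBound (K + 1) (ent (newtonIter n M L) i j) * 2 ^ (4 * n + 2 + M))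
        (fun _ _ => Nat.zero_le _) (Finset.mem_range.2 (List.mem_range.1 hj))
  choose K k t hK ht hk using key
  let y (M : ℕ) : MCode := msmul ghalf (mren (fun n => (t M).getD n 0) (newtonIter n M L))
  have hy : Filter.Tendsto (fun M => meval (lpt P') n n (y M)) Filter.atTop
      (nhds ((2⁻¹ : ℂ) • p.map (suspUnit φ))) := by
    simp only [y, meval_msmul, val_ghalf]
    refine Filter.Tendsto.const_smul ?_ _
    refine tendsto_pi_nhds.2 fun i => tendsto_pi_nhds.2 fun j => ?_
    rw [tendsto_iff_norm_sub_tendsto_zero]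
    have h0 : Filter.Tendsto (fun M : ℕ => (2⁻¹ : ℝ) ^ M + 2⁻¹ ^ M) Filter.atTop (nhds 0) := by
      have := tendsto_pow_atTop_nhds_zero_of_lt_one (r := (2⁻¹ : ℝ)) (by norm_num) (by norm_num)
      simpa using this.add this
    refine squeeze_zero (fun _ => norm_nonneg _) (fun M => ?_) h0
    have h2 := norm_image_sub_le he hd (f := fun n => (t M).getD n 0) (hK M) (ht M) i j
    have h3 : (polyBound (K M + 1) (ent (newtonIter n M L) i j) : ℝ) * 2⁻¹ ^ k M ≤ 2⁻¹ ^ M := by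
      have h4 : (polyBound (K M + 1) (ent (newtonIter n M L) i j) : ℝ) * 2 ^ (4 * n + 2 + M) ≤
          2 ^ k M := by exact_mod_cast hk M i (List.mem_range.2 i.2) j (List.mem_range.2 j.2)
      rw [inv_pow, inv_pow, ← div_eq_mul_inv, div_le_iff₀ (by positivity), ← div_eq_inv_mul,
        le_div_iff₀ (by positivity)]
      refine le_trans ?_ h4
      gcongr
      · norm_num
      · omega
    have h5 : ‖suspUnit φ (meval (lpt P) n n (newtonIter n M L) i j) - suspUnit φ (p i j)‖ ≤
        2⁻¹ ^ M := by
      rw [← map_sub]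
      exact (NonUnitalStarAlgHom.norm_apply_le _ _).trans (hp.lt M i j).le
    exact (norm_sub_le_norm_sub_add_norm_sub _
      (suspUnit φ (meval (lpt P) n n (newtonIter n M L) i j)) _).trans
      (add_le_add (h2.trans h3) h5)
  obtain ⟨M, hM1, hM2⟩ := ((eventually_validTest (isNormTest he') hq.selfAdj hq.idem hy).and
    (Filter.eventually_ge_atTop (4 * n + 2))).exists
  refine ⟨(n, y M), ⟨M, K M, k M, t M, hM2, hK M, ht M, fun i hi j hj => ?_, rfl⟩, hM1⟩
  exact (Nat.mul_le_mul_left _ (Nat.pow_le_pow_right two_pos (Nat.le_add_right _ M))).trans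
    (hk M i hi j hj)

/-- The one-letter word `w'` labels an image, under the homomorphism with index `d`, of the element
with label `w`. -/
def ImageWord (x : (ℕ × ℕ × ℕ) × List (ℕ × Bool)) (w' : List (ℕ × Bool)) : Prop :=
  ∃ y : PCode × ℕ, w' = [(Encodable.encode y, true)] ∧
    genCert (x.1.2.1, y.1) y.2 = true ∧
    ImageTest x.1.1 x.1.2.2 (wordCode x.1.1 x.2).1 y.1.1 ∧
    ImageTest x.1.1 x.1.2.2 (wordCode x.1.1 x.2).2 y.1.2

theorem ImageWord.val_eq (he : P.IsIndex e) (he' : P'.IsIndex e')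
    (hd : CStarPresentation.IsMapIndex P P' φ d) {w w' : List (ℕ × Bool)}
    (h : ImageWord ((e, e', d), w) w') :
    (k1Pres he').val w' = AddMonoidHom.toMultiplicative (K1.map φ) ((k1Pres he).val w) := by
  obtain ⟨⟨Y, s⟩, rfl, hs, h1, h2⟩ := h
  simp only at hs h1 h2
  obtain ⟨hv1, hv2, -⟩ := genValid_iff.2 ⟨s, hs⟩
  obtain ⟨x, y, hx, hy, hz⟩ := pairRep_wordCode he w
  have e1 : genVal he' (Encodable.encode (Y, s)) = K1.map φ ((k1Pres he).val w).toAdd := by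
    refine genVal_encode he' hs ⟨_, _, h1.rep he he' hd hx hv1, h2.rep he he' hd hy hv2, ?_⟩
    rw [K1.coe_map, ← map_diff]
    exact congrArg _ hz
  have e2 : (k1Pres he').val [(Encodable.encode (Y, s), true)] =
      Multiplicative.ofAdd (genVal he' (Encodable.encode (Y, s))) := by
    simp [GroupPresentation.val, k1Pres, FreeGroup.lift_mk]
  rw [e2, e1]
  rfl

theorem exists_imageWord (he : P.IsIndex e) (he' : P'.IsIndex e')
    (hd : CStarPresentation.IsMapIndex P P' φ d) (w : List (ℕ × Bool)) :
    ∃ w', ImageWord ((e, e', d), w) w' := by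
  obtain ⟨x, y, hx, hy, hz⟩ := pairRep_wordCode he w
  obtain ⟨Y1, h1, hv1⟩ := exists_imageTest he he' hd hx
  obtain ⟨Y2, h2, hv2⟩ := exists_imageTest he he' hd hy
  have h3 : PairRep (lpt P') (ssymm Y1, ssymm Y2) (K1.map φ ((k1Pres he).val w).toAdd).1 := by
    refine ⟨_, _, h1.rep he he' hd hx hv1, h2.rep he he' hd hy hv2, ?_⟩
    rw [K1.coe_map, ← map_diff]
    exact congrArg _ hz
  obtain ⟨s, hs⟩ := genValid_iff.1 (genValid_of_rep he' (X := (Y1, Y2)) hv1 hv2 h3)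
  exact ⟨_, ((Y1, Y2), s), rfl, hs, h1, h2⟩

end Image

section Computability

variable {α : Type*} [Primcodable α]

theorem primrec_imagePt {n : α → ℕ} {q : α → RatPoly} (hn : Primrec n) (hq : Primrec q) :
    Primrec fun a => imagePt (n a) (q a) :=
  have h := primrec_letterData.comp hn
  Primrec.encode.comp (Primrec.pair (Primrec.encode.comp (Primrec.pair
    (Primrec.fst.comp (Primrec.snd.comp h)) hq)) (Primrec.fst.comp h))

theorem sigmaOne_letterImage {d k n n' : α → ℕ} (hd : Primrec d) (hk : Primrec k) (hn : Primrec n)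
    (hn' : Primrec n') : SigmaOne fun a => LetterImage (d a) (k a) (n a) (n' a) := by
  refine SigmaOne.exists (R := fun a q => _) ?_
  let δ := α × RatPoly
  have fa : Primrec fun x : δ => x.1 := Primrec.fst
  have fq : Primrec fun x : δ => x.2 := Primrec.snd
  have h := primrec_letterData.comp (hn.comp fa)
  refine SigmaOne.and (sigmaOne_phi.comp (f := fun x : δ => (d x.1,
    Encodable.encode ((letterData (n x.1)).2.2, k x.1 + curveBound (letterData (n x.1)).2.1),
      Encodable.encode x.2)) (Primrec.pair (hd.comp fa) (Primrec.pair (Primrec.encode.comp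
        (Primrec.pair (Primrec.snd.comp (Primrec.snd.comp h)) (Primrec.nat_add.comp (hk.comp fa)
          (primrec_curveBound.comp (Primrec.fst.comp (Primrec.snd.comp h))))))
        (Primrec.encode.comp fq)))) (PrimrecPred.sigmaOne ?_)
  exact Primrec.eq.comp (hn'.comp fa) (primrec_imagePt (hn.comp fa) fq)

theorem sigmaOne_imageTest {e d : α → ℕ} {X Y : α → SCode} (he : Primrec e) (hd : Primrec d)
    (hX : Primrec X) (hY : Primrec Y) :
    SigmaOne fun a => ImageTest (e a) (d a) (X a) (Y a) := by
  refine SigmaOne.exists (SigmaOne.exists (SigmaOne.exists (SigmaOne.exists ?_)))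
  let δ := (((α × ℕ) × ℕ) × ℕ) × List ℕ
  have fa : Primrec fun x : δ => x.1.1.1.1 :=
    Primrec.fst.comp (Primrec.fst.comp (Primrec.fst.comp Primrec.fst))
  have fM : Primrec fun x : δ => x.1.1.1.2 :=
    Primrec.snd.comp (Primrec.fst.comp (Primrec.fst.comp Primrec.fst))
  have fK : Primrec fun x : δ => x.1.1.2 := Primrec.snd.comp (Primrec.fst.comp Primrec.fst)
  have fk : Primrec fun x : δ => x.1.2 := Primrec.snd.comp Primrec.fst
  have ft : Primrec fun x : δ => x.2 := Primrec.snd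
  have fn := Primrec.fst.comp (hX.comp fa)
  have fL := primrec_newtonIter fn fM (Primrec.snd.comp (hX.comp fa))
  have fr := Primrec.list_map fL (Primrec.snd.comp Primrec.snd).to₂
  have hl (β : Type _) [Primcodable β] : Primrec fun x : β × Letter => x.2.1 :=
    Primrec.fst.comp Primrec.snd
  refine SigmaOne.and (PrimrecPred.sigmaOne (Primrec.nat_le.comp (primrec_linear 4 2 fn) fM)) ?_
  refine SigmaOne.and (sigmaOne_lettersBelow (he.comp fa) fr fK) ?_
  refine SigmaOne.and (SigmaOne.forall_mem
    (R := fun (x : δ) (l : Letter) => LetterImage (d x.1.1.1.1) x.1.2 l.1 (x.2.getD l.1 0))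
    (sigmaOne_letterImage ((hd.comp fa).comp Primrec.fst) (fk.comp Primrec.fst) (hl δ)
      ((Primrec.list_getD 0).comp (ft.comp Primrec.fst) (hl δ)))
    (Primrec.list_flatMap fr (Primrec.snd.comp Primrec.snd).to₂)) ?_
  refine SigmaOne.and ?_ (PrimrecPred.sigmaOne (Primrec.eq.comp (hY.comp fa) (Primrec.pair fn
    (primrec_msmul (Primrec.const _) (primrec_mren (f := fun (x : δ) n => x.2.getD n 0)
      ((Primrec.list_getD 0).comp (ft.comp Primrec.fst) Primrec.snd).to₂ fL)))))
  refine SigmaOne.forall_mem (R := fun (x : δ) i => ∀ j ∈ List.range (X x.1.1.1.1).1,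
    polyBound (x.1.1.2 + 1) (ent (newtonIter (X x.1.1.1.1).1 x.1.1.1.2 (X x.1.1.1.1).2) i j) *
      2 ^ (4 * (X x.1.1.1.1).1 + 2) ≤ 2 ^ x.1.2) ?_ (Primrec.list_range.comp fn)
  refine SigmaOne.forall_mem (R := fun (y : δ × ℕ) j =>
    polyBound (y.1.1.1.2 + 1) (ent (newtonIter (X y.1.1.1.1.1).1 y.1.1.1.1.2 (X y.1.1.1.1.1).2)
      y.2 j) * 2 ^ (4 * (X y.1.1.1.1.1).1 + 2) ≤ 2 ^ y.1.1.2) ?_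
    (Primrec.list_range.comp (fn.comp Primrec.fst))
  have f1 : Primrec fun x : (δ × ℕ) × ℕ => x.1.1 := Primrec.fst.comp Primrec.fst
  exact PrimrecPred.sigmaOne (Primrec.nat_le.comp (Primrec.nat_mul.comp
    (primrec_polyBound (Primrec.succ.comp (fK.comp f1)) (primrec_ent (fL.comp f1)
      (Primrec.snd.comp Primrec.fst) Primrec.snd))
    (primrec_pow (Primrec.const 2) ((primrec_linear 4 2 fn).comp f1)))
    (primrec_pow (Primrec.const 2) (fk.comp f1)))

theorem sigmaOne_imageWord :
    SigmaOne fun x : ((ℕ × ℕ × ℕ) × List (ℕ × Bool)) × List (ℕ × Bool) => ImageWord x.1 x.2 := by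
  refine SigmaOne.exists (R := fun x y => _) ?_
  let δ := (((ℕ × ℕ × ℕ) × List (ℕ × Bool)) × List (ℕ × Bool)) × (PCode × ℕ)
  have fc : Primrec fun x : δ => x.1.1.1 := Primrec.fst.comp (Primrec.fst.comp Primrec.fst)
  have fw : Primrec fun x : δ => x.1.1.2 := Primrec.snd.comp (Primrec.fst.comp Primrec.fst)
  have fw' : Primrec fun x : δ => x.1.2 := Primrec.snd.comp Primrec.fst
  have fy : Primrec fun x : δ => x.2 := Primrec.snd
  have fe := Primrec.fst.comp fc
  have fe' := Primrec.fst.comp (Primrec.snd.comp fc)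
  have fd := Primrec.snd.comp (Primrec.snd.comp fc)
  have fY := Primrec.fst.comp fy
  have fX := primrec_wordCode.comp fe fw
  refine SigmaOne.and (PrimrecPred.sigmaOne (Primrec.eq.comp fw' (Primrec.list_cons.comp
    (Primrec.pair (Primrec.encode.comp fy) (Primrec.const true)) (Primrec.const [])))) ?_
  refine SigmaOne.and (PrimrecPred.sigmaOne (Primrec.eq.comp (primrec_genCert.comp
    (Primrec.pair fe' fY) (Primrec.snd.comp fy)) (Primrec.const true))) ?_
  exact SigmaOne.and (sigmaOne_imageTest fe fd (Primrec.fst.comp fX) (Primrec.fst.comp fY))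
    (sigmaOne_imageTest fe fd (Primrec.snd.comp fX) (Primrec.snd.comp fY))

/-- An index of `K₁(φ)` can be computed: an image of a label is found by an unbounded search, which
terminates since every element of `K₁` has a label consisting of one generator. -/
theorem exists_k1Map_index : ∃ g : ℕ × ℕ × ℕ → ℕ, Primrec g ∧
    ∀ (A B : Type u) [NonUnitalCStarAlgebra A] [NonUnitalCStarAlgebra B]
      (P : CStarPresentation A) (P' : CStarPresentation B) (e e' : ℕ)
      (he : P.IsIndex e) (he' : P'.IsIndex e') (φ : A →⋆ₙₐ[ℂ] B) (d : ℕ),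
      CStarPresentation.IsMapIndex P P' φ d →
      GroupPresentation.IsMapIndex (k1Pres he) (k1Pres he')
        (AddMonoidHom.toMultiplicative (K1.map φ)) (g (e, e', d)) := by
  obtain ⟨F, hF, h1, h2⟩ := sigmaOne_imageWord.exists_partrec
  obtain ⟨g, hg, h⟩ := exists_index hF
  refine ⟨g, hg, fun A B _ _ P P' e e' he he' φ d hd w => ?_⟩
  have hdom := h2 ((e, e', d), w) (exists_imageWord he he' hd w)
  refine ⟨(F ((e, e', d), w)).get hdom, ?_, (h1 _ _ (Part.get_mem hdom)).val_eq he he' hd⟩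
  rw [h]
  conv_lhs => rw [← Part.some_get hdom]
  exact Part.map_some _ _

end Computability

/-! ### Independence of the index -/

section Comparison

variable {A : Type u} [NonUnitalCStarAlgebra A] {P : CStarPresentation A} {e e' : ℕ}

theorem exists_isMapIndex_id (P : CStarPresentation A) :
    ∃ d, CStarPresentation.IsMapIndex P P (NonUnitalStarAlgHom.id ℂ A) d := by
  obtain ⟨g, -, h⟩ := exists_index (γ := Unit) (α := RatPoly × ℕ) (β := RatPoly)
    (F := fun x => Part.some x.2.1)
    (Computable.partrec (Primrec.fst.comp Primrec.snd).to_comp)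
  refine ⟨g (), fun p k => ⟨p, (h () (p, k)).trans (Part.map_some _ _), ?_⟩⟩
  change ‖P.ratPt p - P.ratPt p‖ < _
  rw [sub_self, norm_zero]
  exact pow_half_pos k

/-- The presentations that belong to two indices of the same presentation are computably
isomorphic, since the identity is computable. -/
theorem isComputableMap_id (he : P.IsIndex e) (he' : P.IsIndex e') :
    GroupPresentation.IsComputableMap (k1Pres he) (k1Pres he') (MonoidHom.id _) := by
  obtain ⟨g, -, hg⟩ := exists_k1Map_index.{u}
  obtain ⟨d, hd⟩ := exists_isMapIndex_id P
  have h := hg A A P P e e' he he' _ d hd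
  rw [K1.map_id] at h
  exact ⟨_, h⟩

end Comparison

end EffectiveK

end

open EffectiveK in
theorem mainTheorem2 :
    -- `K₁` is a functor from C⋆-algebras to abelian groups
    (∀ (A : Type u) [NonUnitalCStarAlgebra A],
      K1.map (NonUnitalStarAlgHom.id ℂ A) = AddMonoidHom.id (K1 A)) ∧
    (∀ (A B C : Type u) [NonUnitalCStarAlgebra A] [NonUnitalCStarAlgebra B]
      [NonUnitalCStarAlgebra C] (φ : A →⋆ₙₐ[ℂ] B) (ψ : B →⋆ₙₐ[ℂ] C),
      K1.map (ψ.comp φ) = (K1.map ψ).comp (K1.map φ)) ∧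
    -- `Q` sends a c.e. presentation of `A` to a presentation of `K₁(A)`; `N` does the same for a
    -- c.e. presentation that is given by an index; `f` and `g` act on indices
    ∃ (Q : ∀ (A : Type u) [NonUnitalCStarAlgebra A] (P : CStarPresentation A), P.IsCE →
        GroupPresentation (Multiplicative (K1 A)))
      (N : ∀ (A : Type u) [NonUnitalCStarAlgebra A] (P : CStarPresentation A) (e : ℕ),
        P.IsIndex e → GroupPresentation (Multiplicative (K1 A)))
      (f : ℕ → ℕ) (g : ℕ × ℕ × ℕ → ℕ) (s : ℕ × List (ℕ × Bool) → (ℕ × ℕ) × (ℕ × ℕ)),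
      Computable f ∧ Computable g ∧ Computable s ∧
      -- `Q` maps c.e. presentations to c.e. presentations, computable maps to computable maps
      (∀ (A : Type u) [NonUnitalCStarAlgebra A] (P : CStarPresentation A) (hP : P.IsCE),
        (Q A P hP).IsCE) ∧
      (∀ (A B : Type u) [NonUnitalCStarAlgebra A] [NonUnitalCStarAlgebra B]
        (P : CStarPresentation A) (P' : CStarPresentation B) (hP : P.IsCE) (hP' : P'.IsCE)
        (φ : A →⋆ₙₐ[ℂ] B), CStarPresentation.IsComputableMap P P' φ →
        GroupPresentation.IsComputableMap (Q A P hP) (Q B P' hP')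
          (AddMonoidHom.toMultiplicative (K1.map φ))) ∧
      -- `N` represents `Q` up to computable isomorphism over the identity of `K₁(A)`
      (∀ (A : Type u) [NonUnitalCStarAlgebra A] (P : CStarPresentation A) (e : ℕ)
        (he : P.IsIndex e),
        GroupPresentation.IsComputableMap (N A P e he) (Q A P ⟨e, he⟩) (MonoidHom.id _) ∧
        GroupPresentation.IsComputableMap (Q A P ⟨e, he⟩) (N A P e he) (MonoidHom.id _)) ∧
      -- the labels stand, effectively, for differences of projections over the unitization of `SA`
      (∀ (A : Type u) [NonUnitalCStarAlgebra A] (P : CStarPresentation A) (e : ℕ)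
        (he : P.IsIndex e), Supports P (N A P e he) (fun w => s (e, w))) ∧
      -- from an index of an object, `f` computes an index of its image
      (∀ (A : Type u) [NonUnitalCStarAlgebra A] (P : CStarPresentation A) (e : ℕ)
        (he : P.IsIndex e), (N A P e he).IsIndex (f e)) ∧
      -- from indices of a morphism, its source and its target, `g` computes an index of its image
      (∀ (A B : Type u) [NonUnitalCStarAlgebra A] [NonUnitalCStarAlgebra B]
        (P : CStarPresentation A) (P' : CStarPresentation B) (e e' : ℕ)
        (he : P.IsIndex e) (he' : P'.IsIndex e') (φ : A →⋆ₙₐ[ℂ] B) (d : ℕ),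
        CStarPresentation.IsMapIndex P P' φ d →
        GroupPresentation.IsMapIndex (N A P e he) (N B P' e' he')
          (AddMonoidHom.toMultiplicative (K1.map φ)) (g (e, e', d))) := by
  obtain ⟨f, hf, hf'⟩ := exists_k1Pres_index.{u}
  obtain ⟨g, hg, hg'⟩ := exists_k1Map_index.{u}
  obtain ⟨s, hs, hs'⟩ := exists_supports.{u}
  -- the presentation of `K₁` without a given index is that of an arbitrarily chosen index
  refine ⟨fun A _ => K1.map_id, fun A B C _ _ _ φ ψ => K1.map_comp φ ψ,
    fun A _ P hP => k1Pres hP.choose_spec, fun A _ P e he => k1Pres he, f, g, s, hf.to_comp,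
    hg.to_comp, hs.to_comp, fun A _ P hP => ⟨_, hf' A P _ hP.choose_spec⟩, ?_, ?_, hs', hf', hg'⟩
  · rintro A B _ _ P P' hP hP' φ ⟨d, hd⟩
    exact ⟨_, hg' A B P P' _ _ hP.choose_spec hP'.choose_spec φ d hd⟩
  · exact fun A _ P e he => ⟨isComputableMap_id he _, isComputableMap_id _ he⟩
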